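/- **Definitions.** "Polynomial time" means computable by a deterministic Turing machine in time polynomial in the length of the input; $p$ always denotes a polynomial with natural number coefficients, and $L\subseteq\{0,1\}^\star$ a language. * $\#\mathrm{P}$ is the set of functions $f(x)=\sum_{u\in\{0,1\}^{p(|x|)}}T(x,u)$ with $p$ a polynomial and $T$ a polynomial-time $0/1$-valued predicate; $\mathrm{GapP}$ is the set of differences of two $\#\mathrm{P}$ functions. * A function $g:\{0,1\}^\star\to\mathbb R$ *corresponds to a weighted counting problem* ($g\in\#\mathrm{P}_{\mathbb R}$) if $g(x)=\sum_{u\in\{0,1\}^{p(|x|)}}w(x,u)$ for a polynomial $p$ and a weight function $w:\{0,1\}^\star\times\{0,1\}^\star\to\mathbb R$ for which there is $v:\{0,1\}^\star\times\{0,1\}^\star\times\mathbb N\to\mathbb Z$, computable in time polynomial in $|x|$, $|u|$ and $b$, with $|w(x,u)-v(x,u,b)/2^b|\le 2^{-b}$ for all $x,u,b$. * $L\in\mathrm{AWPP}$ if there are a polynomial $p$, a function $g\in\mathrm{GapP}$ and a constant $c<1/2$ such that for all $x$: $1-c\le g(x)/2^{p(|x|)}\le 1$ if $x\in L$, and $0\le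 g(x)/2^{p(|x|)}\le c$ if $x\notin L$. * $L\in\mathrm{PP}$ if there are a polynomial $p$ and a polynomial-time predicate $M$ such that for all $x$ the fraction of the strings $y\in\{0,1\}^{p(|x|)}$ with $M(x,y)=1$ is $>1/2$ if $x\in L$, and $\le 1/2$ if $x\notin L$. * A *quantum Turing machine* has finitely many states, a finite alphabet, one two-way infinite tape (the input, followed and preceded by blanks, with the head on its first symbol), and a transition amplitude in $\mathbb C$ for each (state, scanned symbol; written symbol, new state, head move left or right); its time evolution on finite linear combinations of configurations preserves the Euclidean norm. Before each step an observable of the state and the scanned symbol is measured; its outcome tells whether the machine halts and accepts, halts and rejects, or goes on, and in the last case it may carry the result of an intermediate measurement. The real and imaginary parts of every transition amplitude are efficiently computable: for such a part $r$ there is $v:\mathbb N\to\mathbb Z$, computable in time polynomial in $b$, with $|r-v(b)/2^b|\le 2^{-b}$ for all $b$. * $L\in\mathrm{BQP}$ if there are such a machine and a polynomial $t$ such that on every input $x$ the machine halts with certainty within $t(|x|)$ steps, accepts with probability at least $2/3$ if $x\in L$, and rejects with probability at least $2/3$ if $x\notin L$. **Theorem.** 1. A language $L\subseteq\{0,1\}^\star$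 is in $\mathrm{AWPP}$ if and only if there are a function $g$ corresponding to a weighted counting problem and a constant $c<1/2$ such that, for all $x\in\{0,1\}^\star$, $$x\in L\ \Rightarrow\ 1-c\le g(x)\le 1,\qquad x\notin L\ \Rightarrow\ 0\le g(x)\le c .$$ 2. $\mathrm{BQP}\subseteq\mathrm{AWPP}$. 3. $\mathrm{BQP}\subseteq\mathrm{PP}$. -/

import Mathlib

open Turing Computability

namespace WeightedCounting

/-! ### Polynomial-time computability

Polynomial time is Mathlib's `Turing.TM2ComputableInPolyTime`: a finite (multi-stack) Turing
machine whose running time is bounded by a polynomial in the length of the encoded input. -/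

/-- Binary strings. -/
abbrev Str : Type := List Bool

/-- Integers in binary: a sign bit, followed by the absolute value in binary. -/
def encodeInt (z : ℤ) : List Bool := decide (z < 0) :: encodeNat z.natAbs

/-- Pairs of strings, the second written after the first in a disjoint copy of the alphabet. -/
def encodePair : Str × Str → List (Bool ⊕ Bool) :=
  (encodingProd (encodingList Bool) (encodingList Bool)).encode

/-- Triples `(x, u, b)`, with `b` in unary, so that the length of the code of `(x, u, b)` is
`|x| + |u| + b`. -/
def encodeTriple : (Str × Str) × ℕ → List ((Bool ⊕ Bool) ⊕ Bool) :=
  (encodingProd (encodingProd (encodingList Bool) (encodingList Bool)) unaryEncodingNat).encode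

/-- `f` is computed in polynomial time by a Turing machine, for the given encodings of its inputs
and outputs. -/
def IsPolyTime {α β αΓ βΓ : Type} (ea : α → List αΓ) (eb : β → List βΓ) (f : α → β) : Prop :=
  Nonempty (TM2ComputableInPolyTime ea eb f)

/-- A polynomial-time predicate of two strings. -/
def IsPolyTimePred (T : Str → Str → Bool) : Prop :=
  IsPolyTime encodePair encodeBool (fun a => T a.1 a.2)

/-! ### Counting classes -/

/-- The counting class `#P`: functions `f x = ∑_{u ∈ {0,1}^{p(|x|)}} T (x, u)`. -/
def SharpP : Set (Str → ℕ) :=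
  {f | ∃ (p : Polynomial ℕ) (T : Str → Str → Bool), IsPolyTimePred T ∧
    ∀ x, f x = ∑ u : Fin (p.eval x.length) → Bool, (T x (List.ofFn u)).toNat}

/-- `GapP`, the closure of `#P` under subtraction: differences of two `#P` functions. -/
def GapP : Set (Str → ℤ) :=
  {g | ∃ f₁ ∈ SharpP, ∃ f₂ ∈ SharpP, ∀ x, g x = (f₁ x : ℤ) - (f₂ x : ℤ)}

/-- A weight function `w` is efficiently approximable if there is a function `v` to the integers,
computable in time polynomial in `|x|`, `|u|` and `b`, with
`|w(x, u) - v(x, u, b) / 2^b| ≤ 2^{-b}` for all `x`, `u`, `b`. -/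
def IsApproximableWeight (w : Str → Str → ℝ) : Prop :=
  ∃ v : Str → Str → ℕ → ℤ,
    IsPolyTime encodeTriple encodeInt (fun a => v a.1.1 a.1.2 a.2) ∧
    ∀ x u b, |w x u - (v x u b : ℝ) / 2 ^ b| ≤ 1 / 2 ^ b

/-- The class `#P_S` of functions `f x = ∑_{u ∈ {0,1}^{p(|x|)}} w (x, u)` that correspond to
weighted counting problems with weights in `S`. -/
def WeightedSharpP (S : Set ℝ) : Set (Str → ℝ) :=
  {f | ∃ (p : Polynomial ℕ) (w : Str → Str → ℝ),
    IsApproximableWeight w ∧ (∀ x u, w x u ∈ S) ∧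
    ∀ x, f x = ∑ u : Fin (p.eval x.length) → Bool, w x (List.ofFn u)}

/-- The class `PP`. -/
def PP : Set (Language Bool) :=
  {L | ∃ (p : Polynomial ℕ) (M : Str → Str → Bool), IsPolyTimePred M ∧
    ∀ x,
      (x ∈ L → (1 / 2 : ℚ) <
        (Finset.univ.filter fun y : Fin (p.eval x.length) → Bool =>
          M x (List.ofFn y) = true).card / 2 ^ (p.eval x.length)) ∧
      (x ∉ L →
        ((Finset.univ.filter fun y : Fin (p.eval x.length) → Bool =>
          M x (List.ofFn y) = true).card : ℚ) / 2 ^ (p.eval x.length) ≤ 1 / 2)}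

/-- The class `AWPP`. -/
def AWPP : Set (Language Bool) :=
  {L | ∃ (p : Polynomial ℕ), ∃ g ∈ GapP, ∃ c : ℝ, c < 1 / 2 ∧
    ∀ x,
      (x ∈ L → 1 - c ≤ (g x : ℝ) / 2 ^ (p.eval x.length) ∧
        (g x : ℝ) / 2 ^ (p.eval x.length) ≤ 1) ∧
      (x ∉ L → 0 ≤ (g x : ℝ) / 2 ^ (p.eval x.length) ∧
        (g x : ℝ) / 2 ^ (p.eval x.length) ≤ c)}

/-! ### Quantum Turing machines -/

/-- A real number that can be approximated within `2^{-b}` by a dyadic rational `v(b) / 2^b`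
computable in time polynomial in `b`. -/
def IsEfficientReal (r : ℝ) : Prop :=
  ∃ v : ℕ → ℤ, IsPolyTime unaryEncodeNat encodeInt v ∧
    ∀ b, |r - (v b : ℝ) / 2 ^ b| ≤ 1 / 2 ^ b

/-- A quantum Turing machine with one two-way infinite tape, in which intermediate measurements
are allowed. `δ q σ τ q' d` is the amplitude with which the machine, in control state `q` and
scanning `σ`, writes `τ`, enters the state `q'` and moves its head by one cell in direction `d`.

Before each step the observable `obs` of the control state and the scanned symbol is measured.
If the outcome is `inl b`, then the computation halts with the answer `b` (`true` accepts, `false`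
rejects); if it is `inr o`, then the computation goes on, and `o` is the result of an intermediate
measurement (there are none besides that of halting if `Outcome` has one element). -/
structure QTM where
  State : Type
  Symbol : Type
  Outcome : Type
  [stateFintype : Fintype State]
  [symbolFintype : Fintype Symbol]
  [outcomeFintype : Fintype Outcome]
  start : State
  blank : Symbol
  bit : Bool → Symbol
  bit_injective : Function.Injective bit
  bit_ne_blank : ∀ b, bit b ≠ blank
  δ : State → Symbol → Symbol → State → Dir → ℂ
  obs : State → Symbol → Bool ⊕ Outcome

namespace QTM

attribute [instance] QTM.stateFintype QTM.symbolFintype QTM.outcomeFintype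

/-- A configuration: control state, head position, and contents of the tape, which is blank in all
but finitely many cells. -/
@[ext]
structure Config (M : QTM) where
  state : M.State
  head : ℤ
  tape : ℤ → M.Symbol
  finite_tape : {i | tape i ≠ M.blank}.Finite

variable (M : QTM)

/-- Superpositions: finite complex linear combinations of configurations. -/
abbrev Superposition : Type := M.Config →₀ ℂ

variable {M}

/-- The configuration after writing `τ`, entering the state `q` and moving in direction `d`. -/
def Config.next (c : M.Config) (τ : M.Symbol) (q : M.State) (d : Dir) : M.Config where
  state := q
  head := match d with
    | Dir.left => c.head - 1
    | Dir.right => c.head + 1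
  tape := Function.update c.tape c.head τ
  finite_tape := by
    refine (c.finite_tape.insert c.head).subset ?_
    intro i hi
    by_cases h : i = c.head
    · exact Or.inl h
    · right
      simpa [Function.update_of_ne h] using hi

/-- The outcome of the measurement on a configuration. -/
def Config.obs (c : M.Config) : Bool ⊕ M.Outcome := M.obs c.state (c.tape c.head)

/-- The initial configuration: the input stands in the cells `0, …, |x| - 1`, the head is on
cell `0`. -/
def initConfig (M : QTM) (x : Str) : M.Config where
  state := M.start
  head := 0
  tape := fun i => if 0 ≤ i then (x[i.toNat]?).elim M.blank M.bit else M.blank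
  finite_tape := by
    refine (Set.finite_Ico (0 : ℤ) x.length).subset ?_
    intro i hi
    by_cases h0 : 0 ≤ i
    · refine ⟨h0, ?_⟩
      by_contra hlt
      have hle : x.length ≤ i.toNat := by omega
      exact hi (by simp [List.getElem?_eq_none hle])
    · exact absurd (if_neg h0) hi

/-- The linear time evolution operator. -/
noncomputable def evolve (M : QTM) : M.Superposition →ₗ[ℂ] M.Superposition :=
  Finsupp.linearCombination ℂ fun c : M.Config =>
    ∑ τ : M.Symbol, ∑ q : M.State,
      (Finsupp.single (c.next τ q Dir.left) (M.δ c.state (c.tape c.head) τ q Dir.left) +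
        Finsupp.single (c.next τ q Dir.right) (M.δ c.state (c.tape c.head) τ q Dir.right))

/-- The square of the Euclidean norm of a superposition. -/
noncomputable def normSq (ψ : M.Superposition) : ℝ := ψ.sum fun _ z => ‖z‖ ^ 2

/-- The machine is well-formed: its time evolution preserves the Euclidean norm. -/
def WellFormed (M : QTM) : Prop := ∀ ψ : M.Superposition, normSq (M.evolve ψ) = normSq ψ

/-- The real and imaginary parts of all transition amplitudes are efficiently computable. -/
def EfficientAmplitudes (M : QTM) : Prop :=
  ∀ q σ τ q' d, IsEfficientReal (M.δ q σ τ q' d).re ∧ IsEfficientReal (M.δ q σ τ q' d).im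

open Classical in
/-- The unnormalised superposition left when the measurement of `ψ` gives the outcome `a`. -/
noncomputable def project (ψ : M.Superposition) (a : Bool ⊕ M.Outcome) : M.Superposition :=
  ψ.filter fun c => c.obs = a

/-- The unnormalised superposition after `h.length` steps on the input `x`, if the computation has
not halted in an earlier measurement and the results of the intermediate measurements were `h`
(most recent first). Its squared norm is the probability of that event. -/
noncomputable def run (M : QTM) (x : Str) : List M.Outcome → M.Superposition
  | [] => Finsupp.single (M.initConfig x) 1
  | o :: h => M.evolve (project (run M x h) (Sum.inr o))

/-- The probability that on the input `x` the machine halts with the answer `b` within `t` steps. -/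
noncomputable def answerProb (M : QTM) (x : Str) (t : ℕ) (b : Bool) : ℝ :=
  ∑ s ∈ Finset.range (t + 1), ∑ h : Fin s → M.Outcome,
    normSq (project (M.run x (List.ofFn h)) (Sum.inl b))

/-- On the input `x` the machine halts within `t` steps with certainty: after `t` steps, whatever
the results of the intermediate measurements, only halting configurations have a non-zero
amplitude. -/
def HaltsWithin (M : QTM) (x : Str) (t : ℕ) : Prop :=
  ∀ (h : Fin t → M.Outcome) (c : M.Config), M.run x (List.ofFn h) c ≠ 0 →
    ∃ b : Bool, c.obs = Sum.inl b

end QTM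

/-- The class `BQP`: languages decided with error probability at most `1/3` by a polynomial-time
quantum Turing machine with efficiently computable amplitudes. -/
def BQP : Set (Language Bool) :=
  {L | ∃ M : QTM, M.WellFormed ∧ M.EfficientAmplitudes ∧ ∃ t : Polynomial ℕ,
    ∀ x : Str, M.HaltsWithin x (t.eval x.length) ∧
      (x ∈ L → 2 / 3 ≤ M.answerProb x (t.eval x.length) true) ∧
      (x ∉ L → 2 / 3 ≤ M.answerProb x (t.eval x.length) false)}

end WeightedCounting

open Turing Computability
namespace WeightedCounting

/-! ### A structured language for stack machines -/

/-! Up to a small error, a weighted sum and a normalised gap are the same thing. A difference of two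
counting functions, divided by `2 ^ p`, is a sum of the dyadic weights `± 2 ^ (-p)` and `0`.
Conversely, round every weight to `p + k` binary digits: the `2 ^ p` errors add up to at most `2 ^
(-k)`, and the rounded sum is a gap, because an integer `e` is, up to its sign, the number of bit
strings representing a number below `|e|` (`GapP.bitSum`). The rounded sum may leave `[0, 1]`
slightly; the room between `c` and `1 - c` allows an affine correction, which can be carried out
within `GapP` (`mem_AWPP_of_approx`).

For a quantum machine, expanding the squared norms writes the acceptance probability as a sum over
pairs of computation paths that see the same measurement outcomes and end in the same accepting
configuration; a pair contributes the amplitudes of the first path times the conjugate amplitudes of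
the second (`answerProb_true`). Replacing the amplitudes by dyadic approximations costs an error
that is multiplied by at most a constant in each step (`norm_pairValue_sub_le`), so a precision
linear in the time bound suffices. Real and imaginary parts are separated by carrying a power of the
imaginary unit along the paths (`pathSum_pairSystem`), which leaves a sum over paths of products of
integers. Such a sum is a gap, since each factor unfolds into signs indexed by bit strings
(`PathSystem.Efficient.pathSum_mem_GapP`). Preservation of the norm makes the probabilities of
acceptance and rejection add up to at most one (`answerProb_add_le_one`), so likely rejection bounds
acceptance from above. This is the case `c = 1 / 3`.

For the inclusion in `PP`, with `g = f₁ - f₂` the question whether `g / 2 ^ p` exceeds `1 / 2`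
compares `2 f₁` with `2 f₂ + 2 ^ p`; counting the witnesses of the former together with the
non-witnesses of the latter turns this into a majority vote.

The rest shows that the functions involved run in polynomial time on stack machines. Structured
programs define a class `FP` that contains finite-state transductions and is closed under
composition, pairing and iteration with polynomially bounded states. Programs compile to stack
machines (`IsPolyTime.of_FP`), and stack machines are simulated by programs (`FP.of_isPolyTime`);
both directions are needed, since machines occur in hypotheses and in conclusions. -/

/-- Structured programs acting on stacks indexed by `ℕ`, with natural numbers as symbols. -/
inductive Prog : Type
  | skip : Prog
  | push (k a : ℕ) : Prog
  | pop (k : ℕ) : Prog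
  | seq (p q : Prog) : Prog
  | ite (k : ℕ) (P : Option ℕ → Bool) (p q : Prog) : Prog
  | loop (k : ℕ) (P : Option ℕ → Bool) (p : Prog) : Prog

/-- The contents of the stacks. -/
abbrev St : Type := ℕ → List ℕ

/-- `Run p S t S'`: started on `S`, the program `p` ends with `S'` after at most `t` steps. -/
inductive Run : Prog → St → ℕ → St → Prop
  | skip (S : St) : Run Prog.skip S 1 S
  | push (k a : ℕ) (S : St) : Run (Prog.push k a) S 1 (Function.update S k (a :: S k))
  | pop (k : ℕ) (S : St) : Run (Prog.pop k) S 1 (Function.update S k (S k).tail)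
  | seq {p q : Prog} {S S' S'' : St} {t t' : ℕ} :
      Run p S t S' → Run q S' t' S'' → Run (Prog.seq p q) S (t + t') S''
  | iteTrue {k : ℕ} {P : Option ℕ → Bool} {p q : Prog} {S S' : St} {t : ℕ} :
      P (S k).head? = true → Run p S t S' → Run (Prog.ite k P p q) S (t + 1) S'
  | iteFalse {k : ℕ} {P : Option ℕ → Bool} {p q : Prog} {S S' : St} {t : ℕ} :
      P (S k).head? = false → Run q S t S' → Run (Prog.ite k P p q) S (t + 1) S'
  | loopDone {k : ℕ} {P : Option ℕ → Bool} {p : Prog} {S : St} :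
      P (S k).head? = false → Run (Prog.loop k P p) S 1 S
  | loopStep {k : ℕ} {P : Option ℕ → Bool} {p : Prog} {S S' S'' : St} {t t' : ℕ} :
      P (S k).head? = true → Run p S t S' → Run (Prog.loop k P p) S' t' S'' →
        Run (Prog.loop k P p) S (t + t' + 1) S''
  | weaken {p : Prog} {S S' : St} {t t' : ℕ} : Run p S t S' → t ≤ t' → Run p S t' S'

namespace Prog

/-- A bound on the indices of the stacks used by a program. -/
def bound : Prog → ℕ
  | skip => 0
  | push k _ => k + 1
  | pop k => k + 1
  | seq p q => max p.bound q.bound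
  | ite k _ p q => max (k + 1) (max p.bound q.bound)
  | loop k _ p => max (k + 1) p.bound

/-- Labels for the points of a program. -/
def Label : Prog → Type
  | skip => Unit
  | push _ _ => Unit
  | pop _ => Unit
  | seq p q => p.Label ⊕ q.Label
  | ite _ _ p q => Option (p.Label ⊕ q.Label)
  | loop _ _ p => Option p.Label

instance finite_label : ∀ p : Prog, Finite p.Label
  | skip => inferInstanceAs (Finite Unit)
  | push _ _ => inferInstanceAs (Finite Unit)
  | pop _ => inferInstanceAs (Finite Unit)
  | seq p q =>
    have := finite_label p
    have := finite_label q
    inferInstanceAs (Finite (p.Label ⊕ q.Label))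
  | ite _ _ p q =>
    have := finite_label p
    have := finite_label q
    inferInstanceAs (Finite (Option (p.Label ⊕ q.Label)))
  | loop _ _ p =>
    have := finite_label p
    inferInstanceAs (Finite (Option p.Label))

/-- The label at which a program starts. -/
def entry : (p : Prog) → p.Label
  | skip => ()
  | push _ _ => ()
  | pop _ => ()
  | seq p _ => Sum.inl p.entry
  | ite _ _ _ _ => none
  | loop _ _ _ => none

end Prog

/-- A program never looks at stacks from its bound upwards, so these may hold anything. This is what
allows data to be parked on high stacks while a subprogram runs. -/
theorem Run.frame {p : Prog} {S S' : St} {t : ℕ} (h : Run p S t S') (n : ℕ) (hn : p.bound ≤ n)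
    (R : St) :
    Run p (fun k => if k < n then S k else R k) t (fun k => if k < n then S' k else R k) := by
  have key : ∀ (S : St) (k : ℕ) (l : List ℕ), k < n →
      (fun j => if j < n then Function.update S k l j else R j) =
        Function.update (fun j => if j < n then S j else R j) k l := by
    intro S k l hk
    funext j
    by_cases hj : j = k
    · subst hj; simp [hk]
    · simp [Function.update_of_ne hj]
  induction h with
  | skip S => exact Run.skip _
  | push k a S =>
    have hk : k < n := hn
    rw [key _ _ _ hk]
    simpa [hk] using Run.push k a (fun j => if j < n then S j else R j)
  | pop k S =>
    have hk : k < n := hn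
    rw [key _ _ _ hk]
    simpa [hk] using Run.pop k (fun j => if j < n then S j else R j)
  | seq _ _ ih ih' =>
    simp only [Prog.bound, max_le_iff] at hn
    exact Run.seq (ih hn.1) (ih' hn.2)
  | @iteTrue k _ _ _ _ _ _ hP _ ih =>
    simp only [Prog.bound, max_le_iff] at hn
    have hk : k < n := hn.1
    exact Run.iteTrue (by simpa [hk] using hP) (ih hn.2.1)
  | @iteFalse k _ _ _ _ _ _ hP _ ih =>
    simp only [Prog.bound, max_le_iff] at hn
    have hk : k < n := hn.1
    exact Run.iteFalse (by simpa [hk] using hP) (ih hn.2.2)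
  | @loopDone k _ _ _ hP =>
    simp only [Prog.bound, max_le_iff] at hn
    have hk : k < n := hn.1
    exact Run.loopDone (by simpa [hk] using hP)
  | @loopStep k _ _ _ _ _ _ _ hP _ _ ih ih' =>
    have hn' := hn
    simp only [Prog.bound, max_le_iff] at hn
    have hk : k < n := hn.1
    exact Run.loopStep (by simpa [hk] using hP) (ih hn.2) (ih' hn')
  | weaken _ hle ih => exact Run.weaken (ih hn) hle

/-- A unit of time pushes at most one symbol, so a time bound is also a bound on the size of the
result. -/
theorem Run.length_le {p : Prog} {S S' : St} {t : ℕ} (h : Run p S t S') (k : ℕ) :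
    (S' k).length ≤ (S k).length + t := by
  induction h with
  | skip S => omega
  | push j a S =>
    by_cases hj : k = j
    · subst hj; simp
    · simp [Function.update_of_ne hj]
  | pop j S =>
    by_cases hj : k = j
    · subst hj; simp; omega
    · simp [Function.update_of_ne hj]
  | _ => omega

/-! ### Compilation to Mathlib's stack machines -/

/-- `n` steps of a machine lead from `c` to `c'`. -/
def Steps {σ : Type} (f : σ → Option σ) (n : ℕ) (c c' : σ) : Prop :=
  (flip bind f)^[n] (some c) = some c'

theorem Steps.trans {σ : Type} {f : σ → Option σ} {m n : ℕ} {a b c : σ} (h : Steps f m a b)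
    (h' : Steps f n b c) : Steps f (m + n) a c := by
  unfold Steps at *
  rw [Nat.add_comm, Function.iterate_add_apply, h, h']

theorem Steps.one {σ : Type} {f : σ → Option σ} {a b : σ} (h : f a = some b) : Steps f 1 a b := h

/-- Stack alphabets of a compiled program: input, output, and the work stacks. -/
abbrev WorkAlphabet (A B : Type) (n : ℕ) : Option (Option (Fin n)) → Type
  | none => A
  | some none => B
  | some (some _) => ℕ

section Compile

variable {A B : Type} {n : ℕ} {Λ : Type}

/-- Contents of all stacks of a compiled program. -/
def workStacks (n : ℕ) (S : St) (a : List A) (b : List B) :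
    ∀ k : Option (Option (Fin n)), List (WorkAlphabet A B n k)
  | none => a
  | some none => b
  | some (some i) => S i

/-- The local variables of a compiled program: a flag, and registers for input and output. -/
abbrev Regs (A B : Type) : Type := Bool × Option A × Option B

/-- The statements of a compiled program. -/
def Prog.stmt [NeZero n] : (p : Prog) → (p.Label → Λ) → Λ → p.Label →
    TM2.Stmt (WorkAlphabet A B n) Λ (Regs A B)
  | skip, _, nxt, _ => TM2.Stmt.goto fun _ => nxt
  | push k a, _, nxt, _ =>
    TM2.Stmt.push (some (some (Fin.ofNat n k))) (fun _ => a) (TM2.Stmt.goto fun _ => nxt)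
  | pop k, _, nxt, _ =>
    TM2.Stmt.pop (some (some (Fin.ofNat n k))) (fun v _ => v) (TM2.Stmt.goto fun _ => nxt)
  | seq p q, emb, _, Sum.inl l =>
    p.stmt (fun l => emb (Sum.inl l)) (emb (Sum.inr q.entry)) l
  | seq _ q, emb, nxt, Sum.inr l => q.stmt (fun l => emb (Sum.inr l)) nxt l
  | ite k P p q, emb, _, none =>
    TM2.Stmt.peek (some (some (Fin.ofNat n k))) (fun v o => (P o, v.2))
      (TM2.Stmt.goto fun v =>
        bif v.1 then emb (some (Sum.inl p.entry)) else emb (some (Sum.inr q.entry)))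
  | ite _ _ p _, emb, nxt, some (Sum.inl l) => p.stmt (fun l => emb (some (Sum.inl l))) nxt l
  | ite _ _ _ q, emb, nxt, some (Sum.inr l) => q.stmt (fun l => emb (some (Sum.inr l))) nxt l
  | loop k P p, emb, nxt, none =>
    TM2.Stmt.peek (some (some (Fin.ofNat n k))) (fun v o => (P o, v.2))
      (TM2.Stmt.goto fun v => bif v.1 then emb (some p.entry) else nxt)
  | loop _ _ p, emb, _, some l => p.stmt (fun l => emb (some l)) (emb none) l

theorem update_workStacks [NeZero n] (S : St) (a : List A) (b : List B) {k : ℕ} (hk : k < n)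
    (l : List ℕ) :
    Function.update (workStacks n S a b) (some (some (Fin.ofNat n k))) l =
      workStacks n (Function.update S k l) a b := by
  funext j
  rcases j with _ | _ | i
  · rfl
  · rfl
  · by_cases h : i = Fin.ofNat n k
    · subst h
      simp [workStacks, Nat.mod_eq_of_lt hk]
    · have h1 : (some (some i) : Option (Option (Fin n))) ≠ some (some (Fin.ofNat n k)) := by
        simpa using h
      have h2 : (i : ℕ) ≠ k := by
        rintro rfl
        exact h (by simp)
      rw [Function.update_of_ne h1]
      simp [workStacks, Function.update_of_ne h2]

theorem workStacks_apply [NeZero n] (S : St) (a : List A) (b : List B) {k : ℕ} (hk : k < n) :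
    workStacks n S a b (some (some (Fin.ofNat n k))) = S k := by
  simp [workStacks, Nat.mod_eq_of_lt hk]

theorem step_of_stmt {K : Type} [DecidableEq K] {Γ : K → Type} {σ : Type}
    {m : Λ → TM2.Stmt Γ Λ σ} {l : Λ} {q : TM2.Stmt Γ Λ σ} (h : m l = q) (v : σ)
    (S : ∀ k, List (Γ k)) : TM2.step m ⟨some l, v, S⟩ = some (TM2.stepAux q v S) := by
  rw [TM2.step, h]

/-- Induction on the run. The map `emb` places the labels of a subprogram inside the whole machine
and `nxt` is its continuation, so both must vary in the induction. Tests cost one machine step and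
sequencing none, hence the machine is no slower than the program. -/
theorem Run.compile [NeZero n] {p : Prog} {S S' : St} {t : ℕ} (h : Run p S t S')
    (m : Λ → TM2.Stmt (WorkAlphabet A B n) Λ (Regs A B)) (hn : p.bound ≤ n)
    (emb : p.Label → Λ) (nxt : Λ) (hm : ∀ l, m (emb l) = p.stmt emb nxt l)
    (a : List A) (b : List B) (v : Regs A B) :
    ∃ s ≤ t, ∃ v', Steps (TM2.step m) s ⟨some (emb p.entry), v, workStacks n S a b⟩
      ⟨some nxt, v', workStacks n S' a b⟩ := by
  induction h generalizing nxt v with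
  | skip S => exact ⟨1, le_rfl, v, Steps.one (by simp [hm, Prog.stmt])⟩
  | push k x S =>
    have hk : k < n := hn
    refine ⟨1, le_rfl, v, Steps.one ?_⟩
    simp only [TM2.step, hm, Prog.stmt, TM2.stepAux]
    rw [workStacks_apply _ _ _ hk, update_workStacks _ _ _ hk]
  | pop k S =>
    have hk : k < n := hn
    refine ⟨1, le_rfl, v, Steps.one ?_⟩
    simp only [TM2.step, hm, Prog.stmt, TM2.stepAux]
    rw [workStacks_apply _ _ _ hk, update_workStacks _ _ _ hk]
  | @seq p q _ _ _ _ _ _ _ ih ih' =>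
    simp only [Prog.bound, max_le_iff] at hn
    obtain ⟨s, hs, v', h1⟩ := ih hn.1 (fun l => emb (Sum.inl l)) (emb (Sum.inr q.entry))
      (fun l => hm (Sum.inl l)) v
    obtain ⟨s', hs', v'', h2⟩ := ih' hn.2 (fun l => emb (Sum.inr l)) nxt
      (fun l => hm (Sum.inr l)) v'
    exact ⟨s + s', by omega, v'', h1.trans h2⟩
  | @iteTrue k P p q _ _ _ hP _ ih =>
    simp only [Prog.bound, max_le_iff] at hn
    have hk : k < n := hn.1
    obtain ⟨s, hs, v', h1⟩ := ih hn.2.1 (fun l => emb (some (Sum.inl l))) nxt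
      (fun l => hm (some (Sum.inl l))) (true, v.2)
    refine ⟨1 + s, by omega, v', Steps.trans (Steps.one ?_) h1⟩
    refine (step_of_stmt (q := TM2.Stmt.peek _ _ _) (hm none) _ _).trans ?_
    rw [TM2.stepAux, TM2.stepAux, workStacks_apply _ _ _ hk, hP]
    rfl
  | @iteFalse k P p q _ _ _ hP _ ih =>
    simp only [Prog.bound, max_le_iff] at hn
    have hk : k < n := hn.1
    obtain ⟨s, hs, v', h1⟩ := ih hn.2.2 (fun l => emb (some (Sum.inr l))) nxt
      (fun l => hm (some (Sum.inr l))) (false, v.2)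
    refine ⟨1 + s, by omega, v', Steps.trans (Steps.one ?_) h1⟩
    refine (step_of_stmt (q := TM2.Stmt.peek _ _ _) (hm none) _ _).trans ?_
    rw [TM2.stepAux, TM2.stepAux, workStacks_apply _ _ _ hk, hP]
    rfl
  | @loopDone k P p _ hP =>
    simp only [Prog.bound, max_le_iff] at hn
    have hk : k < n := hn.1
    refine ⟨1, le_rfl, (false, v.2), Steps.one ?_⟩
    refine (step_of_stmt (q := TM2.Stmt.peek _ _ _) (hm none) _ _).trans ?_
    rw [TM2.stepAux, TM2.stepAux, workStacks_apply _ _ _ hk, hP]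
    rfl
  | @loopStep k P p _ _ _ _ _ hP _ _ ih ih' =>
    have hn' := hn
    simp only [Prog.bound, max_le_iff] at hn
    have hk : k < n := hn.1
    obtain ⟨s, hs, v', h1⟩ := ih hn.2 (fun l => emb (some l)) (emb none)
      (fun l => hm (some l)) (true, v.2)
    obtain ⟨s', hs', v'', h2⟩ := ih' hn' emb nxt hm v'
    refine ⟨1 + s + s', by omega, v'', Steps.trans (Steps.trans (Steps.one ?_) h1) h2⟩
    refine (step_of_stmt (q := TM2.Stmt.peek _ _ _) (hm none) _ _).trans ?_
    rw [TM2.stepAux, TM2.stepAux, workStacks_apply _ _ _ hk, hP]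
    rfl
  | weaken _ hle ih =>
    obtain ⟨s, hs, v', h1⟩ := ih hn emb nxt hm v
    exact ⟨s, hs.trans hle, v', h1⟩

end Compile

/-- The stacks when stack `0` contains `l` and the others are empty. -/
def st0 (l : List ℕ) : St := Function.update (fun _ => []) 0 l

theorem update_workStacks_input {A B : Type} {n : ℕ} (S : St) (a a' : List A) (b : List B) :
    Function.update (workStacks n S a b) none a' = workStacks n S a' b := by
  funext j
  rcases j with _ | _ | i <;> rfl

theorem update_workStacks_output {A B : Type} {n : ℕ} (S : St) (a : List A) (b b' : List B) :
    Function.update (workStacks n S a b) (some none) b' = workStacks n S a b' := by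
  funext j
  rcases j with _ | _ | i <;> rfl

section Wrap

variable {A B : Type} [Inhabited B] {n : ℕ} [NeZero n]

/-- The compiled program, with loops that read the input and write the output. -/
def Prog.machine (p : Prog) (sa : A → ℕ) (sb : ℕ → B) (n : ℕ) [NeZero n] :
    Option (Option p.Label) →
      TM2.Stmt (WorkAlphabet A B n) (Option (Option p.Label)) (Regs A B)
  | none =>
    TM2.Stmt.pop none (fun _ o => (o.isSome, o, none))
      (TM2.Stmt.branch (fun v => v.1)
        (TM2.Stmt.push (some (some (Fin.ofNat n 0))) (fun v => (v.2.1.map sa).getD 0)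
          (TM2.Stmt.goto fun _ => none))
        (TM2.Stmt.goto fun _ => some (some p.entry)))
  | some none =>
    TM2.Stmt.pop (some (some (Fin.ofNat n 0))) (fun _ o => (o.isSome, none, o.map sb))
      (TM2.Stmt.branch (fun v => v.1)
        (TM2.Stmt.push (some none) (fun v => v.2.2.getD default)
          (TM2.Stmt.goto fun _ => some none))
        TM2.Stmt.halt)
  | some (some l) => p.stmt (fun l => some (some l)) (some none) l

theorem Prog.machine_read (p : Prog) (sa : A → ℕ) (sb : ℕ → B) (b : List B) (a : List A) :
    ∀ (S : St) (v : Regs A B),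
      Steps (TM2.step (p.machine sa sb n)) (a.length + 1) ⟨some none, v, workStacks n S a b⟩
        ⟨some (some (some p.entry)), (false, none, none),
          workStacks n (Function.update S 0 ((a.map sa).reverse ++ S 0)) [] b⟩ := by
  have h0 : 0 < n := Nat.pos_of_ne_zero (NeZero.ne n)
  induction a with
  | nil =>
    intro S v
    refine Steps.one ((step_of_stmt (q := TM2.Stmt.pop _ _ _) rfl _ _).trans ?_)
    simp only [TM2.stepAux, update_workStacks_input]
    simp [workStacks]
  | cons x a ih =>
    intro S v
    rw [List.length_cons, Nat.add_comm]
    refine Steps.trans (Steps.one ((step_of_stmt (q := TM2.Stmt.pop _ _ _) rfl _ _).trans ?_))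
      ((ih (Function.update S 0 (sa x :: S 0)) (true, some x, none)).trans (n := 0) ?_)
    · simp only [TM2.stepAux, update_workStacks_input, update_workStacks _ _ _ h0,
        workStacks_apply _ _ _ h0]
      simp [workStacks]
    · simp [Steps]

theorem Prog.machine_write (p : Prog) (sa : A → ℕ) (sb : ℕ → B) (l : List ℕ) :
    ∀ (b : List B) (v : Regs A B),
      Steps (TM2.step (p.machine sa sb n)) (l.length + 1)
        ⟨some (some none), v, workStacks n (st0 l) [] b⟩
        ⟨none, (false, none, none), workStacks n (st0 []) [] ((l.map sb).reverse ++ b)⟩ := by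
  have h0 : 0 < n := Nat.pos_of_ne_zero (NeZero.ne n)
  induction l with
  | nil =>
    intro b v
    refine Steps.one ((step_of_stmt (q := TM2.Stmt.pop _ _ _) rfl _ _).trans ?_)
    simp only [TM2.stepAux, update_workStacks _ _ _ h0, workStacks_apply _ _ _ h0]
    simp [st0]
  | cons x l ih =>
    intro b v
    rw [List.length_cons, Nat.add_comm]
    refine Steps.trans (Steps.one ((step_of_stmt (q := TM2.Stmt.pop _ _ _) rfl _ _).trans ?_))
      ((ih (sb x :: b) (true, none, some (sb x))).trans (n := 0) ?_)
    · simp only [TM2.stepAux, update_workStacks _ _ _ h0, workStacks_apply _ _ _ h0]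
      simp only [st0, Function.update_self, Function.update_idem, List.head?_cons, List.tail_cons,
        Option.isSome_some, cond_true, Option.map_some, Option.getD_some,
        update_workStacks_output]
      rfl
    · simp [Steps]

end Wrap

theorem natPoly_mono (T : Polynomial ℕ) {m n : ℕ} (h : m ≤ n) :
    T.eval m ≤ T.eval n := by
  simp only [Polynomial.eval_eq_sum_range]
  gcongr

/-- The machine pops its input onto work stack `0` and finally pops that stack onto the output; each
transfer reverses a list, whence the two reversals. The three parts of the time bound are reading,
the program, and writing a result of length at most `X + T`. -/
theorem IsPolyTime.of_run {α β A B : Type} [Fintype A] [Fintype B] [Inhabited B]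
    {ea : α → List A} {eb : β → List B} {f : α → β} (sa : A → ℕ) (sb : ℕ → B) (p : Prog)
    (T : Polynomial ℕ)
    (h : ∀ a, ∃ l, Run p (st0 ((ea a).map sa).reverse) (T.eval (ea a).length) (st0 l) ∧
      (l.map sb).reverse = eb (f a)) : IsPolyTime ea eb f := by
  have e : ∀ l : List A, (List.map (Equiv.refl A).invFun l) = l := fun l => by
    have : (Equiv.refl A).invFun = id := rfl
    rw [this, List.map_id]
  have e' : ∀ l : List B, (List.map (Equiv.refl B).invFun l) = l := fun l => by
    have : (Equiv.refl B).invFun = id := rfl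
    rw [this, List.map_id]
  let n := p.bound + 1
  have hfin : Fintype (Option (Option p.Label)) := Fintype.ofFinite _
  let tm : FinTM2 :=
    { K := Option (Option (Fin n))
      k₀ := none
      k₁ := some none
      Γ := WorkAlphabet A B n
      Λ := Option (Option p.Label)
      main := none
      ΛFin := hfin
      σ := Regs A B
      initialState := (false, none, none)
      Γk₀Fin := inferInstanceAs (Fintype A)
      m := p.machine sa sb n }
  refine ⟨{ tm := tm, inputAlphabet := Equiv.refl A, outputAlphabet := Equiv.refl B,
            time := Polynomial.X + 1 + T + (Polynomial.X + T + 1), outputsFun := fun a => ?_ }⟩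
  have key : ∃ s ≤ ((Polynomial.X + 1 + T + (Polynomial.X + T + 1) : Polynomial ℕ)).eval
      (ea a).length, Steps (TM2.step (p.machine sa sb n)) s
        ⟨some none, (false, none, none), workStacks n (st0 []) (ea a) []⟩
        ⟨none, (false, none, none), workStacks n (st0 []) [] (eb (f a))⟩ := by
    obtain ⟨l, hl, hl'⟩ := h a
    have h1 := p.machine_read (n := n) sa sb [] (ea a) (st0 []) (false, none, none)
    obtain ⟨s, hs, v, h2⟩ := hl.compile (p.machine sa sb n) (Nat.le_succ _)
      (fun l => some (some l)) (some none) (fun l => rfl) [] [] (false, none, none)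
    have h3 := p.machine_write (n := n) sa sb l [] v
    have hlen := hl.length_le 0
    simp only [st0, Function.update_self, List.length_reverse, List.length_map] at hlen
    have e1 : Function.update (st0 []) 0 (((ea a).map sa).reverse ++ st0 [] 0) =
        st0 ((ea a).map sa).reverse := by
      simp [st0]
    rw [e1] at h1
    rw [List.append_nil, hl'] at h3
    refine ⟨_, ?_, (h1.trans h2).trans h3⟩
    simp only [Polynomial.eval_add, Polynomial.eval_X, Polynomial.eval_one]
    omega
  have key2 : TM2OutputsInTime tm (ea a) (some (eb (f a)))
      (((Polynomial.X + 1 + T + (Polynomial.X + T + 1) : Polynomial ℕ)).eval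
      (ea a).length) := by
    refine ⟨⟨key.choose, ?_⟩, key.choose_spec.1⟩
    have k1 : initList tm (ea a) =
        ⟨some none, (false, none, none), workStacks n (st0 []) (ea a) []⟩ := by
      unfold initList
      congr 1
      funext k
      rcases k with _ | _ | i <;> simp [tm, workStacks, st0]
    have k2 : haltList tm (eb (f a)) =
        ⟨none, (false, none, none), workStacks n (st0 []) [] (eb (f a))⟩ := by
      unfold haltList
      congr 1
      funext k
      rcases k with _ | _ | i <;> simp [tm, workStacks, st0]
    rw [k1, Option.map_some, k2]
    exact key.choose_spec.2
  have e1 := e (ea a)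
  have e2 := e' (eb (f a))
  rw [e1, e2]
  exact key2

/-! ### Program constructs -/

namespace Prog

/-- Branch on a finite classification of the top of stack `k`. -/
def switch {ι : Type} [DecidableEq ι] (k : ℕ) (cls : Option ℕ → ι) (f : ι → Prog) :
    List ι → Prog
  | [] => skip
  | i :: l => ite k (fun o => decide (cls o = i)) (f i) (switch k cls f l)

theorem switch_run {ι : Type} [DecidableEq ι] {k : ℕ} {cls : Option ℕ → ι} {f : ι → Prog}
    {S S' : St} {t : ℕ} {l : List ι} (hl : cls (S k).head? ∈ l)
    (h : Run (f (cls (S k).head?)) S t S') : Run (switch k cls f l) S (t + l.length) S' := by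
  induction l with
  | nil => simp at hl
  | cons i l ih =>
    by_cases hi : cls (S k).head? = i
    · subst hi
      exact (Run.iteTrue (by simp) h).weaken (by simp)
    · exact Run.iteFalse (by simpa using hi) (ih (by simpa [hi] using hl))

/-- Pop stack `k` and branch on a finite classification of the symbol found there. -/
def popCase {ι : Type} [DecidableEq ι] (k : ℕ) (cls : ℕ → ι) (l : List ι) (f : ι → Prog) : Prog :=
  switch k (fun o => cls (o.getD 0)) (fun i => seq (pop k) (f i)) l

theorem popCase_run {ι : Type} [DecidableEq ι] {k : ℕ} {cls : ℕ → ι} {L : List ι} {f : ι → Prog}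
    {S S' : St} {t a : ℕ} {l : List ℕ} (hS : S k = a :: l) (hL : cls a ∈ L)
    (h : Run (f (cls a)) (Function.update S k l) t S') :
    Run (popCase k cls L f) S (t + 1 + L.length) S' := by
  have e : cls ((S k).head?.getD 0) = cls a := by rw [hS]; rfl
  have h1 := Run.pop k S
  rw [hS, List.tail_cons] at h1
  refine switch_run (by rw [e]; exact hL) ?_
  rw [e]
  exact (Run.seq h1 h).weaken (by omega)

/-- Run `f a` for each symbol `a < N` popped from stack `k`, until this stack is empty. -/
def forEach (k N : ℕ) (f : ℕ → Prog) : Prog :=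
  loop k Option.isSome (popCase k id (List.range N) f)

theorem forEach_nil {k N : ℕ} {f : ℕ → Prog} {S : St} (hS : S k = []) :
    Run (forEach k N f) S 1 S :=
  Run.loopDone (by rw [hS]; rfl)

theorem forEach_cons {k N : ℕ} {f : ℕ → Prog} {S S' S'' : St} {t t' a : ℕ} {l : List ℕ}
    (hS : S k = a :: l) (ha : a < N) (h : Run (f a) (Function.update S k l) t S')
    (h' : Run (forEach k N f) S' t' S'') : Run (forEach k N f) S (t + N + 2 + t') S'' := by
  have h1 := popCase_run (cls := id) (L := List.range N) (f := f) hS (by simpa using ha) h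
  refine (Run.loopStep (by rw [hS]; rfl) h1 h').weaken ?_
  simp only [List.length_range]
  omega

/-- Push the symbols of a list, in their order. -/
def pushes (k : ℕ) : List ℕ → Prog
  | [] => skip
  | a :: l => seq (push k a) (pushes k l)

theorem pushes_run (k : ℕ) (l : List ℕ) (S : St) :
    Run (pushes k l) S (l.length + 1) (Function.update S k (l.reverse ++ S k)) := by
  induction l generalizing S with
  | nil => simpa [pushes] using Run.skip S
  | cons a l ih =>
    have := Run.seq (Run.push k a S) (ih _)
    refine Run.weaken (t := 1 + (l.length + 1)) ?_ (by simp; omega)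
    simpa [pushes] using this

/-- Empty stack `k`, pushing `g a` on stack `d` for each symbol `a`. -/
def move (k N d : ℕ) (g : ℕ → List ℕ) : Prog := forEach k N fun a => pushes d (g a)

/-- What is popped first is buried deepest, so one move reverses the list and two moves preserve it.
-/
theorem move_run {k N d c : ℕ} {g : ℕ → List ℕ} (hkd : k ≠ d)
    (hg : ∀ a < N, (g a).length ≤ c) (l : List ℕ) (hl : ∀ a ∈ l, a < N) (S : St) (hS : S k = l) :
    Run (move k N d g) S (l.length * (c + N + 3) + 1)
      (Function.update (Function.update S k []) d ((l.flatMap g).reverse ++ S d)) := by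
  induction l generalizing S with
  | nil =>
    have : Function.update (Function.update S k []) d ((List.flatMap g []).reverse ++ S d) = S := by
      funext j
      by_cases h1 : j = d
      · subst h1; simp
      · by_cases h2 : j = k
        · subst h2; simp [h1, hS]
        · simp [h1, h2]
    rw [this]
    exact (forEach_nil hS).weaken (by simp)
  | cons a l ih =>
    have ha : a < N := hl a (by simp)
    have h1 := pushes_run d (g a) (Function.update S k l)
    have h2 := ih (fun b hb => hl b (by simp [hb]))
      (Function.update (Function.update S k l) d
        ((g a).reverse ++ Function.update S k l d)) (by simp [hkd])
    have h3 := forEach_cons hS ha h1 h2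
    have e : Function.update (Function.update (Function.update (Function.update S k l) d
        ((g a).reverse ++ Function.update S k l d)) k []) d ((l.flatMap g).reverse ++
          Function.update (Function.update S k l) d
            ((g a).reverse ++ Function.update S k l d) d) =
        Function.update (Function.update S k []) d (((a :: l).flatMap g).reverse ++ S d) := by
      funext j
      by_cases h1 : j = d
      · subst h1; simp [hkd.symm]
      · by_cases h2 : j = k
        · subst h2; simp [hkd, hkd.symm]
        · simp [h1, h2, hkd.symm]
    rw [e] at h3
    refine h3.weaken ?_
    have := hg a ha
    simp only [List.length_cons, Nat.succ_mul]
    omega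

/-- Empty stack `k`, pushing `g a` on stack `d` and `g' a` on stack `d'` for each symbol `a`. -/
def distribute (k N d d' : ℕ) (g g' : ℕ → List ℕ) : Prog :=
  forEach k N fun a => seq (pushes d (g a)) (pushes d' (g' a))

theorem distribute_run {k N d d' c : ℕ} {g g' : ℕ → List ℕ} (hkd : k ≠ d) (hkd' : k ≠ d')
    (hdd' : d ≠ d') (hg : ∀ a < N, (g a).length + (g' a).length ≤ c) (l : List ℕ)
    (hl : ∀ a ∈ l, a < N) (S : St) (hS : S k = l) :
    Run (distribute k N d d' g g') S (l.length * (c + N + 4) + 1)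
      (Function.update (Function.update (Function.update S k []) d
        ((l.flatMap g).reverse ++ S d)) d' ((l.flatMap g').reverse ++ S d')) := by
  induction l generalizing S with
  | nil =>
    have : Function.update (Function.update (Function.update S k []) d
        ((List.flatMap g []).reverse ++ S d)) d' ((List.flatMap g' []).reverse ++ S d') = S := by
      funext j
      by_cases h1 : j = d
      · subst h1; simp [hdd']
      · by_cases h2 : j = k
        · subst h2; simp [h1, hS, hkd']
        · by_cases h3 : j = d'
          · subst h3; simp
          · simp [h1, h2, h3]
    rw [this]
    exact (forEach_nil hS).weaken (by simp)
  | cons a l ih =>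
    have ha : a < N := hl a (by simp)
    have h1 := Run.seq (pushes_run d (g a) (Function.update S k l)) (pushes_run d' (g' a) _)
    have h2 := ih (fun b hb => hl b (by simp [hb])) (Function.update (Function.update
      (Function.update S k l) d ((g a).reverse ++ Function.update S k l d)) d'
      ((g' a).reverse ++ Function.update (Function.update S k l) d
        ((g a).reverse ++ Function.update S k l d) d')) (by simp [hkd, hkd'])
    have h3 := forEach_cons hS ha h1 h2
    refine Run.weaken (t := (g a).length + 1 + ((g' a).length + 1) + N + 2 +
      (l.length * (c + N + 4) + 1)) ?_ ?_
    · unfold distribute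
      convert h3 using 1
      clear h1 h2 h3 ih
      funext j
      by_cases e1 : j = d
      · subst e1; simp [hdd', hkd.symm]
      · by_cases e3 : j = d'
        · subst e3; simp [hdd'.symm, hkd'.symm]
        · by_cases e2 : j = k
          · subst e2; simp [e1, e3]
          · simp [e1, e2, e3]
    · have := hg a ha
      simp only [List.length_cons, Nat.succ_mul]
      omega

end Prog

/-! ### Polynomial-time functions between coded types -/

/-- Types whose elements are coded by lists over a finite alphabet of natural numbers. -/
class Coded (α : Type) where
  code : α → List ℕ
  bound : ℕ
  code_lt : ∀ a, ∀ s ∈ code a, s < bound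

open Coded

/-- Functions computed in polynomial time by programs that transform the contents of
stack `0`. -/
def FP {α β : Type} [Coded α] [Coded β] (f : α → β) : Prop :=
  ∃ (p : Prog) (T : Polynomial ℕ), ∀ a, Run p (st0 (code a)) (T.eval (code a).length)
    (st0 (code (f a)))

/-- The form in which `Run.frame` is used: the stacks below `n` other than `0` must be empty, those
above are preserved. -/
theorem Run.call {p : Prog} {l l' : List ℕ} {t : ℕ} (h : Run p (st0 l) t (st0 l')) {n : ℕ}
    (hn : p.bound ≤ n) (h0 : 0 < n) (S : St) (hS : S 0 = l)
    (hS' : ∀ k, 0 < k → k < n → S k = []) : Run p S t (Function.update S 0 l') := by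
  have h1 := h.frame n hn S
  convert h1 using 1
  · funext k
    split_ifs with hk
    · rcases Nat.eq_zero_or_pos k with rfl | hk'
      · simp [st0, hS]
      · simp [st0, hk'.ne', hS' k hk' hk]
    · rfl
  · funext k
    split_ifs with hk
    · rcases Nat.eq_zero_or_pos k with rfl | hk'
      · simp [st0]
      · simp [st0, hk'.ne', hS' k hk' hk]
    · rw [Function.update_of_ne (by omega)]

theorem Run.congr {p : Prog} {S S' S'' : St} {t : ℕ} (h : Run p S t S') (e : S' = S'') :
    Run p S t S'' := e ▸ h

section Basic

variable {α β γ δ : Type} [Coded α] [Coded β] [Coded γ] [Coded δ]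

theorem FP.id : FP (fun a : α => a) :=
  ⟨Prog.skip, 1, fun a => by simpa using Run.skip _⟩

/-- Only the code of the result matters, so a result may be reinterpreted in another type at no
cost. -/
theorem FP.of_code_eq {f : α → β} {g : α → γ} (hf : FP f) (h : ∀ a, code (g a) = code (f a)) :
    FP g := by
  obtain ⟨p, T, hp⟩ := hf
  exact ⟨p, T, fun a => by rw [h]; exact hp a⟩

theorem FP.length_le {f : α → β} (hf : FP f) :
    ∃ T : Polynomial ℕ, ∀ a, (code (f a)).length ≤ T.eval (code a).length := by
  obtain ⟨p, T, hp⟩ := hf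
  refine ⟨Polynomial.X + T, fun a => ?_⟩
  have := (hp a).length_le 0
  simpa [st0] using this

theorem FP.comp {g : β → γ} {f : α → β} (hg : FP g) (hf : FP f) : FP (fun a => g (f a)) := by
  obtain ⟨p, T, hp⟩ := hf
  obtain ⟨q, U, hq⟩ := hg
  refine ⟨p.seq q, T + U.comp (Polynomial.X + T), fun a => ?_⟩
  refine ((hp a).seq (hq (f a))).weaken ?_
  have := (hp a).length_le 0
  simp only [st0, Function.update_self] at this
  simp only [Polynomial.eval_add, Polynomial.eval_comp, Polynomial.eval_X]
  have := natPoly_mono U this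
  omega

/-! ### Pairs of coded objects -/

instance Coded.prod : Coded (α × β) where
  code x := (code x.1).map (fun s => 2 * s) ++ (code x.2).map (fun s => 2 * s + 1)
  bound := 2 * Coded.bound α + 2 * Coded.bound β
  code_lt := by
    intro a s hs
    simp only [List.mem_append, List.mem_map] at hs
    rcases hs with ⟨r, hr, rfl⟩ | ⟨r, hr, rfl⟩
    · have := code_lt _ r hr; omega
    · have := code_lt _ r hr; omega

theorem code_prod (x : α × β) :
    code x = (code x.1).map (fun s => 2 * s) ++ (code x.2).map (fun s => 2 * s + 1) := rfl

theorem length_code_prod (x : α × β) :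
    (code x).length = (code x.1).length + (code x.2).length := by
  simp [code_prod]

/-- Duplicate stack `0` on stack `n + 1`, using stack `n`. -/
theorem copy_run {N n : ℕ} (l : List ℕ) (hl : ∀ a ∈ l, a < N) (S : St) (hS : S 0 = l)
    (h1 : S (n + 1) = []) (h2 : S (n + 2) = []) :
    Run ((Prog.move 0 N (n + 1) (fun a => [a])).seq
      (Prog.distribute (n + 1) N 0 (n + 2) (fun a => [a]) (fun a => [a])))
      S (l.length * (2 * N + 20) + 2) (Function.update S (n + 2) l) := by
  have r1 := Prog.move_run (k := 0) (N := N) (d := n + 1) (c := 1) (g := fun a => [a]) (by omega)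
    (by simp) l hl S hS
  have r2 := Prog.distribute_run (k := n + 1) (N := N) (d := 0) (d' := n + 2) (c := 2)
    (g := fun a => [a]) (g' := fun a => [a]) (by omega) (by omega) (by omega) (by simp)
    l.reverse (by simpa using hl) _ (by simp [h1] :
      Function.update (Function.update S 0 []) (n + 1)
        ((l.flatMap (fun a => [a])).reverse ++ S (n + 1)) (n + 1) = l.reverse)
  refine Run.weaken (t := l.length * (1 + N + 3) + 1 + (l.reverse.length * (2 + N + 4) + 1)) ?_ ?_
  · convert r1.seq r2 using 1
    funext j
    by_cases j2 : j = n + 2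
    · subst j2; simp [h2]
    · by_cases j0 : j = 0
      · subst j0; simp [hS]
      · by_cases j1 : j = n + 1
        · subst j1; simp [h1]
        · simp [j0, j1, j2]
  · rw [List.length_reverse]; ring_nf; omega

/-- The detour through stack `n + 1` restores the orientation of the list. -/
theorem moveBack_run {N n : ℕ} (l : List ℕ) (hl : ∀ a ∈ l, a < N) (S : St) {k : ℕ} (hS : S k = l)
    (hk : k ≠ n + 1) (hk0 : k ≠ 0) (h1 : S (n + 1) = []) (h0 : S 0 = []) :
    Run ((Prog.move k N (n + 1) (fun a => [a])).seq (Prog.move (n + 1) N 0 (fun a => [a])))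
      S (l.length * (2 * N + 20) + 2) (Function.update (Function.update S k []) 0 l) := by
  have r1 := Prog.move_run (k := k) (N := N) (d := n + 1) (c := 1) (g := fun a => [a]) hk
    (by simp) l hl S hS
  have r2 := Prog.move_run (k := n + 1) (N := N) (d := 0) (c := 1) (g := fun a => [a])
    (by omega) (by simp) l.reverse (by simpa using hl) _ (by simp [h1] :
      Function.update (Function.update S k []) (n + 1)
        ((l.flatMap (fun a => [a])).reverse ++ S (n + 1)) (n + 1) = l.reverse)
  refine Run.weaken (t := l.length * (1 + N + 3) + 1 + (l.reverse.length * (1 + N + 3) + 1)) ?_ ?_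
  · convert r1.seq r2 using 1
    funext j
    by_cases j0 : j = 0
    · subst j0; simp [hk0.symm, h0]
    · by_cases j1 : j = n + 1
      · subst j1; simp [h1, hk.symm]
      · by_cases j2 : j = k
        · subst j2; simp [hk, hk0]
        · simp [j0, j1, j2]
  · rw [List.length_reverse]; ring_nf; omega

/-- The program computing the pair of the results of two programs. -/
def Prog.pair (p q : Prog) (N n : ℕ) : Prog :=
  (((Prog.move 0 N (n + 1) (fun a => [a])).seq
      (Prog.distribute (n + 1) N 0 (n + 2) (fun a => [a]) (fun a => [a]))).seq (p.seq
      (Prog.move 0 N (n + 3) (fun a => [2 * a])))).seq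
      (((Prog.move (n + 2) N (n + 1) (fun a => [a])).seq
        (Prog.move (n + 1) N 0 (fun a => [a]))).seq (q.seq
      ((Prog.move 0 N (n + 1) (fun a => [2 * a + 1])).seq
        ((Prog.move (n + 1) N 0 (fun a => [a])).seq
          (Prog.move (n + 3) N 0 (fun a => [a]))))))

/-- The input is saved on stack `n + 2`, the first result is parked, with doubled symbols, on stack
`n + 3`, and the input is restored before the second program runs. Stacks up to `n` are empty
whenever a subprogram is called, as `Run.call` requires. -/
theorem Prog.pair_run {p q : Prog} {N n t u : ℕ} {x y z : List ℕ} (hp : Run p (st0 x) t (st0 y))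
    (hq : Run q (st0 x) u (st0 z)) (hpn : p.bound ≤ n + 1) (hqn : q.bound ≤ n + 1)
    (hxN : ∀ s ∈ x, s < N) (hyN : ∀ s ∈ y, s < N) (hzN : ∀ s ∈ z, s < N)
    (hyN' : ∀ s ∈ y.map (fun s => 2 * s), s < N)
    (hzN' : ∀ s ∈ z.map (fun s => 2 * s + 1), s < N) :
    Run (Prog.pair p q N n) (st0 x)
      ((2 * N + 20) * (2 * x.length + 2 * y.length + 2 * z.length) + 12 + t + u)
      (st0 (y.map (fun s => 2 * s) ++ z.map (fun s => 2 * s + 1))) := by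
  let S1 : St := Function.update (st0 x) (n + 2) x
  have r1 : Run _ (st0 x) _ S1 := copy_run (N := N) (n := n) x hxN (st0 x) (by simp [st0])
    (by simp [st0]) (by simp [st0])
  let S2 : St := Function.update (st0 y) (n + 2) x
  have r2 := Run.congr (S'' := S2) (
    Run.call hp hpn (by omega) S1 (by simp [S1, st0]) (fun k hk hk' => by
      simp [S1, st0, hk.ne', (show k ≠ n + 2 by omega)])) (by
    funext j
    by_cases j0 : j = 0
    · subst j0; simp [S2, st0]
    · simp [S2, S1, st0, j0, Function.update_apply])
  let S3 : St := Function.update (Function.update (fun _ => []) (n + 2) x) (n + 3)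
    (y.map (fun s => 2 * s)).reverse
  have r3 := Run.congr (S'' := S3) (
    Prog.move_run (k := 0) (N := N) (d := n + 3) (c := 1) (g := fun a => [2 * a])
      (by omega) (by simp) y hyN S2 (by simp [S2, st0])) (by
    funext j
    by_cases j0 : j = 0
    · subst j0; simp [S3]
    · simp only [S3, S2, st0, Function.update_apply, j0, List.map_eq_flatMap]
      split_ifs <;> simp_all)
  let S4 : St := Function.update (st0 x) (n + 3) (y.map (fun s => 2 * s)).reverse
  have r4 := Run.congr (S'' := S4) (
    moveBack_run (N := N) (n := n) x hxN S3 (k := n + 2) (by simp [S3]) (by omega)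
      (by omega) (by simp [S3]) (by simp [S3])) (by
    funext j
    simp only [S3, S4, st0, Function.update_apply]
    split_ifs <;> simp_all)
  let S5 : St := Function.update (st0 z) (n + 3) (y.map (fun s => 2 * s)).reverse
  have r5 := Run.congr (S'' := S5) (
    Run.call hq hqn (by omega) S4 (by simp [S4, st0]) (fun k hk hk' => by
      simp [S4, st0, hk.ne', (show k ≠ n + 3 by omega)])) (by
    funext j
    by_cases j0 : j = 0
    · subst j0; simp [S5, st0]
    · simp [S5, S4, st0, j0, Function.update_apply])
  let S6 : St := Function.update (Function.update (fun _ => []) (n + 3)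
    (y.map (fun s => 2 * s)).reverse) (n + 1) (z.map (fun s => 2 * s + 1)).reverse
  have r6 := Run.congr (S'' := S6) (
    Prog.move_run (k := 0) (N := N) (d := n + 1) (c := 1) (g := fun a => [2 * a + 1])
      (by omega) (by simp) z hzN S5 (by simp [S5, st0])) (by
    funext j
    by_cases j0 : j = 0
    · subst j0; simp [S6]
    · simp only [S6, S5, st0, Function.update_apply, j0, List.map_eq_flatMap]
      split_ifs <;> simp_all)
  let S7 : St := Function.update (st0 (z.map (fun s => 2 * s + 1))) (n + 3)
    (y.map (fun s => 2 * s)).reverse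
  have r7 := Run.congr (S'' := S7) (
    Prog.move_run (k := n + 1) (N := N) (d := 0) (c := 1) (g := fun a => [a])
      (by omega) (by simp) (z.map (fun s => 2 * s + 1)).reverse (by simpa using hzN') S6
      (by simp [S6])) (by
    funext j
    simp only [S7, S6, st0, Function.update_apply]
    split_ifs <;> simp_all)
  have r8 := Run.congr (S'' := (st0 (y.map (fun s => 2 * s) ++ z.map (fun s => 2 * s + 1)))) (
    Prog.move_run (k := n + 3) (N := N) (d := 0) (c := 1) (g := fun a => [a])
      (by omega) (by simp) (y.map (fun s => 2 * s)).reverse (by simpa using hyN') S7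
      (by simp [S7])) (by
    funext j
    simp only [S7, st0, Function.update_apply]
    split_ifs <;> simp_all)
  refine ((r1.seq (r2.seq r3)).seq (r4.seq (r5.seq (r6.seq (r7.seq r8))))).weaken ?_
  simp only [List.length_reverse, List.length_map]
  have e2 : y.length * (1 + N + 3) ≤ (2 * N + 20) * y.length := by
    rw [mul_comm]; exact Nat.mul_le_mul_right _ (by omega)
  have e3 : z.length * (1 + N + 3) ≤ (2 * N + 20) * z.length := by
    rw [mul_comm]; exact Nat.mul_le_mul_right _ (by omega)
  have e4 : (2 * N + 20) * (2 * x.length + 2 * y.length + 2 * z.length) =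
      2 * (x.length * (2 * N + 20)) + 2 * ((2 * N + 20) * y.length) +
        2 * ((2 * N + 20) * z.length) := by ring
  rw [e4]
  omega

theorem FP.pair {f : α → β} {g : α → γ} (hf : FP f) (hg : FP g) : FP (fun a => (f a, g a)) := by
  obtain ⟨p, T, hp⟩ := hf
  obtain ⟨q, U, hq⟩ := hg
  -- Large enough for the symbols of the input and of both results, and for the even and odd symbols
  -- in the code of the pair.
  let N := 2 * (Coded.bound α + Coded.bound β + Coded.bound γ)
  obtain ⟨n, hpn, hqn⟩ : ∃ n, p.bound ≤ n + 1 ∧ q.bound ≤ n + 1 :=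
    ⟨max p.bound q.bound, by omega, by omega⟩
  refine ⟨Prog.pair p q N n,
    Polynomial.C (2 * N + 20) * (6 * Polynomial.X + 2 * T + 2 * U) + 12 + T + U, fun a => ?_⟩
  have hpl := (hp a).length_le 0
  have hql := (hq a).length_le 0
  simp only [st0, Function.update_self] at hpl hql
  refine (Prog.pair_run (N := N) (hp a) (hq a) hpn hqn
    (fun s hs => by have := code_lt _ s hs; omega) (fun s hs => by have := code_lt _ s hs; omega)
    (fun s hs => by have := code_lt _ s hs; omega) (fun s hs => ?_) (fun s hs => ?_)).weaken ?_
  · obtain ⟨r, hr, rfl⟩ := List.mem_map.1 hs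
    have := code_lt _ r hr; omega
  · obtain ⟨r, hr, rfl⟩ := List.mem_map.1 hs
    have := code_lt _ r hr; omega
  · simp only [Polynomial.eval_add, Polynomial.eval_mul, Polynomial.eval_C, Polynomial.eval_X,
      Polynomial.eval_ofNat]
    have := Nat.mul_le_mul_left (2 * N + 20) (show 2 * (code a).length +
      2 * (code (f a)).length + 2 * (code (g a)).length ≤ 6 * (code a).length +
      2 * T.eval (code a).length + 2 * U.eval (code a).length by omega)
    omega

end Basic

/-! ### Iteration -/

theorem flatMap_left_code (x y : List ℕ) :
    (x.map (fun s => 2 * s) ++ y.map (fun s => 2 * s + 1)).flatMap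
      (fun s => if s % 2 = 0 then [s / 2] else []) = x := by
  have h1 : ∀ s : ℕ, (2 * s + 1) % 2 = 1 := fun s => by omega
  have h2 : (y.map (fun s => 2 * s + 1)).flatMap
      (fun s => if s % 2 = 0 then [s / 2] else []) = [] := by
    simp [List.flatMap_eq_nil_iff, h1]
  rw [List.flatMap_append, h2, List.append_nil]
  induction x with
  | nil => rfl
  | cons a x ih => rw [List.map_cons, List.flatMap_cons, ih]; simp

theorem flatMap_right_code (x y : List ℕ) :
    (x.map (fun s => 2 * s) ++ y.map (fun s => 2 * s + 1)).flatMap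
      (fun s => if s % 2 = 0 then [] else [s / 2]) = y := by
  have h1 : ∀ s : ℕ, (2 * s + 1) % 2 = 1 := fun s => by omega
  have h2 : (x.map (fun s => 2 * s)).flatMap
      (fun s => if s % 2 = 0 then [] else [s / 2]) = [] := by
    simp [List.flatMap_eq_nil_iff]
  rw [List.flatMap_append, h2, List.nil_append]
  induction y with
  | nil => rfl
  | cons a y ih => rw [List.map_cons, List.flatMap_cons, ih]; simp [h1]; omega

/-- The program iterating another one as often as the first component of a pair is long. -/
def Prog.iter (p : Prog) (N n : ℕ) : Prog :=
  ((Prog.distribute 0 N n (n + 1) (fun s => if s % 2 = 0 then [s / 2] else [])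
      (fun s => if s % 2 = 0 then [] else [s / 2])).seq
    (Prog.move (n + 1) N 0 (fun a => [a]))).seq
      (Prog.loop n Option.isSome ((Prog.pop n).seq p))

/-- Stack `n` serves as the counter. It lies outside the range of `p`, so each round pops one
counter symbol and leaves the rest intact. -/
theorem Prog.iterLoop_run {p : Prog} {n t : ℕ} (hpn : p.bound ≤ n) (h0 : 0 < n) (l : List ℕ) :
    ∀ x : ℕ → List ℕ, (∀ i < l.length, Run p (st0 (x i)) t (st0 (x (i + 1)))) →
      Run (Prog.loop n Option.isSome ((Prog.pop n).seq p)) (Function.update (st0 (x 0)) n l)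
        (l.length * (t + 2) + 1) (st0 (x l.length)) := by
  induction l with
  | nil =>
    intro x _
    have : Function.update (st0 (x 0)) n [] = st0 (x 0) := by
      funext j
      by_cases hj : j = n
      · subst hj; simp [st0, h0.ne']
      · simp [hj]
    rw [this]
    exact (Run.loopDone (by simp [st0, h0.ne'])).weaken (by simp)
  | cons a l ih =>
    intro x hx
    have h1 := Run.pop n (Function.update (st0 (x 0)) n (a :: l))
    have h2 := Run.call (hx 0 (by simp)) hpn h0 (Function.update (st0 (x 0)) n l)
      (by simp [st0, h0.ne]) (fun k hk hk' => by simp [st0, hk.ne', hk'.ne])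
    have h3 := ih (fun i => x (i + 1)) (fun i hi => hx (i + 1) (by simpa using hi))
    have e1 : Function.update (Function.update (st0 (x 0)) n (a :: l)) n
        ((Function.update (st0 (x 0)) n (a :: l) n).tail) = Function.update (st0 (x 0)) n l := by
      simp
    have e2 : Function.update (Function.update (st0 (x 0)) n l) 0 (x (0 + 1)) =
        Function.update (st0 (x (0 + 1))) n l := by
      funext j
      by_cases hj : j = 0
      · subst hj; simp [st0, h0.ne]
      · simp [st0, hj, Function.update_apply]
    rw [e1] at h1
    rw [e2] at h2
    refine (Run.loopStep (by simp) (h1.seq h2) h3).weaken ?_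
    simp only [List.length_cons, Nat.succ_mul]
    omega

theorem Prog.iter_run {p : Prog} {N n t : ℕ} (hpn : p.bound ≤ n) (h0 : 0 < n) (c : List ℕ)
    (x : ℕ → List ℕ) (hx : ∀ i < c.length, Run p (st0 (x i)) t (st0 (x (i + 1))))
    (hN : ∀ s ∈ c.map (fun s => 2 * s) ++ (x 0).map (fun s => 2 * s + 1), s < N)
    (hN' : ∀ s ∈ x 0, s < N) :
    Run (Prog.iter p N n) (st0 (c.map (fun s => 2 * s) ++ (x 0).map (fun s => 2 * s + 1)))
      ((c.length + (x 0).length) * (2 * N + 20) + c.length * (t + 2) + 3)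
      (st0 (x c.length)) := by
  set l := c.map (fun s => 2 * s) ++ (x 0).map (fun s => 2 * s + 1) with hl
  have r1 := Run.congr (S'' := Function.update (Function.update (fun _ => []) n c.reverse) (n + 1)
    (x 0).reverse) (Prog.distribute_run (k := 0) (N := N) (d := n) (d' := n + 1) (c := 1)
    (g := fun s => if s % 2 = 0 then [s / 2] else [])
    (g' := fun s => if s % 2 = 0 then [] else [s / 2]) (by omega) (by omega) (by omega)
    (fun a _ => by split_ifs <;> simp) l hN (st0 l) (by simp [st0])) (by
    rw [hl, flatMap_left_code, flatMap_right_code]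
    funext j
    by_cases e1 : j = n + 1
    · subst e1; simp [st0]
    · by_cases e2 : j = n
      · subst e2; simp [st0, h0.ne']
      · by_cases e3 : j = 0
        · subst e3; simp [e2]
        · simp [st0, e1, e2])
  have r2 := Run.congr (S'' := Function.update (st0 (x 0)) n c.reverse)
    (Prog.move_run (k := n + 1) (N := N) (d := 0) (c := 1) (g := fun a => [a]) (by omega)
    (by simp) (x 0).reverse (by simpa using hN') (Function.update
      (Function.update (fun _ => []) n c.reverse) (n + 1) (x 0).reverse) (by simp)) (by
    funext j
    by_cases e3 : j = 0
    · subst e3; simp [st0, h0.ne]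
    · by_cases e2 : j = n
      · subst e2; simp [h0.ne']
      · by_cases e1 : j = n + 1
        · subst e1; simp [st0]
        · simp [st0, e1, e2, e3])
  have r3 := Prog.iterLoop_run (t := t) hpn h0 c.reverse x (by simpa using hx)
  rw [List.length_reverse] at r3
  refine ((r1.seq r2).seq r3).weaken ?_
  have hlen : l.length = c.length + (x 0).length := by simp [hl]
  rw [hlen, List.length_reverse]
  ring_nf
  omega

/-- The bound `B` on all intermediate states is essential: repeating a polynomial-time step could
otherwise enlarge the state exponentially. The number of rounds is given in unary, as the length of
a code. -/
theorem FP.iterate {α σ : Type} [Coded α] [Coded σ] {step : σ → σ} (hstep : FP step)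
    (B : Polynomial ℕ) (hB : ∀ (c : α) (s : σ) (i : ℕ), i ≤ (code c).length →
      (code (step^[i] s)).length ≤ B.eval (code (c, s)).length) :
    FP (fun x : α × σ => step^[(code x.1).length] x.2) := by
  obtain ⟨p, T, hp⟩ := hstep
  let N := 2 * (Coded.bound α + Coded.bound σ)
  refine ⟨Prog.iter p N (p.bound + 1), Polynomial.X * Polynomial.C (2 * N + 20) +
    Polynomial.X * (T.comp B + 2) + 3, fun x => ?_⟩
  obtain ⟨c, s⟩ := x
  have h := Prog.iter_run (p := p) (N := N) (n := p.bound + 1)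
    (t := T.eval (B.eval (code (c, s)).length)) (by omega) (by omega)
    (code c) (fun i => code (step^[i] s)) (fun i hi => by
      rw [Function.iterate_succ_apply']
      exact (hp _).weaken (natPoly_mono T (hB c s i hi.le)))
    (fun r hr => by
      have := code_lt (c, s) r hr
      simp only [Coded.bound] at this
      omega)
    (fun r hr => by have := code_lt s r hr; omega)
  refine h.weaken ?_
  simp only [Polynomial.eval_add, Polynomial.eval_mul, Polynomial.eval_C, Polynomial.eval_X,
    Polynomial.eval_ofNat, Polynomial.eval_comp, length_code_prod, Function.iterate_zero, id_eq]
  gcongr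
  omega

theorem length_code_iterate_le {σ : Type} [Coded σ] {step : σ → σ} {C : ℕ}
    (h : ∀ s, (code (step s)).length ≤ (code s).length + C) (s : σ) (i : ℕ) :
    (code (step^[i] s)).length ≤ (code s).length + C * i := by
  induction i with
  | zero => simp
  | succ i ih =>
    rw [Function.iterate_succ_apply']
    have := h (step^[i] s)
    rw [Nat.mul_succ]
    omega

/-- Growth by a constant per round keeps the states linear in the size of the input. -/
theorem FP.iterate_of_le {α σ : Type} [Coded α] [Coded σ] {step : σ → σ} (hstep : FP step)
    (C : ℕ) (h : ∀ s, (code (step s)).length ≤ (code s).length + C) :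
    FP (fun x : α × σ => step^[(code x.1).length] x.2) := by
  refine FP.iterate hstep (Polynomial.X + Polynomial.C C * Polynomial.X) fun c s i hi => ?_
  refine (length_code_iterate_le h s i).trans ?_
  simp only [Polynomial.eval_add, Polynomial.eval_mul, Polynomial.eval_C, Polynomial.eval_X,
    length_code_prod]
  have : C * i ≤ C * ((code c).length + (code s).length) := Nat.mul_le_mul_left _ (by omega)
  omega

/-! ### Transducers -/

/-- The output of a finite-state transducer. -/
def transduce {Q : Type} (δ : Q → ℕ → Q) (out : Q → ℕ → List ℕ) (fin : Q → List ℕ) :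
    Q → List ℕ → List ℕ
  | q, [] => fin q
  | q, a :: l => out q a ++ transduce δ out fin (δ q a) l

/-- The contents of the first three stacks. -/
def st3 (l m r : List ℕ) : St := fun k =>
  if k = 0 then l else if k = 1 then m else if k = 2 then r else []

/-- Stack `0` holds the rest of the input, stack `1` the state as a single symbol, and stack `2` the
output produced so far, in reverse. A final move puts the output on stack `0` in the right order. -/
theorem FP.of_transduce {α β Q : Type} [Coded α] [Coded β] [Fintype Q] {f : α → β}
    (δ : Q → ℕ → Q) (out : Q → ℕ → List ℕ) (fin : Q → List ℕ) (q₀ : Q)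
    (h : ∀ a, transduce δ out fin q₀ (code a) = code (f a)) : FP f := by
  classical
  have : Nonempty Q := ⟨q₀⟩
  let N := Coded.bound α
  let L : List Q := Finset.univ.toList
  have hL : ∀ q, q ∈ L := fun q => by simp [L]
  let e : Q → ℕ := fun q => (Fintype.equivFin Q q).val
  let cls : ℕ → Q := Function.invFun e
  have hcls : ∀ q, cls (e q) = q := Function.leftInverse_invFun
    (fun a b hab => (Fintype.equivFin Q).injective (Fin.ext hab))
  obtain ⟨c, hc⟩ : ∃ c, ∀ q, ∀ a < N, (out q a).length ≤ c := by
    refine ⟨Finset.univ.sup fun q => (Finset.range N).sup fun a => (out q a).length,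
      fun q a ha => ?_⟩
    exact le_trans (Finset.le_sup (f := fun a => (out q a).length) (Finset.mem_range.2 ha))
      (Finset.le_sup (f := fun q => (Finset.range N).sup fun a => (out q a).length)
        (Finset.mem_univ q))
  obtain ⟨c', hc'⟩ : ∃ c, ∀ q, (fin q).length ≤ c :=
    ⟨Finset.univ.sup fun q => (fin q).length, fun q =>
      Finset.le_sup (f := fun q => (fin q).length) (Finset.mem_univ q)⟩
  let body : ℕ → Prog := fun a => Prog.popCase 1 cls L fun q =>
    (Prog.push 1 (e (δ q a))).seq (Prog.pushes 2 (out q a))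
  let last : Prog := Prog.popCase 1 cls L fun q => Prog.pushes 2 (fin q)
  have key : ∀ (l : List ℕ), (∀ a ∈ l, a < N) → ∀ (q : Q) (r : List ℕ),
      Run ((Prog.forEach 0 N body).seq last) (st3 l [e q] r)
        (l.length * (c + L.length + N + 10) + (c' + L.length + 10))
        (st3 [] [] ((transduce δ out fin q l).reverse ++ r)) := by
    intro l
    induction l with
    | nil =>
      intro _ q r
      have h1 := Prog.forEach_nil (k := 0) (N := N) (f := body) (S := st3 [] [e q] r) rfl
      have h2 := Prog.popCase_run (k := 1) (cls := cls) (L := L) (S := st3 [] [e q] r)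
        (f := fun q => Prog.pushes 2 (fin q)) (a := e q) (l := []) rfl (hL _)
        (Prog.pushes_run _ _ _)
      refine Run.congr ((h1.seq h2).weaken ?_) ?_
      · have := hc' (cls (e q)); simp; omega
      · funext j
        rw [hcls]
        by_cases j2 : j = 2
        · subst j2; simp [st3, transduce]
        · by_cases j1 : j = 1
          · subst j1; simp [st3]
          · simp [st3, j1, j2]
    | cons a l ih =>
      intro hl q r
      have h1 := Prog.popCase_run (k := 1) (cls := cls) (L := L) (S := st3 l [e q] r)
        (f := fun q => (Prog.push 1 (e (δ q a))).seq (Prog.pushes 2 (out q a))) (a := e q)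
        (l := []) rfl (hL _) (Run.seq (Run.push _ _ _) (Prog.pushes_run _ _ _))
      have e1 : Function.update (st3 (a :: l) [e q] r) 0 l = st3 l [e q] r := by
        funext j
        by_cases j0 : j = 0
        · subst j0; simp [st3]
        · simp [st3, j0]
      have h1' := Run.congr (S'' := st3 l [e (δ q a)] ((out q a).reverse ++ r)) h1 (by
        funext j
        rw [hcls]
        by_cases j2 : j = 2
        · subst j2; simp [st3]
        · by_cases j1 : j = 1
          · subst j1; simp [st3]
          · simp [st3, j1, j2])
      rw [← e1] at h1'
      have h2 := ih (fun b hb => hl b (by simp [hb])) (δ q a) ((out q a).reverse ++ r)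
      -- The induction hypothesis concerns the loop followed by the final output. It has to be split
      -- so that one more round can be put in front of the loop; `weaken` prevents a plain
      -- inversion.
      have e2 : ∀ (t : ℕ) (S S' : St), Run ((Prog.forEach 0 N body).seq last) S t S' →
          ∃ t₁ t₂ S₁, t₁ + t₂ ≤ t ∧ Run (Prog.forEach 0 N body) S t₁ S₁ ∧ Run last S₁ t₂ S' := by
        intro t S S' h
        generalize hp : (Prog.forEach 0 N body).seq last = p at h
        induction h with
        | seq h h' =>
          simp only [Prog.seq.injEq] at hp
          obtain ⟨rfl, rfl⟩ := hp
          exact ⟨_, _, _, le_rfl, h, h'⟩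
        | weaken _ hle ih =>
          obtain ⟨t₁, t₂, S₁, h1, h2, h3⟩ := ih hp
          exact ⟨t₁, t₂, S₁, h1.trans hle, h2, h3⟩
        | _ => simp at hp
      obtain ⟨t₁, t₂, S₁, ht, h3, h4⟩ := e2 _ _ _ h2
      have h5 := Prog.forEach_cons (k := 0) (N := N) (f := body) (S := st3 (a :: l) [e q] r) rfl
        (hl a (by simp)) h1' h3
      refine Run.congr ((h5.seq h4).weaken ?_) (by simp [transduce])
      have := hc (cls (e q)) a (hl a (by simp))
      simp only [List.length_cons, Nat.succ_mul]
      omega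
  refine ⟨(Prog.push 1 (e q₀)).seq (((Prog.forEach 0 N body).seq last).seq
    (Prog.move 2 (Coded.bound β) 0 (fun a => [a]))), 1 + (Polynomial.X *
      Polynomial.C (c + L.length + N + 10) + Polynomial.C (c' + L.length + 10) +
      ((1 + (Polynomial.X * Polynomial.C (c + L.length + N + 10) +
        Polynomial.C (c' + L.length + 10))) * Polynomial.C (1 + Coded.bound β + 3) + 1)),
    fun a => ?_⟩
  have h1 := Run.congr (S'' := st3 (code a) [e q₀] []) (Run.push 1 (e q₀) (st0 (code a))) (by
    funext j
    by_cases j1 : j = 1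
    · subst j1; simp [st3, st0]
    · by_cases j0 : j = 0
      · subst j0; simp [st3, st0]
      · simp [st3, st0, j0, j1])
  have h2 := key (code a) (code_lt a) q₀ []
  rw [h, List.append_nil] at h2
  have h3 := Prog.move_run (k := 2) (N := Coded.bound β) (d := 0) (c := 1) (g := fun a => [a])
    (by omega) (by simp) (code (f a)).reverse (by simpa using code_lt (f a))
    (st3 [] [] (code (f a)).reverse) rfl
  have hlen := h2.length_le 2
  refine Run.congr ((h1.seq (h2.seq h3)).weaken ?_) ?_
  · simp [st3] at hlen
    simp only [Polynomial.eval_add, Polynomial.eval_mul, Polynomial.eval_C, Polynomial.eval_X,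
      Polynomial.eval_one, List.length_reverse]
    have := Nat.mul_le_mul_right (1 + Coded.bound β + 3) hlen
    nlinarith
  · funext j
    by_cases j0 : j = 0
    · subst j0; simp [st3, st0]
    · by_cases j2 : j = 2
      · subst j2; simp [st0]
      · simp [st3, st0, j0, j2]

/-! ### Stack machines as programs -/

section Simulate

variable {K : Type} {Γ : K → Type} {Λ σ : Type}

/-- The symbols that a statement may push. -/
def pushedSymbols : TM2.Stmt Γ Λ σ → Set (Σ k, Γ k)
  | TM2.Stmt.push k f q => Set.range (fun v => ⟨k, f v⟩) ∪ pushedSymbols q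
  | TM2.Stmt.peek _ _ q => pushedSymbols q
  | TM2.Stmt.pop _ _ q => pushedSymbols q
  | TM2.Stmt.load _ q => pushedSymbols q
  | TM2.Stmt.branch _ p q => pushedSymbols p ∪ pushedSymbols q
  | TM2.Stmt.goto _ => ∅
  | TM2.Stmt.halt => ∅

/-- The alphabets of the work stacks may be infinite, but a pushed symbol depends only on the
finitely many values of the local variables. -/
theorem finite_pushedSymbols [Finite σ] (q : TM2.Stmt Γ Λ σ) : (pushedSymbols q).Finite := by
  induction q with
  | push k f q ih => exact (Set.finite_range _).union ih
  | peek _ _ q ih => exact ih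
  | pop _ _ q ih => exact ih
  | load _ q ih => exact ih
  | branch _ p q ih ih' => exact ih.union ih'
  | goto _ => exact Set.finite_empty
  | halt => exact Set.finite_empty

/-- A numbering of the stacks, of the stack symbols, and of the control states of a machine. -/
structure Numbering (Γ : K → Type) (Λ σ : Type) where
  stack : K → ℕ
  stack_inj : Function.Injective stack
  two_le : ∀ k, 2 ≤ stack k
  sym : ∀ k, Γ k → ℕ
  unsym : ∀ k, ℕ → Option (Γ k)
  ctl : Λ × σ → ℕ
  unctl : ℕ → Λ × σ
  unctl_ctl : ∀ x, unctl (ctl x) = x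

namespace Numbering

variable (ν : Numbering Γ Λ σ)

open Classical in
/-- The stacks of a program simulating a machine. -/
noncomputable def content (S : ∀ k, List (Γ k)) (c : List ℕ) : St := fun j =>
  if j = 1 then c else if h : ∃ k, ν.stack k = j then (S h.choose).map (ν.sym _) else []

theorem content_one (S : ∀ k, List (Γ k)) (c : List ℕ) : ν.content S c 1 = c := if_pos rfl

theorem content_stack (S : ∀ k, List (Γ k)) (c : List ℕ) (k : K) :
    ν.content S c (ν.stack k) = (S k).map (ν.sym k) := by
  have h : ∃ k', ν.stack k' = ν.stack k := ⟨k, rfl⟩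
  have h1 : ν.stack k ≠ 1 := by have := ν.two_le k; omega
  have e : h.choose = k := ν.stack_inj h.choose_spec
  rw [content, if_neg h1, dif_pos h]
  rw [e]

theorem content_of_notMem (S : ∀ k, List (Γ k)) (c : List ℕ) {j : ℕ} (h1 : j ≠ 1)
    (h : ¬ ∃ k, ν.stack k = j) : ν.content S c j = [] := by
  rw [content, if_neg h1, dif_neg h]

theorem update_content [DecidableEq K] (S : ∀ k, List (Γ k)) (c : List ℕ) (k : K)
    (l : List (Γ k)) : Function.update (ν.content S c) (ν.stack k) (l.map (ν.sym k)) =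
      ν.content (Function.update S k l) c := by
  have hk1 : ν.stack k ≠ 1 := by have := ν.two_le k; omega
  funext j
  by_cases h1 : j = 1
  · subst h1
    rw [Function.update_of_ne hk1.symm, content_one, content_one]
  · by_cases h : ∃ k', ν.stack k' = j
    · obtain ⟨k', rfl⟩ := h
      rw [content_stack]
      by_cases hk : k' = k
      · subst hk; simp
      · rw [Function.update_of_ne (fun h => hk (ν.stack_inj h)), content_stack,
          Function.update_of_ne hk]
    · rw [Function.update_of_ne (fun h' => h ⟨k, h'.symm⟩), content_of_notMem _ _ _ h1 h,
        content_of_notMem _ _ _ h1 h]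

theorem update_content_one (S : ∀ k, List (Γ k)) (c c' : List ℕ) :
    Function.update (ν.content S c) 1 c' = ν.content S c' := by
  funext j
  by_cases h1 : j = 1
  · subst h1; simp [content]
  · simp [content, h1]

/-- A symbol is faithfully represented. -/
def Good {k : K} (g : Γ k) : Prop := ν.unsym k (ν.sym k g) = some g

/-- The program simulating a statement executed with given values of the local variables. -/
def prog [DecidableEq σ] (vs : List σ) : TM2.Stmt Γ Λ σ → σ → Prog
  | TM2.Stmt.push k f q, v => (Prog.push (ν.stack k) (ν.sym k (f v))).seq (prog vs q v)
  | TM2.Stmt.peek k f q, v =>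
    Prog.switch (ν.stack k) (fun o => f v (o.bind (ν.unsym k))) (fun v' => prog vs q v') vs
  | TM2.Stmt.pop k f q, v =>
    Prog.switch (ν.stack k) (fun o => f v (o.bind (ν.unsym k)))
      (fun v' => (Prog.pop (ν.stack k)).seq (prog vs q v')) vs
  | TM2.Stmt.load a q, v => prog vs q (a v)
  | TM2.Stmt.branch b p q, v => bif b v then prog vs p v else prog vs q v
  | TM2.Stmt.goto l, v => Prog.push 1 (ν.ctl (l v, v))
  | TM2.Stmt.halt, _ => Prog.skip

/-- The code of the control state of a configuration. -/
def ctlList (c : TM2.Cfg Γ Λ σ) : List ℕ := c.l.elim [] fun l => [ν.ctl (l, c.var)]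

theorem head_bind {S : ∀ k, List (Γ k)} (hS : ∀ k, ∀ g ∈ S k, ν.Good g) (c : List ℕ) (k : K) :
    (ν.content S c (ν.stack k)).head?.bind (ν.unsym k) = (S k).head? := by
  rw [content_stack]
  have := hS k
  cases h : S k with
  | nil => rfl
  | cons g l =>
    rw [h] at this
    exact this g (by simp)

/-- The simulating program is unfolded separately for every value of the local variables, which is
therefore known at each program point; reading a stack branches over all possible new values. The
running time is thus a constant `C`, independent of the contents of the stacks. Good symbols are
exactly what makes reading back from numbers correct. -/
theorem prog_run [DecidableEq σ] [DecidableEq K] (vs : List σ) (hvs : ∀ v, v ∈ vs) (q : TM2.Stmt Γ Λ σ)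
    (hq : ∀ x ∈ pushedSymbols q, ν.Good x.2) :
    ∃ C, ∀ (v : σ) (S : ∀ k, List (Γ k)), (∀ k, ∀ g ∈ S k, ν.Good g) →
      Run (ν.prog vs q v) (ν.content S []) C
        (ν.content (TM2.stepAux q v S).stk (ν.ctlList (TM2.stepAux q v S))) ∧
      ∀ k, ∀ g ∈ (TM2.stepAux q v S).stk k, ν.Good g := by
  induction q with
  | push k f q ih =>
    obtain ⟨C, hC⟩ := ih (fun x hx => hq x (Or.inr hx))
    refine ⟨1 + C, fun v S hS => ?_⟩
    have hg : ∀ k', ∀ g ∈ Function.update S k (f v :: S k) k', ν.Good g := by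
      intro k' g hg
      by_cases hk : k' = k
      · subst hk
        simp only [Function.update_self, List.mem_cons] at hg
        rcases hg with rfl | hg
        · exact hq ⟨k', f v⟩ (Or.inl ⟨v, rfl⟩)
        · exact hS _ g hg
      · rw [Function.update_of_ne hk] at hg
        exact hS _ g hg
    obtain ⟨h1, h2⟩ := hC v _ hg
    refine ⟨(Run.congr (Run.push _ _ _) ?_).seq h1, h2⟩
    rw [content_stack, ← List.map_cons, update_content]
  | peek k f q ih =>
    obtain ⟨C, hC⟩ := ih hq
    refine ⟨C + vs.length, fun v S hS => ?_⟩
    obtain ⟨h1, h2⟩ := hC (f v (S k).head?) S hS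
    refine ⟨Prog.switch_run (hvs _) ?_, h2⟩
    rw [head_bind ν hS]
    exact h1
  | pop k f q ih =>
    obtain ⟨C, hC⟩ := ih hq
    refine ⟨1 + C + vs.length, fun v S hS => ?_⟩
    have hg : ∀ k', ∀ g ∈ Function.update S k (S k).tail k', ν.Good g := by
      intro k' g hg
      by_cases hk : k' = k
      · subst hk
        simp only [Function.update_self] at hg
        exact hS _ g (List.mem_of_mem_tail hg)
      · rw [Function.update_of_ne hk] at hg
        exact hS _ g hg
    obtain ⟨h1, h2⟩ := hC (f v (S k).head?) _ hg
    refine ⟨Prog.switch_run (hvs _) ?_, h2⟩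
    rw [head_bind ν hS]
    refine (Run.congr (Run.pop _ _) ?_).seq h1
    rw [content_stack, ← List.map_tail, update_content]
  | load a q ih =>
    obtain ⟨C, hC⟩ := ih hq
    exact ⟨C, fun v S hS => hC (a v) S hS⟩
  | branch b p q ih ih' =>
    obtain ⟨C, hC⟩ := ih (fun x hx => hq x (Or.inl hx))
    obtain ⟨C', hC'⟩ := ih' (fun x hx => hq x (Or.inr hx))
    refine ⟨C + C', fun v S hS => ?_⟩
    rw [TM2.stepAux, prog]
    cases b v with
    | true => exact ⟨(hC v S hS).1.weaken (by omega), (hC v S hS).2⟩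
    | false => exact ⟨(hC' v S hS).1.weaken (by omega), (hC' v S hS).2⟩
  | goto l =>
    refine ⟨1, fun v S hS => ⟨Run.congr (Run.push _ _ _) ?_, hS⟩⟩
    rw [content_one, update_content_one]
    rfl
  | halt => exact ⟨1, fun v S hS => ⟨Run.skip _, hS⟩⟩

/-- Stack `1` holds the control state as one symbol as long as the machine runs, and is empty once
it has halted; so emptiness of this stack ends the loop. -/
theorem loop_run [DecidableEq σ] [DecidableEq K] [DecidableEq Λ] (vs : List σ)
    (L : List (Λ × σ)) (hL : ∀ x, x ∈ L) (m : Λ → TM2.Stmt Γ Λ σ) (C : ℕ)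
    (hC : ∀ (l : Λ) (v : σ) (S : ∀ k, List (Γ k)), (∀ k, ∀ g ∈ S k, ν.Good g) →
      Run (ν.prog vs (m l) v) (ν.content S []) C
        (ν.content (TM2.stepAux (m l) v S).stk (ν.ctlList (TM2.stepAux (m l) v S))) ∧
      ∀ k, ∀ g ∈ (TM2.stepAux (m l) v S).stk k, ν.Good g) (s : ℕ) :
    ∀ c c' : TM2.Cfg Γ Λ σ, Steps (TM2.step m) s c c' → c'.l = none →
      (∀ k, ∀ g ∈ c.stk k, ν.Good g) →
      Run (Prog.loop 1 Option.isSome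
        (Prog.popCase 1 ν.unctl L fun x => ν.prog vs (m x.1) x.2))
        (ν.content c.stk (ν.ctlList c)) (s * (C + L.length + 2) + 1) (ν.content c'.stk []) := by
  induction s with
  | zero =>
    intro c c' h hc' _
    have e : c = c' := by simpa [Steps] using h
    subst e
    have : ν.ctlList c = [] := by rw [ctlList, hc']; rfl
    rw [this]
    exact (Run.loopDone (by rw [content_one]; rfl)).weaken (by simp)
  | succ s ih =>
    intro c c' h hc' hg
    obtain ⟨l, v, S⟩ := c
    have h' : (flip bind (TM2.step m))^[s] (TM2.step m ⟨l, v, S⟩) = some c' := h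
    cases l with
    | none =>
      have : ∀ s, (flip bind (TM2.step m))^[s] (none : Option (TM2.Cfg Γ Λ σ)) = none := by
        intro s
        induction s with
        | zero => rfl
        | succ s ih => rw [Function.iterate_succ_apply]; exact ih
      rw [TM2.step, this] at h'
      simp at h'
    | some l =>
      obtain ⟨h1, h2⟩ := hC l v S hg
      have h3 := ih (TM2.stepAux (m l) v S) c' h' hc' h2
      have e : ν.content S (ν.ctlList ⟨some l, v, S⟩) 1 = ν.ctl (l, v) :: [] := content_one _ _ _
      have h4 := Prog.popCase_run (k := 1) (cls := ν.unctl) (L := L)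
        (f := fun x => ν.prog vs (m x.1) x.2) e (hL _) (by
          rw [update_content_one, ν.unctl_ctl]
          exact h1)
      refine (Run.loopStep (by rw [e]; rfl) h4 h3).weaken ?_
      rw [Nat.succ_mul]
      omega

end Numbering

end Simulate

/-- Only a finite set of symbols can ever occur: those pushed by some statement and those of the
input and output alphabets. A numbering injective on this set is enough. The stacks are numbered
from `2`, as `0` carries input and output and `1` the control state. -/
theorem exists_numbering (M : FinTM2) (hk₁ : Finite (M.Γ M.k₁)) :
    ∃ ν : Numbering M.Γ M.Λ M.σ, (∀ l, ∀ x ∈ pushedSymbols (M.m l), ν.Good x.2) ∧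
      (∀ g : M.Γ M.k₀, ν.Good g) ∧ (∀ g : M.Γ M.k₁, ν.Good g) := by
  classical
  have := M.kFin
  have := M.ΛFin
  have := M.σFin
  have := M.Γk₀Fin
  let A : Set (Σ k, M.Γ k) := (⋃ l, pushedSymbols (M.m l)) ∪
    (Set.range (fun g : M.Γ M.k₀ => (⟨M.k₀, g⟩ : Σ k, M.Γ k)) ∪
      Set.range (fun g : M.Γ M.k₁ => (⟨M.k₁, g⟩ : Σ k, M.Γ k)))
  have hA : A.Finite := (Set.finite_iUnion fun l => finite_pushedSymbols _).union
    ((Set.finite_range _).union (Set.finite_range _))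
  obtain ⟨e, he⟩ := Set.countable_iff_exists_injOn.1 hA.countable
  let e' : M.Λ × M.σ → ℕ := fun x => (Fintype.equivFin _ x).val
  have : Nonempty (M.Λ × M.σ) := ⟨(M.main, M.initialState)⟩
  let ν : Numbering M.Γ M.Λ M.σ :=
    { stack := fun k => (Fintype.equivFin M.K k).val + 2
      stack_inj := fun a b h => (Fintype.equivFin M.K).injective (Fin.ext (by simpa using h))
      two_le := fun k => by simp
      sym := fun k g => e ⟨k, g⟩
      unsym := fun k n => if h : ∃ g : M.Γ k, (⟨k, g⟩ : Σ k, M.Γ k) ∈ A ∧ e ⟨k, g⟩ = n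
        then some h.choose else none
      ctl := e'
      unctl := Function.invFun e'
      unctl_ctl := Function.leftInverse_invFun
        (fun a b hab => (Fintype.equivFin _).injective (Fin.ext hab)) }
  have key : ∀ x ∈ A, ν.Good x.2 := by
    rintro ⟨k, g⟩ hx
    have h : ∃ g' : M.Γ k, (⟨k, g'⟩ : Σ k, M.Γ k) ∈ A ∧ e ⟨k, g'⟩ = e ⟨k, g⟩ := ⟨g, hx, rfl⟩
    have h1 : ν.unsym k (ν.sym k g) = some h.choose := dif_pos h
    have h2 := he h.choose_spec.1 hx h.choose_spec.2
    rw [Numbering.Good, h1]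
    simpa using h2
  exact ⟨ν, fun l x hx => key x (Or.inl (Set.mem_iUnion.2 ⟨l, hx⟩)),
    fun g => key ⟨M.k₀, g⟩ (Or.inr (Or.inl ⟨g, rfl⟩)),
    fun g => key ⟨M.k₁, g⟩ (Or.inr (Or.inr ⟨g, rfl⟩))⟩

theorem Numbering.content_nil {K : Type} {Γ : K → Type} {Λ σ : Type} (ν : Numbering Γ Λ σ) :
    ν.content (fun _ => []) [] = fun _ => [] := by
  funext j
  simp only [Numbering.content, List.map_nil]
  split_ifs <;> rfl

/-- The input is moved via stack `1` to the stack that simulates `k₀`, the machine is simulated step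
by step, and the contents of the stack for `k₁` are translated back to stack `0`. Two moves on
either side cancel the reversals. -/
theorem FP.of_isPolyTime {α β A B : Type} [Fintype A] [Finite B] [Coded α] [Coded β]
    {ea : α → List A} {eb : β → List B} {f : α → β} (sa : A → ℕ) (sb : B → ℕ)
    (hsa : Function.Injective sa) (ha : ∀ a, code a = (ea a).map sa)
    (hb : ∀ b, code b = (eb b).map sb) (h : IsPolyTime ea eb f) : FP f := by
  classical
  obtain ⟨⟨⟨M, eA, eB⟩, T, hM⟩⟩ := h
  dsimp only at eA eB hM
  have := M.ΛFin
  have := M.σFin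
  have hk₁ : Finite (M.Γ M.k₁) := Finite.of_equiv B eB.symm
  have := Fintype.ofFinite (M.Γ M.k₁)
  obtain ⟨ν, hν, hν₀, hν₁⟩ := exists_numbering M hk₁
  let vs : List M.σ := Finset.univ.toList
  have hvs : ∀ v, v ∈ vs := fun v => by simp [vs]
  let L : List (M.Λ × M.σ) := Finset.univ.toList
  have hL : ∀ v, v ∈ L := fun v => by simp [L]
  choose C hC using fun l => ν.prog_run vs hvs (M.m l) (hν l)
  let C' := Finset.univ.sup C
  have hCC : ∀ l, C l ≤ C' := fun l => Finset.le_sup (Finset.mem_univ l)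
  let N := Coded.bound α
  obtain ⟨N', hN'⟩ : ∃ N', ∀ g : M.Γ M.k₁, ν.sym M.k₁ g < N' :=
    ⟨(Finset.univ.sup fun g => ν.sym M.k₁ g) + 1, fun g => Nat.lt_succ_of_le
      (Finset.le_sup (f := fun g => ν.sym M.k₁ g) (Finset.mem_univ g))⟩
  -- Translation of input symbols; numbers that code no symbol are dropped, but they do not occur.
  let fin : ℕ → List ℕ := fun s =>
    if h : ∃ a, sa a = s then [ν.sym M.k₀ (eA.symm h.choose)] else []
  have hfin : ∀ a, fin (sa a) = [ν.sym M.k₀ (eA.symm a)] := fun a => by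
    have h : ∃ a', sa a' = sa a := ⟨a, rfl⟩
    have e : fin (sa a) = [ν.sym M.k₀ (eA.symm h.choose)] := dif_pos h
    rw [e, hsa h.choose_spec]
  have hfin' : ∀ s, (fin s).length ≤ 1 := fun s => by
    simp only [fin]; split_ifs <;> simp
  let fout : ℕ → List ℕ := fun s => (ν.unsym M.k₁ s).elim [] fun g => [sb (eB g)]
  have hfout : ∀ g : M.Γ M.k₁, fout (ν.sym M.k₁ g) = [sb (eB g)] := fun g => by
    have : ν.unsym M.k₁ (ν.sym M.k₁ g) = some g := hν₁ g
    simp [fout, this]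
  have hfout' : ∀ s, (fout s).length ≤ 1 := fun s => by
    simp only [fout]; cases ν.unsym M.k₁ s <;> simp
  have h2 := ν.two_le
  let R : Polynomial ℕ := Polynomial.X * Polynomial.C (1 + N + 3) + 1
  let U : Polynomial ℕ := T * Polynomial.C (C' + L.length + 2) + 1
  refine ⟨(Prog.move 0 N 1 (fun s => [s])).seq ((Prog.move 1 N (ν.stack M.k₀) fin).seq
    ((Prog.push 1 (ν.ctl (M.main, M.initialState))).seq ((Prog.loop 1 Option.isSome
        (Prog.popCase 1 ν.unctl L fun x => ν.prog vs (M.m x.1) x.2)).seq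
      ((Prog.move (ν.stack M.k₁) N' 1 (fun s => [s])).seq (Prog.move 1 N' 0 fout))))),
R + R + 1 + U + 2 * ((R + 1 + U) * Polynomial.C (1 + N' + 3) + 1), fun a => ?_⟩
  obtain ⟨⟨s, hs⟩, hsT⟩ := hM a
  dsimp only at hsT
  set inp := (ea a).map eA.invFun with hinp
  set outp := (eb (f a)).map eB.invFun with houtp
  have r1 := Run.congr (S'' := Function.update (fun _ => []) 1 (code a).reverse)
    (Prog.move_run (k := 0) (N := N) (d := 1) (c := 1) (g := fun a => [a]) (by omega) (by simp)
      (code a) (code_lt a) (st0 (code a)) (by simp [st0])) (by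
    funext j
    by_cases j1 : j = 1
    · subst j1; simp [st0]
    · by_cases j0 : j = 0
      · subst j0; simp
      · simp [st0, j1])
  have einp : (code a).flatMap fin = inp.map (ν.sym M.k₀) := by
    rw [ha, hinp]
    clear hs hsT hinp inp r1
    induction ea a with
    | nil => rfl
    | cons x l ih => rw [List.map_cons, List.flatMap_cons, ih, hfin]; rfl
  have e0 := ν.content_nil
  have r2 := Run.congr (S'' := ν.content (initList M inp).stk [])
    (Prog.move_run (k := 1) (N := N) (d := ν.stack M.k₀) (c := 1) (g := fin)
      (by have := h2 M.k₀; omega) (fun s _ => hfin' s) (code a).reverse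
      (by simpa using code_lt a) (Function.update (fun _ => []) 1 (code a).reverse) (by simp)) (by
    have e1 : (initList M inp).stk = Function.update (fun _ => []) M.k₀ inp := by
      funext k
      by_cases hk : k = M.k₀
      · subst hk; simp [initList]
      · simp [initList, hk]
    have e2 : ((code a).reverse.flatMap fin).reverse = inp.map (ν.sym M.k₀) := by
      rw [← einp, List.reverse_flatMap, List.reverse_reverse]
      congr 1
      funext s
      have := hfin' s
      simp only [Function.comp]
      match fin s, this with
      | [], _ => rfl
      | [x], _ => rfl
    rw [e1, ← ν.update_content, e0, e2]
    have := h2 M.k₀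
    have e3 : ν.stack M.k₀ ≠ 1 := by omega
    congr 1
    · funext j; simp
    · simp [e3])
  have r3 := Run.congr (S'' := ν.content (initList M inp).stk (ν.ctlList (initList M inp)))
    (Run.push 1 (ν.ctl (M.main, M.initialState)) (ν.content (initList M inp).stk [])) (by
    rw [ν.update_content_one, ν.content_one]; rfl)
  have r4 := ν.loop_run vs L hL M.m C' (fun l v S hS =>
    ⟨((hC l v S hS).1).weaken (hCC l), (hC l v S hS).2⟩) s (initList M inp) (haltList M outp)
    hs rfl (by
      intro k g hg
      by_cases hk : k = M.k₀
      · subst hk; exact hν₀ g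
      · simp [initList, hk] at hg)
  have e5 : ν.content (haltList M outp).stk [] =
      Function.update (fun _ => []) (ν.stack M.k₁) (outp.map (ν.sym M.k₁)) := by
    have e1 : (haltList M outp).stk = Function.update (fun _ => []) M.k₁ outp := by
      funext k
      by_cases hk : k = M.k₁
      · subst hk; simp [haltList]
      · simp [haltList, hk]
    rw [e1, ← ν.update_content, e0]
  rw [e5] at r4
  have r5 := Run.congr (S'' := Function.update (fun _ => []) 1 (outp.map (ν.sym M.k₁)).reverse)
    (Prog.move_run (k := ν.stack M.k₁) (N := N') (d := 1) (c := 1) (g := fun a => [a])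
      (by have := h2 M.k₁; omega) (by simp) (outp.map (ν.sym M.k₁))
      (by
        intro x hx
        obtain ⟨g, _, rfl⟩ := List.mem_map.1 hx
        exact hN' g) (Function.update (fun _ => []) (ν.stack M.k₁) (outp.map (ν.sym M.k₁)))
      (by simp)) (by
    have := h2 M.k₁
    funext j
    by_cases j1 : j = 1
    · subst j1; simp [show (1 : ℕ) ≠ ν.stack M.k₁ by omega]
    · simp [j1])
  have r6 := Run.congr (S'' := st0 (code (f a)))
    (Prog.move_run (k := 1) (N := N') (d := 0) (c := 1) (g := fout) (by omega)
      (fun s _ => hfout' s) (outp.map (ν.sym M.k₁)).reverse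
      (by
        intro x hx
        obtain ⟨g, _, rfl⟩ := List.mem_map.1 (List.mem_reverse.1 hx)
        exact hN' g) (Function.update (fun _ => []) 1 (outp.map (ν.sym M.k₁)).reverse)
      (by simp)) (by
    have e2 : ((outp.map (ν.sym M.k₁)).reverse.flatMap fout).reverse = code (f a) := by
      rw [← List.map_reverse, List.flatMap_map, hb, houtp]
      simp only [hfout]
      rw [← List.map_eq_flatMap, ← List.map_reverse, List.reverse_reverse, List.map_map]
      refine List.map_congr_left fun x _ => ?_
      simp
    rw [e2]
    funext j
    by_cases j0 : j = 0
    · subst j0; simp [st0]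
    · by_cases j1 : j = 1
      · subst j1; simp [st0]
      · simp [st0, j0])
  refine (r1.seq (r2.seq (r3.seq (r4.seq (r5.seq r6))))).weaken ?_
  have hstk : ν.stack M.k₁ ≠ 1 := by have := h2 M.k₁; omega
  -- The length of the output is bounded by the time spent before, so the final moves are polynomial
  -- as well.
  have l2 := r2.length_le (ν.stack M.k₁)
  have l3 := r3.length_le (ν.stack M.k₁)
  have l4 := r4.length_le (ν.stack M.k₁)
  simp only [Function.update_self, Function.update_of_ne hstk, List.length_reverse,
    List.length_map, List.length_nil] at l2 l3 l4
  have hn : (code a).length = (ea a).length := by rw [ha, List.length_map]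
  have hRU : (R + R + 1 + U + 2 * ((R + 1 + U) * Polynomial.C (1 + N' + 3) + 1)).eval
      (code a).length = R.eval (code a).length + R.eval (code a).length + 1 +
        U.eval (code a).length + 2 * ((R.eval (code a).length + 1 + U.eval (code a).length) *
          (1 + N' + 3) + 1) := by
    simp
  have hR : R.eval (code a).length = (code a).length * (1 + N + 3) + 1 := by simp [R]
  have hU : s * (C' + L.length + 2) + 1 ≤ U.eval (code a).length := by
    have := Nat.mul_le_mul_right (C' + L.length + 2) hsT
    simpa [U, hn] using this
  have ho : outp.length * (1 + N' + 3) ≤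
      (R.eval (code a).length + 1 + U.eval (code a).length) * (1 + N' + 3) :=
    Nat.mul_le_mul_right _ (by omega)
  rw [hRU]
  simp only [List.length_reverse, List.length_map]
  omega

/-! ### Basic polynomial-time functions -/

section Symbols

variable {A : Type} [Fintype A]

/-- The number of an element of a finite alphabet. -/
noncomputable def sym (a : A) : ℕ := (Fintype.equivFin A a).val

theorem sym_injective : Function.Injective (sym : A → ℕ) :=
  fun _ _ h => (Fintype.equivFin A).injective (Fin.ext h)

theorem sym_lt (a : A) : sym a < Fintype.card A := (Fintype.equivFin A a).isLt

/-- The element of a finite alphabet with a given number. -/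
noncomputable def unsym (n : ℕ) : Option A :=
  if h : n < Fintype.card A then some ((Fintype.equivFin A).symm ⟨n, h⟩) else none

@[simp]
theorem unsym_sym (a : A) : unsym (sym a) = some a := by
  rw [unsym, dif_pos (sym_lt a)]
  simp [sym]

noncomputable instance Coded.list : Coded (List A) where
  code l := l.map sym
  bound := Fintype.card A
  code_lt := by
    intro l s hs
    obtain ⟨a, _, rfl⟩ := List.mem_map.1 hs
    exact sym_lt a

theorem code_list (l : List A) : code l = l.map sym := rfl

@[simp]
theorem length_code_list (l : List A) : (code l).length = l.length := by simp [code_list]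

variable (A) in
/-- A finite type, its elements being coded by single symbols. -/
@[ext]
structure Sym where
  val : A

noncomputable instance Coded.sym : Coded (Sym A) where
  code a := [WeightedCounting.sym a.val]
  bound := Fintype.card A
  code_lt := by
    intro a s hs
    rw [List.mem_singleton.1 hs]
    exact sym_lt a.val

theorem code_sym (a : Sym A) : code a = [sym a.val] := rfl

@[simp]
theorem length_code_sym (a : Sym A) : (code a).length = 1 := rfl

end Symbols

theorem transduce_unit (g : ℕ → List ℕ) (l : List ℕ) :
    transduce (fun _ _ => ()) (fun _ => g) (fun _ => []) () l = l.flatMap g := by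
  induction l with
  | nil => rfl
  | cons a l ih => rw [transduce, ih, List.flatMap_cons]

namespace FP

section

variable {α β γ δ ε : Type} [Coded α] [Coded β] [Coded γ] [Coded δ] [Coded ε]
variable {A B C D : Type} [Fintype A] [Fintype B] [Fintype C] [Fintype D]

theorem of_flatMap {f : α → β} (g : ℕ → List ℕ) (h : ∀ a, (code a).flatMap g = code (f a)) :
    FP f :=
  of_transduce (Q := Unit) (fun _ _ => ()) (fun _ => g) (fun _ => []) () fun a => by
    rw [transduce_unit, h]

theorem fst : FP (fun x : α × β => x.1) :=
  of_flatMap _ fun x => flatMap_left_code (code x.1) (code x.2)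

theorem snd : FP (fun x : α × β => x.2) :=
  of_flatMap _ fun x => flatMap_right_code (code x.1) (code x.2)

theorem const (b : β) : FP (fun _ : α => b) :=
  of_transduce (Q := Unit) (fun _ _ => ()) (fun _ _ => []) (fun _ => code b) () fun a => by
    induction code a with
    | nil => rfl
    | cons a l ih => rw [transduce, ih, List.nil_append]

/-- A symbol of a finite alphabet can be remembered in the state of a transducer, so `g` is a finite
table and needs no computability assumption. -/
theorem apply₁' (g : A → β) : FP (fun a : Sym A => g a.val) :=
  of_transduce (Q := Option A) (fun _ s => unsym s) (fun _ _ => [])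
    (fun o => o.elim [] fun a => code (g a)) none fun a => by
    simp only [code_sym, transduce, List.nil_append, unsym_sym]
    rfl

theorem apply₂' (g : A → B → β) : FP (fun x : Sym A × Sym B => g x.1.val x.2.val) :=
  of_transduce (Q := Option A × Option B)
    (fun q s => if s % 2 = 0 then (unsym (s / 2), q.2) else (q.1, unsym (s / 2)))
    (fun _ _ => []) (fun q => q.1.elim [] fun a => q.2.elim [] fun b => code (g a b))
    (none, none) fun x => by
    have h1 : ∀ s : ℕ, (2 * s + 1) % 2 = 1 := fun s => by omega
    have h2 : ∀ s : ℕ, (2 * s + 1) / 2 = s := fun s => by omega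
    simp only [code_prod, code_sym, transduce, List.map_cons, List.map_nil, List.cons_append,
      List.nil_append, Nat.mul_mod_right, if_true, h1, h2, one_ne_zero, if_false,
      Nat.mul_div_right _ (Nat.zero_lt_two), unsym_sym]
    rfl

theorem apply₁ (g : A → β) {f : α → A} (hf : FP fun x => Sym.mk (f x)) :
    FP (fun x => g (f x)) :=
  (apply₁' g).comp hf

theorem apply₂ (g : A → B → β) {f₁ : α → A} {f₂ : α → B} (h₁ : FP fun x => Sym.mk (f₁ x))
    (h₂ : FP fun x => Sym.mk (f₂ x)) : FP (fun x => g (f₁ x) (f₂ x)) :=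
  (apply₂' g).comp (h₁.pair h₂)

theorem symPair {f₁ : α → A} {f₂ : α → B} (h₁ : FP fun x => Sym.mk (f₁ x))
    (h₂ : FP fun x => Sym.mk (f₂ x)) : FP (fun x => Sym.mk (f₁ x, f₂ x)) :=
  apply₂ (fun a b => Sym.mk (a, b)) h₁ h₂

theorem apply₃ (g : A → B → C → β) {f₁ : α → A} {f₂ : α → B} {f₃ : α → C}
    (h₁ : FP fun x => Sym.mk (f₁ x)) (h₂ : FP fun x => Sym.mk (f₂ x))
    (h₃ : FP fun x => Sym.mk (f₃ x)) : FP (fun x => g (f₁ x) (f₂ x) (f₃ x)) :=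
  apply₂ (fun (a : A × B) c => g a.1 a.2 c) (symPair h₁ h₂) h₃

theorem cons' : FP (fun x : Sym A × List A => x.1.val :: x.2) :=
  of_flatMap (fun s => [s / 2]) fun x => by
    have h2 : ∀ s : ℕ, (2 * s + 1) / 2 = s := fun s => by omega
    rw [← List.map_eq_flatMap]
    simp [code_prod, code_sym, code_list, Function.comp_def, h2]

theorem cons {f : α → A} {g : α → List A} (hf : FP fun x => Sym.mk (f x)) (hg : FP g) :
    FP (fun x => f x :: g x) :=
  cons'.comp (hf.pair hg)

theorem append' : FP (fun x : List A × List A => x.1 ++ x.2) :=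
  of_flatMap (fun s => [s / 2]) fun x => by
    have h2 : ∀ s : ℕ, (2 * s + 1) / 2 = s := fun s => by omega
    rw [← List.map_eq_flatMap]
    simp [code_prod, code_list, Function.comp_def, h2]

theorem append {f : α → List A} {g : α → List A} (hf : FP f) (hg : FP g) :
    FP (fun x => f x ++ g x) :=
  append'.comp (hf.pair hg)

theorem map' (g : A → B) : FP (fun l : List A => l.map g) :=
  of_flatMap (fun s => (unsym s).elim [] fun a => [sym (g a)]) fun l => by
    rw [code_list, code_list, List.flatMap_map]
    simp only [unsym_sym, Option.elim_some]
    rw [← List.map_eq_flatMap, List.map_map]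
    rfl

theorem map (g : A → B) {f : α → List A} (hf : FP f) : FP (fun x => (f x).map g) :=
  (map' g).comp hf

theorem headTail : FP (fun l : List A => (Sym.mk l.head?, l.tail)) :=
  of_transduce (Q := Bool) (fun _ _ => true)
    (fun q s => if q then [2 * s + 1] else [2 * sym (unsym s : Option A)])
    (fun q => if q then [] else [2 * sym (none : Option A)]) false fun l => by
    have key : ∀ l : List ℕ, transduce (fun _ _ => true)
        (fun q s => if q then [2 * s + 1] else [2 * sym (unsym s : Option A)])
        (fun q => if q then [] else [2 * sym (none : Option A)]) true l =
          l.map (fun s => 2 * s + 1) := by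
      intro l
      induction l with
      | nil => rfl
      | cons a l ih => rw [transduce, ih]; rfl
    cases l with
    | nil => rfl
    | cons a l =>
      rw [code_list, List.map_cons, transduce, key, unsym_sym]
      rfl

theorem head {f : α → List A} (hf : FP f) : FP (fun x => Sym.mk (f x).head?) :=
  (fst.comp headTail).comp hf

theorem tail {f : α → List A} (hf : FP f) : FP (fun x => (f x).tail) :=
  (snd.comp headTail).comp hf

/-- The flag comes first in the code, so a transducer knows it before it meets the two candidates,
and then lets through the symbols of one parity. -/
theorem select : FP (fun x : Sym Bool × (β × β) => bif x.1.val then x.2.1 else x.2.2) :=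
  of_transduce (Q := Bool)
    (fun q s => if s % 2 = 0 then decide (unsym (s / 2) = some true) else q)
    (fun q s => if s % 2 = 0 then [] else
      if s / 2 % 2 = 0 then (bif q then [s / 2 / 2] else []) else
        (bif q then [] else [s / 2 / 2])) (fun _ => []) false fun x => by
    have h1 : ∀ s : ℕ, (2 * s + 1) % 2 = 1 := fun s => by omega
    have h2 : ∀ s : ℕ, (2 * s + 1) / 2 = s := fun s => by omega
    have key : ∀ (q : Bool) (l : List ℕ), transduce
        (fun q s => if s % 2 = 0 then decide (unsym (s / 2) = some true) else q)
        (fun q s => if s % 2 = 0 then [] else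
          if s / 2 % 2 = 0 then (bif q then [s / 2 / 2] else []) else
          (bif q then [] else [s / 2 / 2])) (fun _ => []) q (l.map fun s => 2 * s + 1) =
        l.flatMap (fun s => if s % 2 = 0 then (bif q then [s / 2] else [])
          else (bif q then [] else [s / 2])) := by
      intro q l
      induction l with
      | nil => rfl
      | cons a l ih =>
        rw [List.map_cons, transduce, List.flatMap_cons]
        simp only [h1, h2, one_ne_zero, if_false]
        rw [ih]
    obtain ⟨⟨b⟩, y, z⟩ := x
    rw [code_prod, code_sym, List.map_singleton, List.singleton_append, transduce]
    simp only [Nat.mul_mod_right, if_true, List.nil_append,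
      Nat.mul_div_right _ (Nat.zero_lt_two), unsym_sym]
    rw [key, code_prod]
    cases b with
    | true => exact flatMap_left_code (code y) (code z)
    | false => exact flatMap_right_code (code y) (code z)

theorem cond {c : α → Bool} {f g : α → β} (hc : FP fun x => Sym.mk (c x)) (hf : FP f)
    (hg : FP g) : FP (fun x => bif c x then f x else g x) :=
  select.comp (hc.pair (hf.pair hg))

theorem cases {c : α → A} {f : A → α → β} (hc : FP fun x => Sym.mk (c x)) (hf : ∀ a, FP (f a)) :
    FP (fun x => f (c x) x) := by
  classical
  rcases isEmpty_or_nonempty α with hα | ⟨⟨x₀⟩⟩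
  · exact ⟨Prog.skip, 0, fun a => (IsEmpty.false a).elim⟩
  -- A chain of two-way choices over a list of values; what happens for values outside the list is
  -- irrelevant, and in the end the list contains all values.
  have key : ∀ l : List A, ∃ g : α → β, FP g ∧ ∀ x, c x ∈ l → g x = f (c x) x := by
    intro l
    induction l with
    | nil => exact ⟨f (c x₀), hf _, fun x hx => absurd hx List.not_mem_nil⟩
    | cons a l ih =>
      obtain ⟨g, hg, h⟩ := ih
      refine ⟨_, cond (apply₁ (fun b : A => Sym.mk (decide (b = a))) hc) (hf a) hg,
        fun x hx => ?_⟩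
      by_cases hxa : c x = a
      · rw [decide_eq_true hxa, hxa]; rfl
      · rw [decide_eq_false hxa]
        exact h x ((List.mem_cons.1 hx).resolve_left hxa)
  obtain ⟨g, hg, h⟩ := key Finset.univ.toList
  have : (fun x => f (c x) x) = g := funext fun x => (h x (by simp)).symm
  rw [this]
  exact hg

theorem iter {σ : Type} [Coded σ] {step : σ → σ} (hstep : FP step) (C : ℕ)
    (h : ∀ s, (code (step s)).length ≤ (code s).length + C) {n : α → List Unit} {s : α → σ}
    (hn : FP n) (hs : FP s) : FP (fun x => step^[(n x).length] (s x)) := by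
  have := (iterate_of_le (α := List Unit) hstep C h).comp (hn.pair hs)
  simpa using this

/-- Repeated addition: each round appends as many units as the second list is long. The growth per
round is not constant, so the general form of iteration is used, with a quadratic bound. -/
theorem mulUnits : FP (fun x : List Unit × List A => List.replicate (x.1.length * x.2.length) ())
    := by
  let step : List Unit × List A → List Unit × List A :=
    fun s => (s.2.map (fun _ => ()) ++ s.1, s.2)
  have hstep : FP step := (append (map _ snd) fst).pair snd
  have hi : ∀ (i : ℕ) (s : List Unit × List A),
      step^[i] s = (List.replicate (i * s.2.length) () ++ s.1, s.2) := by
    intro i s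
    induction i with
    | zero => simp
    | succ i ih =>
      rw [Function.iterate_succ_apply', ih]
      simp only [step, List.map_const', Nat.succ_mul, Nat.add_comm (i * _), List.replicate_add,
        List.append_assoc]
  have h1 : FP (fun x : List Unit × (List Unit × List A) => step^[(code x.1).length] x.2) := by
    refine iterate hstep (Polynomial.X + Polynomial.X * Polynomial.X) fun c s i hic => ?_
    rw [hi]
    simp only [length_code_prod, length_code_list, List.length_append, List.length_replicate,
      Polynomial.eval_add, Polynomial.eval_mul, Polynomial.eval_X] at hic ⊢
    have : i * s.2.length ≤ (c.length + (s.1.length + s.2.length)) *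
        (c.length + (s.1.length + s.2.length)) := Nat.mul_le_mul (by omega) (by omega)
    omega
  have h2 := fst.comp (h1.comp (fst.pair ((const ([] : List Unit)).pair snd)))
  refine (funext fun x => ?_ : (fun x : List Unit × List A =>
    List.replicate (x.1.length * x.2.length) ()) = _) ▸ h2
  rw [hi]
  simp

/-- Polynomial lengths, in unary, serve as counters for all later iterations. -/
theorem polyUnits (p : Polynomial ℕ) :
    FP (fun l : List A => List.replicate (p.eval l.length) ()) := by
  induction p using Polynomial.induction_on with
  | C a => simpa using const (α := List A) (List.replicate a ())
  | add p q hp hq => simpa only [Polynomial.eval_add, List.replicate_add] using append hp hq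
  | monomial n a ih =>
    have := mulUnits.comp (ih.pair (FP.id (α := List A)))
    simpa only [List.length_replicate, Polynomial.eval_mul, Polynomial.eval_C, Polynomial.eval_pow,
      Polynomial.eval_X, pow_succ, ← mul_assoc] using this

end

end FP

/-! ### Comparison of the two notions of polynomial-time functions -/

/-- The program reversing the list on stack `0`. -/
def Prog.reverse (N : ℕ) : Prog :=
  (Prog.move 0 N 1 (fun a => [a])).seq
    ((Prog.move 1 N 2 (fun a => [a])).seq (Prog.move 2 N 0 (fun a => [a])))

theorem Prog.reverse_run {N : ℕ} (l : List ℕ) (hl : ∀ a ∈ l, a < N) :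
    Run (Prog.reverse N) (st0 l) (3 * (l.length * (1 + N + 3) + 1)) (st0 l.reverse) := by
  have r1 := Run.congr (S'' := st3 [] l.reverse []) (Prog.move_run (k := 0) (N := N) (d := 1)
    (c := 1) (g := fun a => [a]) (by omega) (by simp) l hl (st0 l) (by simp [st0])) (by
    funext j
    by_cases j1 : j = 1
    · subst j1; simp [st0, st3]
    · by_cases j0 : j = 0
      · subst j0; simp [st3]
      · simp [st0, st3, j0, j1])
  have r2 := Run.congr (S'' := st3 [] [] l) (Prog.move_run (k := 1) (N := N) (d := 2)
    (c := 1) (g := fun a => [a]) (by omega) (by simp) l.reverse (by simpa using hl)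
    (st3 [] l.reverse []) (by simp [st3])) (by
    funext j
    by_cases j1 : j = 2
    · subst j1; simp [st3]
    · by_cases j0 : j = 1
      · subst j0; simp [st3]
      · simp [st3, j0, j1])
  have r3 := Run.congr (S'' := st0 l.reverse) (Prog.move_run (k := 2) (N := N) (d := 0)
    (c := 1) (g := fun a => [a]) (by omega) (by simp) l hl
    (st3 [] [] l) (by simp [st3])) (by
    funext j
    by_cases j1 : j = 0
    · subst j1; simp [st0, st3]
    · by_cases j0 : j = 2
      · subst j0; simp [st0]
      · simp [st0, st3, j0, j1])
  refine (r1.seq (r2.seq r3)).weaken ?_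
  rw [List.length_reverse]
  omega

/-- The reversals before and after the program compensate for those caused by reading and writing in
`IsPolyTime.of_run`. -/
theorem IsPolyTime.of_FP {α β A B : Type} [Fintype A] [Fintype B] [Inhabited B] [Coded α]
    [Coded β] {ea : α → List A} {eb : β → List B} {f : α → β} (sa : A → ℕ) (sb : B → ℕ)
    (hsb : Function.Injective sb) (ha : ∀ a, code a = (ea a).map sa)
    (hb : ∀ b, code b = (eb b).map sb) (h : FP f) : IsPolyTime ea eb f := by
  obtain ⟨p, T, hp⟩ := h
  refine IsPolyTime.of_run sa (Function.invFun sb)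
    ((Prog.reverse (Coded.bound α)).seq (p.seq (Prog.reverse (Coded.bound β))))
    (3 * (Polynomial.X * Polynomial.C (1 + Coded.bound α + 3) + 1) + T +
      3 * ((Polynomial.X + T) * Polynomial.C (1 + Coded.bound β + 3) + 1)) fun a => ?_
  refine ⟨(code (f a)).reverse, ?_, ?_⟩
  · have r1 := Prog.reverse_run (N := Coded.bound α) (code a).reverse
      (by simpa using code_lt a)
    rw [List.reverse_reverse] at r1
    rw [← ha]
    refine (r1.seq ((hp a).seq (Prog.reverse_run _ (code_lt (f a))))).weaken ?_
    have hlen := (hp a).length_le 0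
    simp only [st0, Function.update_self] at hlen
    have hn : (ea a).length = (code a).length := by rw [ha, List.length_map]
    simp only [Polynomial.eval_add, Polynomial.eval_mul, Polynomial.eval_C, Polynomial.eval_X,
      Polynomial.eval_ofNat, Polynomial.eval_one, List.length_reverse, hn]
    have := Nat.mul_le_mul_right (1 + Coded.bound β + 3) hlen
    omega
  · rw [hb, List.map_reverse, List.reverse_reverse, List.map_map]
    have : Function.invFun sb ∘ sb = id := funext (Function.leftInverse_invFun hsb)
    rw [this, List.map_id]

noncomputable instance Coded.unaryNat : Coded ℕ where
  code n := code (unaryEncodeNat n)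
  bound := Coded.bound (List Bool)
  code_lt n := code_lt (unaryEncodeNat n)

noncomputable instance Coded.binaryInt : Coded ℤ where
  code n := code (encodeInt n)
  bound := Coded.bound (List Bool)
  code_lt n := code_lt (encodeInt n)

theorem unaryEncodeNat_eq (n : ℕ) : unaryEncodeNat n = List.replicate n true := by
  induction n with
  | zero => rfl
  | succ n ih => rw [unaryEncodeNat, ih]; rfl

theorem FP.ofUnary : FP (fun n : ℕ => List.replicate n ()) := by
  have h : FP (fun n : ℕ => unaryEncodeNat n) :=
    FP.of_code_eq (f := fun n : ℕ => n) FP.id fun _ => rfl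
  simpa [unaryEncodeNat_eq] using FP.map (fun _ : Bool => ()) h

theorem FP.toUnary : FP (fun l : List Unit => l.length) :=
  (FP.map' (fun _ : Unit => true)).of_code_eq fun l => by
    change code (unaryEncodeNat l.length) = _
    rw [unaryEncodeNat_eq, List.map_const']

theorem sumElim_injective {A B : Type} {s : A → ℕ} {t : B → ℕ} (hs : Function.Injective s)
    (ht : Function.Injective t) :
    Function.Injective (Sum.elim (fun a => 2 * s a) (fun b => 2 * t b + 1)) := by
  rintro (a | a) (b | b) h <;> simp only [Sum.elim_inl, Sum.elim_inr] at h
  · rw [hs (by omega : s a = s b)]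
  · omega
  · omega
  · rw [ht (by omega : t a = t b)]

theorem isPolyTimePred_iff {T : Str → Str → Bool} :
    IsPolyTimePred T ↔ FP (fun a : Str × Str => Sym.mk (T a.1 a.2)) := by
  let s : Bool ⊕ Bool → ℕ := Sum.elim (fun a => 2 * sym a) (fun b => 2 * sym b + 1)
  have hs : Function.Injective s := sumElim_injective sym_injective sym_injective
  have ha : ∀ a : Str × Str, code a = (encodePair a).map s := fun a => by
    simp [code_prod, code_list, encodePair, encodingProd, encodingList, s, Function.comp_def]
  constructor
  · rintro ⟨h⟩
    exact FP.of_isPolyTime s sym hs ha (fun b => rfl) (eb := fun b : Sym Bool => encodeBool b.val)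
      -- The same machine, with results regarded as elements of `Sym Bool` instead of `Bool`; their
      -- encodings agree.
      ⟨⟨h.toTM2ComputableAux, h.time, h.outputsFun⟩⟩
  · intro h
    obtain ⟨h'⟩ := IsPolyTime.of_FP s sym sym_injective ha
      (eb := fun b : Sym Bool => encodeBool b.val) (fun b => rfl) h
    exact ⟨⟨h'.toTM2ComputableAux, h'.time, h'.outputsFun⟩⟩

theorem isPolyTime_triple_iff {f : (Str × Str) × ℕ → ℤ} :
    IsPolyTime encodeTriple encodeInt f ↔
      FP (fun a : (Str × Str) × List Unit => encodeInt (f (a.1, a.2.length))) := by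
  let s : (Bool ⊕ Bool) ⊕ Bool → ℕ := Sum.elim
    (fun a => 2 * Sum.elim (fun a => 2 * sym a) (fun b => 2 * sym b + 1) a)
    (fun b => 2 * sym b + 1)
  have hs : Function.Injective s :=
    sumElim_injective (sumElim_injective sym_injective sym_injective) sym_injective
  have ha : ∀ a : (Str × Str) × ℕ, code a = (encodeTriple a).map s := fun a => by
    have : code a.2 = (unaryEncodeNat a.2).map sym := rfl
    simp [code_prod, this, code_list, encodeTriple, encodingProd, encodingList, unaryEncodingNat,
      s, Function.comp_def]
  have hb : ∀ b : ℤ, code b = (encodeInt b).map sym := fun b => rfl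
  constructor
  · intro h
    have h1 : FP (α := (Str × Str) × ℕ) (β := ℤ) f :=
      FP.of_isPolyTime s sym hs ha hb h
    exact (h1.comp (FP.fst.pair (FP.toUnary.comp FP.snd))).of_code_eq fun _ => rfl
  · intro h
    refine IsPolyTime.of_FP (α := (Str × Str) × ℕ) (β := ℤ) s sym sym_injective
      ha hb ?_
    refine (h.comp (FP.fst.pair (FP.ofUnary.comp FP.snd))).of_code_eq fun a => ?_
    rw [List.length_replicate]
    rfl

theorem FP.of_isPolyTime_unary {v : ℕ → ℤ} (h : IsPolyTime unaryEncodeNat encodeInt v) :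
    FP (fun l : List Unit => encodeInt (v l.length)) := by
  have h1 : FP (α := ℕ) (β := ℤ) v :=
    FP.of_isPolyTime sym sym sym_injective (fun _ => rfl) (fun _ => rfl) h
  exact (h1.comp FP.toUnary).of_code_eq fun _ => rfl

/-! ### Sums over bit strings -/

/-- The sum of `F u` over the bit strings `u` of length `n`. -/
def bitSum {M : Type} [AddCommMonoid M] (n : ℕ) (F : List Bool → M) : M :=
  ∑ u : Fin n → Bool, F (List.ofFn u)

section BitSum

variable {M : Type} [AddCommMonoid M]

theorem bitSum_zero (F : List Bool → M) : bitSum 0 F = F [] := by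
  simp [bitSum]

theorem bitSum_succ (n : ℕ) (F : List Bool → M) :
    bitSum (n + 1) F = bitSum n (fun u => F (true :: u)) + bitSum n (fun u => F (false :: u)) := by
  unfold bitSum
  rw [← (Fin.consEquiv fun _ : Fin (n + 1) => Bool).sum_comp, Fintype.sum_prod_type]
  simp [Fin.consEquiv, List.ofFn_succ]

theorem bitSum_congr {n : ℕ} {F G : List Bool → M} (h : ∀ u, u.length = n → F u = G u) :
    bitSum n F = bitSum n G :=
  Finset.sum_congr rfl fun u _ => h _ (by simp)

theorem bitSum_add (m n : ℕ) (F : List Bool → M) :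
    bitSum (m + n) F = bitSum m fun u => bitSum n fun v => F (u ++ v) := by
  induction m generalizing F with
  | zero => simp [bitSum_zero]
  | succ m ih =>
    rw [Nat.succ_add, bitSum_succ, bitSum_succ, ih, ih]
    rfl

theorem bitSum_comm (m n : ℕ) (F : List Bool → List Bool → M) :
    (bitSum m fun u => bitSum n fun v => F u v) = bitSum n fun v => bitSum m fun u => F u v :=
  Finset.sum_comm

theorem bitSum_fun_add (n : ℕ) (F G : List Bool → M) :
    bitSum n (fun u => F u + G u) = bitSum n F + bitSum n G :=
  Finset.sum_add_distrib

end BitSum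

theorem bitSum_const (n c : ℕ) : bitSum n (fun _ => c) = 2 ^ n * c := by
  simp [bitSum]

/-- Exactly one string consists of zeros, so padding by zeros does not change a count. -/
theorem bitSum_allFalse (n c : ℕ) :
    bitSum n (fun u => bif u.all (fun b => !b) then c else 0) = c := by
  induction n with
  | zero => simp [bitSum_zero]
  | succ n ih =>
    rw [bitSum_succ]
    simp only [List.all_cons, Bool.not_true, Bool.false_and, cond_false, Bool.not_false,
      Bool.true_and, ih]
    simp [bitSum_const]

/-- The number represented by a list of binary digits, the least significant one first. -/
def bitsVal : List Bool → ℕ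
  | [] => 0
  | b :: l => b.toNat + 2 * bitsVal l

theorem bitsVal_encodePosNum (n : PosNum) : bitsVal (encodePosNum n) = n := by
  induction n with
  | one => rfl
  | bit0 n ih => rw [encodePosNum, bitsVal, ih, PosNum.cast_bit0]; simp; omega
  | bit1 n ih => rw [encodePosNum, bitsVal, ih, PosNum.cast_bit1]; simp; omega

theorem bitsVal_encodeNat (n : ℕ) : bitsVal (encodeNat n) = n := by
  have h : ∀ m : Num, bitsVal (encodeNum m) = m := by
    intro m
    cases m with
    | zero => rfl
    | pos m => exact bitsVal_encodePosNum m
  rw [encodeNat, h]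
  simp

/-- Digit by digit comparison of two binary numbers; the flag is the result for equal numbers. -/
def bitsLt : Bool → List Bool → List Bool → Bool
  | f, [], _ => f
  | f, a :: z, n => bitsLt (if a = decide (n.head? = some true) then f
      else decide (n.head? = some true)) z n.tail

/-- There are `n` numbers below `n`, and one more if equality is admitted by the flag. Digits are
read from the least significant one, so a later difference overrides the earlier ones; splitting off
the lowest digit replaces `n` by its half, with two new flags accounting for the remainder. Missing
digits of `n` count as zeros. -/
theorem bitSum_bitsLt (r : ℕ) (f : Bool) (n : List Bool) (hn : n.length ≤ r) :
    bitSum r (fun z => (bitsLt f z n).toNat) = bitsVal n + f.toNat := by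
  induction r generalizing f n with
  | zero =>
    have : n = [] := List.length_eq_zero_iff.1 (by omega)
    subst this
    simp [bitSum_zero, bitsLt, bitsVal]
  | succ r ih =>
    rw [bitSum_succ]
    simp only [bitsLt]
    rw [ih _ _ (by simp; omega), ih _ _ (by simp; omega)]
    rcases n with _ | ⟨_ | _, n⟩ <;> cases f <;> simp [bitsVal] <;> omega

/-- One step of the comparison of the bits of a string with those of a number. -/
def bitsLtStep (s : Sym Bool × (List Bool × List Bool)) : Sym Bool × (List Bool × List Bool) :=
  (Sym.mk (if decide (s.2.2.head? = some true) = decide (s.2.1.head? = some true) then s.1.val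
    else decide (s.2.1.head? = some true)), (s.2.1.tail, s.2.2.tail))

theorem bitsLtStep_iterate (z : List Bool) (f : Bool) (n u : List Bool) :
    bitsLtStep^[z.length] (Sym.mk f, (n, z ++ u)) =
      (Sym.mk (bitsLt f z n), (n.drop z.length, u)) := by
  induction z generalizing f n with
  | nil => rfl
  | cons a z ih =>
    rw [List.length_cons, Function.iterate_succ_apply, bitsLtStep]
    simp only [List.cons_append, List.tail_cons, ih, bitsLt, List.drop_tail, List.head?_cons,
      Option.some.injEq, Bool.decide_eq_true]

namespace FP

section

variable {α : Type} [Coded α] {A : Type} [Fintype A]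

theorem drop {n : α → List Unit} {f : α → List A} (hn : FP n) (hf : FP f) :
    FP (fun a => (f a).drop (n a).length) := by
  have := iter (step := List.tail (α := A)) (tail FP.id) 0 (fun s => by simp) hn hf
  have e : ∀ (k : ℕ) (l : List A), List.tail^[k] l = l.drop k := by
    intro k l
    induction k generalizing l with
    | zero => rfl
    | succ k ih => rw [Function.iterate_succ_apply, ih, List.drop_tail]
  simpa only [e] using this

theorem bitsLtIter {n : α → List Unit} {f : α → Bool} {m u : α → List Bool} (hn : FP n)
    (hf : FP fun a => Sym.mk (f a)) (hm : FP m) (hu : FP u) :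
    FP (fun a => bitsLtStep^[(n a).length] (Sym.mk (f a), (m a, u a))) := by
  refine iter (step := bitsLtStep) ?_ 0 (fun s => ?_) hn (hf.pair (hm.pair hu))
  · have h1 : FP (fun s : Sym Bool × (List Bool × List Bool) => s.2.1) := fst.comp snd
    have h2 : FP (fun s : Sym Bool × (List Bool × List Bool) => s.2.2) := snd.comp snd
    exact (apply₃ (fun (a b : Option Bool) (f : Bool) => Sym.mk
      (if decide (a = some true) = decide (b = some true) then f else decide (b = some true)))
      (head h2) (head h1) fst).pair ((tail h1).pair (tail h2))
  · simp only [length_code_prod, bitsLtStep, length_code_sym, length_code_list, List.length_tail]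
    omega

theorem polyLength (p : Polynomial ℕ) {f : α → List A} (hf : FP f) :
    FP (fun a => List.replicate (p.eval (f a).length) ()) :=
  (polyUnits p).comp hf

end

end FP

/-! ### Closure properties of the counting classes -/

/-- `f` counts the witnesses of length `p` for the predicate `T`. -/
def Counts (p : Polynomial ℕ) (T : Str → Str → Bool) (f : Str → ℕ) : Prop :=
  FP (fun a : Str × Str => Sym.mk (T a.1 a.2)) ∧
    ∀ x, f x = bitSum (p.eval x.length) fun u => (T x u).toNat

theorem mem_SharpP_iff {f : Str → ℕ} : f ∈ SharpP ↔ ∃ p T, Counts p T f := by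
  constructor
  · rintro ⟨p, T, hT, h⟩
    exact ⟨p, T, isPolyTimePred_iff.1 hT, h⟩
  · rintro ⟨p, T, hT, h⟩
    exact ⟨p, T, isPolyTimePred_iff.2 hT, h⟩

/-- One step of reading padding. -/
def padStep (s : Sym Bool × List Bool) : Sym Bool × List Bool :=
  (Sym.mk (s.1.val && !(decide (s.2.head? = some true))), s.2.tail)

theorem padStep_iterate (z : List Bool) (f : Bool) (u : List Bool) :
    padStep^[z.length] (Sym.mk f, z ++ u) = (Sym.mk (f && z.all (fun b => !b)), u) := by
  induction z generalizing f with
  | nil => simp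
  | cons a z ih =>
    rw [List.length_cons, Function.iterate_succ_apply, padStep]
    simp [ih, Bool.and_assoc]

/-- The additional bits must all be zero, so every old witness has exactly one extension. This
brings two counting functions to a common witness length. -/
theorem Counts.pad {p : Polynomial ℕ} {T : Str → Str → Bool} {f : Str → ℕ} (h : Counts p T f)
    (r : Polynomial ℕ) : ∃ T', Counts (r + p) T' f := by
  refine ⟨fun x u => let s := padStep^[r.eval x.length] (Sym.mk true, u)
    bif s.1.val then T x s.2 else false, ?_, fun x => ?_⟩
  · have h1 : FP (fun a : Str × Str => padStep^[(List.replicate (r.eval a.1.length) ()).length]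
        (Sym.mk true, a.2)) := by
      refine FP.iter (step := padStep) ?_ 0 (fun s => ?_) (FP.polyLength r FP.fst)
        ((FP.const _).pair FP.snd)
      · exact (FP.apply₂ (fun (a : Bool) (b : Option Bool) => Sym.mk
          (a && !(decide (b = some true)))) FP.fst (FP.head FP.snd)).pair (FP.tail FP.snd)
      · simp [length_code_prod, padStep]
    simp only [List.length_replicate] at h1
    have h2 := FP.cond (FP.fst.comp h1) (h.1.comp (FP.fst.pair (FP.snd.comp h1)))
      (FP.const (Sym.mk false))
    exact h2.of_code_eq fun a => by dsimp only; cases (padStep^[_] _).1.val <;> rfl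
  · rw [h.2 x, Polynomial.eval_add, bitSum_add]
    have e : ∀ u : List Bool, u.length = r.eval x.length →
        (bitSum (p.eval x.length) fun v =>
          (let s := padStep^[r.eval x.length] (Sym.mk true, u ++ v)
            bif s.1.val then T x s.2 else false).toNat) =
        bif u.all (fun b => !b) then bitSum (p.eval x.length) (fun v => (T x v).toNat) else 0 := by
      intro u hu
      rw [← hu]
      simp only [padStep_iterate, Bool.true_and]
      cases u.all (fun b => !b) with
      | true => rfl
      | false => simp [bitSum]
    rw [bitSum_congr e, bitSum_allFalse]

theorem Counts.common {f g : Str → ℕ} (hf : f ∈ SharpP) (hg : g ∈ SharpP) :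
    ∃ p T U, Counts p T f ∧ Counts p U g := by
  obtain ⟨p, T, h⟩ := mem_SharpP_iff.1 hf
  obtain ⟨q, U, h'⟩ := mem_SharpP_iff.1 hg
  obtain ⟨T', hT⟩ := h.pad q
  obtain ⟨U', hU⟩ := h'.pad p
  exact ⟨q + p, T', U', hT, add_comm p q ▸ hU⟩

/-- Combination of two functions according to the first bit of a string. -/
def branchBit {γ : Type} (T U : Str → Str → γ) (d : γ) (x u : Str) : γ :=
  u.head?.elim d fun b => bif b then T x u.tail else U x u.tail

theorem FP.branchBit {γ : Type} [Coded γ] {T U : Str → Str → γ} {d : γ}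
    (hT : FP (fun a : Str × Str => T a.1 a.2)) (hU : FP (fun a : Str × Str => U a.1 a.2)) :
    FP (fun a : Str × Str => branchBit T U d a.1 a.2) := by
  have ht : FP (fun a : Str × Str => (a.1, a.2.tail)) := FP.fst.pair (FP.tail FP.snd)
  refine FP.cases (c := fun a : Str × Str => a.2.head?)
    (f := fun o a => o.elim d fun b => bif b then T a.1 a.2.tail else U a.1 a.2.tail)
    (FP.head FP.snd) fun o => ?_
  match o with
  | none => exact FP.const d
  | some true => exact hT.comp ht
  | some false => exact hU.comp ht

theorem FP.branchBit_sym {γ : Type} [Fintype γ] {T U : Str → Str → γ} {d : γ}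
    (hT : FP (fun a : Str × Str => Sym.mk (T a.1 a.2)))
    (hU : FP (fun a : Str × Str => Sym.mk (U a.1 a.2))) :
    FP (fun a : Str × Str => Sym.mk (WeightedCounting.branchBit T U d a.1 a.2)) :=
  (FP.branchBit (T := fun x u => Sym.mk (T x u)) (U := fun x u => Sym.mk (U x u))
    (d := Sym.mk d) hT hU).of_code_eq fun a => by
    unfold WeightedCounting.branchBit
    rcases a.2.head? with _ | _ | _ <;> rfl

theorem bitSum_branchBit {γ M : Type} [AddCommMonoid M] (F : γ → M) (T U : Str → Str → γ) (d : γ)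
    (x : Str) (n : ℕ) : bitSum (n + 1) (fun u => F (branchBit T U d x u)) =
      bitSum n (fun u => F (T x u)) + bitSum n (fun u => F (U x u)) := by
  rw [bitSum_succ]
  rfl

theorem SharpP.add {f g : Str → ℕ} (hf : f ∈ SharpP) (hg : g ∈ SharpP) :
    (fun x => f x + g x) ∈ SharpP := by
  obtain ⟨p, T, U, hT, hU⟩ := Counts.common hf hg
  refine mem_SharpP_iff.2 ⟨p + 1, branchBit T U false, FP.branchBit_sym hT.1 hU.1, fun x => ?_⟩
  simp only [Polynomial.eval_add, Polynomial.eval_one, bitSum_branchBit Bool.toNat, hT.2, hU.2]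

theorem SharpP.two_pow (p : Polynomial ℕ) : (fun x : Str => 2 ^ p.eval x.length) ∈ SharpP :=
  mem_SharpP_iff.2 ⟨p, fun _ _ => true, FP.const _, fun x => by simp [bitSum_const]⟩

theorem SharpP.mul_const {f : Str → ℕ} (hf : f ∈ SharpP) (k : ℕ) :
    (fun x => k * f x) ∈ SharpP := by
  induction k with
  | zero => exact mem_SharpP_iff.2 ⟨0, fun _ _ => false, FP.const _, fun x => by
      simp [bitSum_const]⟩
  | succ k ih => simpa [Nat.succ_mul] using SharpP.add ih hf

theorem GapP.add_sharpP {g : Str → ℤ} (hg : g ∈ GapP) {f : Str → ℕ} (hf : f ∈ SharpP) :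
    (fun x => g x + f x) ∈ GapP := by
  obtain ⟨f₁, h₁, f₂, h₂, h⟩ := hg
  exact ⟨_, SharpP.add h₁ hf, f₂, h₂, fun x => by
    simp only [h]; push_cast; ring⟩

theorem GapP.mul_const {g : Str → ℤ} (hg : g ∈ GapP) (k : ℕ) :
    (fun x => (k : ℤ) * g x) ∈ GapP := by
  obtain ⟨f₁, h₁, f₂, h₂, h⟩ := hg
  exact ⟨_, SharpP.mul_const h₁ k, _, SharpP.mul_const h₂ k, fun x => by
    simp only [h]; push_cast; ring⟩

theorem bitSum_natCast {M : Type} [AddCommMonoidWithOne M] (n : ℕ) (F : List Bool → ℕ) :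
    ((bitSum n F : ℕ) : M) = bitSum n fun u => (F u : M) := by
  simp [bitSum]

/-- An integer is the number of strings below its absolute value, counted positively or negatively.
Separating the indices by the sign of `V` gives two counting functions, whose witnesses consist of
the comparison bits followed by `u`. -/
theorem GapP.bitSum {V : Str → Str → ℤ} (hV : FP (fun a : Str × Str => encodeInt (V a.1 a.2)))
    (p : Polynomial ℕ) : (fun x : Str => bitSum (p.eval x.length) (V x)) ∈ GapP := by
  obtain ⟨T, hT⟩ := hV.length_le
  -- Enough comparison bits: the code of `V x u` has length at most `T` of the length of the pair,
  -- which is `|x| + p(|x|)`.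
  let r : Polynomial ℕ := T.comp (Polynomial.X + p)
  let n : Str × Str → List Unit := fun a => List.replicate (r.eval a.1.length) ()
  let U : Bool → Str → Str → Bool := fun neg x u =>
    let e := encodeInt (V x (u.drop (n (x, u)).length))
    decide (e.head? = some neg) &&
      (bitsLtStep^[(n (x, u)).length] (Sym.mk false, (e.tail, u))).1.val
  have hU : ∀ neg, FP (fun a : Str × Str => Sym.mk (U neg a.1 a.2)) := by
    intro neg
    have hn : FP n := FP.polyLength r FP.fst
    have he : FP (fun a : Str × Str => encodeInt (V a.1 (a.2.drop (n a).length))) :=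
      hV.comp (FP.fst.pair (FP.drop hn FP.snd))
    exact FP.apply₂ (fun (o : Option Bool) (b : Bool) => Sym.mk (decide (o = some neg) && b))
      (FP.head he) (FP.fst.comp (FP.bitsLtIter hn (FP.const (Sym.mk false)) (FP.tail he) FP.snd))
  have key : ∀ neg x, WeightedCounting.bitSum ((r + p).eval x.length)
      (fun u => (U neg x u).toNat) = WeightedCounting.bitSum (p.eval x.length)
      fun u => bif (decide (V x u < 0) == neg) then (V x u).natAbs else 0 := by
    intro neg x
    rw [Polynomial.eval_add, bitSum_add, bitSum_comm]
    refine bitSum_congr fun u hu => ?_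
    have e : ∀ z : List Bool, z.length = r.eval x.length → (U neg x (z ++ u)).toNat =
        bif (decide (V x u < 0) == neg) then (bitsLt false z (encodeNat (V x u).natAbs)).toNat
          else 0 := by
      intro z hz
      have hn : (n (x, z ++ u)).length = z.length := by simp [n, hz]
      simp only [U, hn, List.drop_left, bitsLtStep_iterate, encodeInt, List.head?_cons,
        List.tail_cons, Option.some.injEq]
      by_cases h : decide (V x u < 0) = neg
      · simp [h]
      · simp [h, beq_eq_false_iff_ne.2 h]
    rw [bitSum_congr e]
    by_cases h : decide (V x u < 0) = neg
    · simp only [h, beq_self_eq_true, cond_true]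
      rw [bitSum_bitsLt, bitsVal_encodeNat]
      · rfl
      · have := hT (x, u)
        simp only [length_code_prod, length_code_list, hu, encodeInt, List.length_cons] at this
        simp only [r, Polynomial.eval_comp, Polynomial.eval_add, Polynomial.eval_X]
        omega
    · simp [beq_eq_false_iff_ne.2 h, bitSum_const]
  refine ⟨_, mem_SharpP_iff.2 ⟨r + p, U false, hU false, fun x => rfl⟩, _,
    mem_SharpP_iff.2 ⟨r + p, U true, hU true, fun x => rfl⟩, fun x => ?_⟩
  rw [key, key, bitSum_natCast, bitSum_natCast]
  unfold WeightedCounting.bitSum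
  rw [← Finset.sum_sub_distrib]
  refine Finset.sum_congr rfl fun u _ => ?_
  by_cases h : V x (List.ofFn u) < 0
  · simp [h, abs_of_neg h]
  · simp [h, abs_of_nonneg (not_lt.1 h)]

/-! ### Characterisations of `AWPP` -/

/-- A language is in `AWPP` if the acceptance probabilities `P` with a gap are approximated
arbitrarily well by normalised `GapP` functions. -/
theorem mem_AWPP_of_approx {L : Language Bool} {P : Str → ℝ} {c : ℝ} (hc : c < 1 / 2)
    (hP : ∀ x, (x ∈ L → 1 - c ≤ P x ∧ P x ≤ 1) ∧ (x ∉ L → 0 ≤ P x ∧ P x ≤ c))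
    (h : ∀ k : ℕ, ∃ g ∈ GapP, ∃ r : Polynomial ℕ, ∀ x,
      |(g x : ℝ) / 2 ^ (r.eval x.length) - P x| ≤ 1 / 2 ^ k) : L ∈ AWPP := by
  -- With `ε = 2 ^ (-k)`, this choice gives `c + 2 * ε < 1 / 2` and `2 * ε < 1`.
  obtain ⟨k, hk⟩ := exists_pow_lt_of_lt_one (lt_min (by linarith : 0 < (1 / 2 - c) / 2)
    (by norm_num : (0 : ℝ) < 1 / 2)) (by norm_num : (1 / 2 : ℝ) < 1)
  rw [lt_min_iff, one_div_pow] at hk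
  obtain ⟨g, hg, r, hgr⟩ := h k
  set ε : ℝ := 1 / 2 ^ k with hε
  have hε0 : 0 < ε := by positivity
  have hεk : ε * 2 ^ k = 1 := by rw [hε]; field_simp
  -- The normalised function is `(1 - 2 * ε) * (y + ε)`, where `y` approximates `P` within `ε`. The
  -- shift by `ε` makes it nonnegative, and the factor keeps it at most one because `(1 - 2 * ε) *
  -- (1 + 2 * ε) ≤ 1`. Either bound on the error deteriorates by at most `2 * ε`.
  refine ⟨r + Polynomial.C (2 * k), _,
    GapP.mul_const (GapP.add_sharpP (GapP.mul_const hg (2 ^ k)) (SharpP.two_pow r)) (2 ^ k - 2),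
    c + 2 * ε, by linarith, fun x => ?_⟩
  -- Ensures that the truncated subtraction `2 ^ k - 2` is a true one.
  have h2k : 2 ≤ 2 ^ k := by
    have : (2 : ℝ) ≤ 2 ^ k := by nlinarith
    exact_mod_cast this
  have e : (((2 ^ k - 2 : ℕ) : ℤ) * (((2 ^ k : ℕ) : ℤ) * g x + ((2 ^ r.eval x.length : ℕ) : ℤ)) :
      ℤ) / (2 : ℝ) ^ (r + Polynomial.C (2 * k)).eval x.length =
      (1 - 2 * ε) * ((g x : ℝ) / 2 ^ r.eval x.length + ε) := by
    rw [Polynomial.eval_add, Polynomial.eval_C, pow_add, mul_comm 2 k, pow_mul, hε]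
    push_cast [h2k]
    field_simp
  rw [e]
  have hy := abs_le.1 (hgr x)
  set y : ℝ := (g x : ℝ) / 2 ^ r.eval x.length
  constructor
  · intro hx
    obtain ⟨h1, h2⟩ := (hP x).1 hx
    constructor
    · nlinarith
    · nlinarith
  · intro hx
    obtain ⟨h1, h2⟩ := (hP x).2 hx
    constructor
    · exact mul_nonneg (by linarith) (by linarith)
    · nlinarith

theorem card_filter_eq_bitSum (n : ℕ) (T : List Bool → Bool) :
    (Finset.univ.filter fun y : Fin n → Bool => T (List.ofFn y) = true).card =
      bitSum n fun u => (T u).toNat := by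
  rw [Finset.card_filter, bitSum]
  refine Finset.sum_congr rfl fun u _ => ?_
  cases T (List.ofFn u) <;> rfl

theorem bitSum_not (n : ℕ) (T : List Bool → Bool) :
    (bitSum n fun u => (!T u).toNat) + (bitSum n fun u => (T u).toNat) = 2 ^ n := by
  rw [← bitSum_fun_add, ← mul_one (2 ^ n), ← bitSum_const]
  refine bitSum_congr fun u _ => ?_
  cases T u <;> rfl

/-! ### The inclusion of AWPP in PP -/

theorem AWPP_subset_PP : AWPP ⊆ PP := by
  rintro L ⟨p, g, ⟨f₁, h₁, f₂, h₂, hg⟩, c, hc, hL⟩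
  -- `T` counts `2 f₁` and `U` counts `2 f₂ + 2 ^ p`. One more bit selects between the witnesses of
  -- `T` and the non-witnesses of `U`, so `2 f₁ + 2 ^ q - (2 f₂ + 2 ^ p)` of the `2 ^ (q + 1)`
  -- strings are accepted. These are more than half exactly when `2 (f₁ - f₂) > 2 ^ p`.
  obtain ⟨q, T, U, hT, hU⟩ := Counts.common (SharpP.mul_const h₁ 2)
    (SharpP.add (SharpP.mul_const h₂ 2) (SharpP.two_pow p))
  have hM : FP (fun a : Str × Str => Sym.mk (branchBit T (fun x u => !U x u) false a.1 a.2)) :=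
    FP.branchBit_sym hT.1 (FP.apply₁ (fun b => Sym.mk (!b)) hU.1)
  refine ⟨q + 1, branchBit T (fun x u => !U x u) false, isPolyTimePred_iff.2 hM, fun x => ?_⟩
  rw [card_filter_eq_bitSum, Polynomial.eval_add, Polynomial.eval_one,
    bitSum_branchBit Bool.toNat, ← hT.2]
  have hn := bitSum_not (q.eval x.length) (U x)
  rw [← hU.2] at hn
  set m := bitSum (q.eval x.length) fun u => (!U x u).toNat
  have hm : (m : ℚ) + (2 * f₂ x + 2 ^ p.eval x.length) = 2 ^ q.eval x.length := by
    exact_mod_cast hn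
  have hgr : (g x : ℝ) = f₁ x - f₂ x := by rw [hg]; push_cast; rfl
  have h2 : (0 : ℝ) < 2 ^ p.eval x.length := by positivity
  rw [pow_succ, lt_div_iff₀ (by positivity), div_le_iff₀ (by positivity), ← hm]
  push_cast
  constructor
  · intro hx
    have h1 := ((hL x).1 hx).1
    rw [le_div_iff₀ h2, hgr] at h1
    have : (2 : ℝ) ^ p.eval x.length < 2 * (f₁ x - f₂ x) := by nlinarith
    have : (2 : ℚ) ^ p.eval x.length < 2 * (f₁ x - f₂ x) := by exact_mod_cast this
    linarith
  · intro hx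
    have h1 := ((hL x).2 hx).2
    rw [div_le_iff₀ h2, hgr] at h1
    have : 2 * ((f₁ x : ℝ) - f₂ x) ≤ 2 ^ p.eval x.length := by nlinarith
    have : 2 * ((f₁ x : ℚ) - f₂ x) ≤ 2 ^ p.eval x.length := by exact_mod_cast this
    linarith

/-! ### Dyadic weights, and AWPP in terms of weighted sums -/

theorem encodePosNum_two_pow (k : ℕ) (n : PosNum) (h : (n : ℕ) = 2 ^ k) :
    encodePosNum n = List.replicate k false ++ [true] := by
  induction k generalizing n with
  | zero =>
    have : n = 1 := PosNum.cast_inj (α := ℕ) |>.1 (by simpa using h)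
    subst this
    rfl
  | succ k ih =>
    cases n with
    | one =>
      have := Nat.one_lt_two_pow (Nat.succ_ne_zero k)
      simp at h
      omega
    | bit0 n =>
      rw [encodePosNum, ih n]
      · rfl
      · have : (n : ℕ) + n = 2 ^ (k + 1) := h
        rw [pow_succ] at this
        omega
    | bit1 n =>
      have : (n : ℕ) + n + 1 = 2 ^ (k + 1) := h
      rw [pow_succ] at this
      omega

theorem encodeNat_two_pow (k : ℕ) : encodeNat (2 ^ k) = List.replicate k false ++ [true] := by
  have h : (((2 ^ k : ℕ) : Num) : ℕ) = 2 ^ k := Num.to_of_nat _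
  rw [encodeNat]
  cases hn : ((2 ^ k : ℕ) : Num) with
  | zero =>
    rw [hn] at h
    exact absurd h.symm (by positivity)
  | pos n =>
    rw [hn] at h
    exact encodePosNum_two_pow k n h

/-- The binary code of a signed power of two is its sign, then zeros, then a one, so it is computed
from unary lengths. Starting from `b + 1` units makes the case `p = b` leave a single unit,
distinguishable from `b < p`; the tail then has the right length `b - p`. -/
theorem encodeInt_shift (s : Fin 3) (b p : ℕ) :
    encodeInt (if p ≤ b then ((s : ℤ) - 1) * 2 ^ (b - p) else 0) =
      bif ((List.replicate (b + 1) ()).drop p).head? = none || s = 1 then [false] else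
        decide (s = 0) :: ((((List.replicate (b + 1) ()).drop p).tail.map fun _ => false) ++
          [true]) := by
  have hd : (List.replicate (b + 1) ()).drop p = List.replicate (b + 1 - p) () := by simp
  rw [hd]
  by_cases h : p ≤ b
  · obtain ⟨k, rfl⟩ := Nat.exists_eq_add_of_le h
    have e : p + k + 1 - p = k + 1 := by omega
    have e' : p + k - p = k := by omega
    rw [e, e', if_pos h, List.replicate_succ]
    have hp : (0 : ℤ) < 2 ^ k := by positivity
    fin_cases s
    · simp [encodeInt, encodeNat_two_pow, Int.natAbs_pow]
    · simp [encodeInt]; rfl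
    · simp [encodeInt, encodeNat_two_pow, Int.natAbs_pow]
  · rw [if_neg h, Nat.sub_eq_zero_of_le (by omega)]
    rfl

/-- The signs `+1`, `0`, `-1` of the summands of the difference of two counting functions. -/
def branchSign (T U : Str → Str → Bool) : Str → Str → Fin 3 :=
  branchBit (fun x u => bif T x u then 2 else 1) (fun x u => bif U x u then 0 else 1) 1

theorem bitSum_branchSign (T U : Str → Str → Bool) (x : Str) (n : ℕ) :
    (bitSum (n + 1) fun u => ((branchSign T U x u : ℤ) : ℝ) - 1) =
      (bitSum n fun u => (T x u).toNat : ℕ) - (bitSum n fun u => (U x u).toNat : ℕ) := by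
  unfold branchSign
  rw [bitSum_branchBit fun s : Fin 3 => ((s : ℤ) : ℝ) - 1, bitSum_natCast, bitSum_natCast]
  simp only [bitSum]
  rw [sub_eq_add_neg, ← Finset.sum_neg_distrib]
  congr 1 <;> refine Finset.sum_congr rfl fun u _ => ?_
  · cases T x (List.ofFn u) <;> norm_num
  · cases U x (List.ofFn u) <;> norm_num

theorem exists_weighted_of_mem_AWPP {L : Language Bool} (hL : L ∈ AWPP) :
    ∃ g ∈ WeightedSharpP Set.univ, ∃ c : ℝ, c < 1 / 2 ∧
      ∀ x : Str, (x ∈ L → 1 - c ≤ g x ∧ g x ≤ 1) ∧ (x ∉ L → 0 ≤ g x ∧ g x ≤ c) := by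
  obtain ⟨p, g, ⟨f₁, h₁, f₂, h₂, hg⟩, c, hc, hL⟩ := hL
  refine ⟨fun x => (g x : ℝ) / 2 ^ p.eval x.length, ?_, c, hc, hL⟩
  obtain ⟨q, T, U, hT, hU⟩ := Counts.common h₁ h₂
  have hs : FP (fun a : Str × Str => Sym.mk (branchSign T U a.1 a.2)) :=
    FP.branchBit_sym (FP.apply₁ (fun b => Sym.mk (bif b then 2 else 1 : Fin 3)) hT.1)
      (FP.apply₁ (fun b => Sym.mk (bif b then 0 else 1 : Fin 3)) hU.1)
  -- The weight is `± 2 ^ (-p)` or `0`. It is dyadic of precision `p`, so it is given exactly for `b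
  -- ≥ p`; for smaller `b` the approximation `0` is good enough, since `2 ^ (-p) ≤ 2 ^ (-b)`.
  refine ⟨q + 1, fun x u => (((branchSign T U x u : ℤ) : ℝ) - 1) / 2 ^ p.eval x.length,
    ⟨fun x u b => if p.eval x.length ≤ b then
      ((branchSign T U x u : ℤ) - 1) * 2 ^ (b - p.eval x.length) else 0, ?_, fun x u b => ?_⟩,
    fun _ _ => Set.mem_univ _, fun x => ?_⟩
  · rw [isPolyTime_triple_iff]
    simp only [encodeInt_shift]
    have hd : FP (fun a : (Str × Str) × List Unit =>
        (List.replicate (a.2.length + 1) ()).drop (p.eval a.1.1.length)) := by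
      have h := FP.drop (FP.polyLength p (FP.fst.comp (FP.fst (α := Str × Str) (β := List Unit))))
        (FP.cons (FP.const (Sym.mk ())) FP.snd)
      refine h.of_code_eq fun a => ?_
      rw [List.length_replicate, List.replicate_succ,
        ← List.eq_replicate_length.2 fun _ _ => rfl]
    have hs' := hs.comp (FP.fst (α := Str × Str) (β := List Unit))
    exact FP.cond (FP.apply₂ (fun (o : Option Unit) (s : Fin 3) => Sym.mk (o = none || s = 1))
        (FP.head hd) hs') (FP.const _)
      (FP.cons (FP.apply₁ (fun s : Fin 3 => Sym.mk (decide (s = 0))) hs')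
        (FP.append (FP.map _ (FP.tail hd)) (FP.const _)))
  · have hs1 : |((branchSign T U x u : ℤ) : ℝ) - 1| ≤ 1 := by
      generalize branchSign T U x u = s
      fin_cases s <;> norm_num
    have h2 : ∀ n : ℕ, (0 : ℝ) < 2 ^ n := fun n => by positivity
    dsimp only
    split_ifs with h
    · obtain ⟨k, rfl⟩ := Nat.exists_eq_add_of_le h
      rw [Nat.add_sub_cancel_left, pow_add]
      push_cast
      rw [mul_div_mul_right _ _ (h2 k).ne', sub_self, abs_zero]
      have := h2 (p.eval x.length)
      have := h2 k
      positivity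
    · rw [Int.cast_zero, zero_div, sub_zero, abs_div, abs_of_pos (h2 _)]
      exact div_le_div₀ zero_le_one hs1 (h2 _) (pow_le_pow_right₀ one_le_two (not_le.1 h).le)
  · have := bitSum_branchSign T U x (q.eval x.length)
    rw [← hT.2, ← hU.2] at this
    rw [Polynomial.eval_add, Polynomial.eval_one, ← Finset.sum_div]
    refine congrArg (· / _) ?_
    rw [hg]
    push_cast
    exact this.symm

theorem mem_AWPP_of_weighted {L : Language Bool} {g : Str → ℝ}
    (hg : g ∈ WeightedSharpP Set.univ) {c : ℝ} (hc : c < 1 / 2)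
    (hL : ∀ x : Str, (x ∈ L → 1 - c ≤ g x ∧ g x ≤ 1) ∧ (x ∉ L → 0 ≤ g x ∧ g x ≤ c)) :
    L ∈ AWPP := by
  obtain ⟨p, w, ⟨v, hv, hvw⟩, -, hgw⟩ := hg
  rw [isPolyTime_triple_iff] at hv
  refine mem_AWPP_of_approx hc hL fun k => ?_
  -- With precision `p + k`, the `2 ^ p` rounding errors of at most `2 ^ (-(p + k))` sum to at most
  -- `2 ^ (-k)`.
  refine ⟨_, GapP.bitSum (V := fun x u => v x u (p + Polynomial.C k |>.eval x.length)) ?_ p,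
    p + Polynomial.C k, fun x => ?_⟩
  · have h := hv.comp (FP.id.pair (FP.polyLength (p + Polynomial.C k)
      (FP.fst (α := Str) (β := Str))))
    simpa only [List.length_replicate] using h
  · rw [hgw, bitSum, Polynomial.eval_add, Polynomial.eval_C]
    push_cast
    rw [Finset.sum_div, ← Finset.sum_sub_distrib]
    refine (Finset.abs_sum_le_sum_abs _ _).trans ?_
    refine (Finset.sum_le_sum fun u _ => (abs_sub_comm _ _).trans_le
      (hvw x (List.ofFn u) _)).trans_eq ?_
    rw [Finset.sum_const, Finset.card_univ, Fintype.card_fun, Fintype.card_fin, Fintype.card_bool,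
      nsmul_eq_mul, pow_add]
    push_cast
    field_simp

/-! ### Sums over paths of products of integer weights -/

/-- The sign contributed by the bits `z` to the integer `e`. -/
def digit (e : ℤ) (z : List Bool) : SignType :=
  bif bitsLt false z (encodeNat e.natAbs) then (if e < 0 then -1 else 1) else 0

theorem bitSum_mul_left (n : ℕ) (c : ℤ) (F : List Bool → ℤ) :
    (bitSum n fun u => c * F u) = c * bitSum n F :=
  (Finset.mul_sum _ _ _).symm

theorem bitSum_mul_right (n : ℕ) (F : List Bool → ℤ) (c : ℤ) :
    (bitSum n fun u => F u * c) = bitSum n F * c :=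
  (Finset.sum_mul _ _ _).symm

theorem bitSum_eq_zero (n : ℕ) : (bitSum n fun _ => (0 : ℤ)) = 0 :=
  Finset.sum_const_zero

theorem bitSum_digit {e : ℤ} {w : ℕ} (h : (encodeNat e.natAbs).length ≤ w) :
    (bitSum w fun z => (digit e z : ℤ)) = e := by
  have h1 := bitSum_bitsLt w false _ h
  rw [bitsVal_encodeNat, Bool.toNat_false, add_zero] at h1
  have h2 : ∀ z, (digit e z : ℤ) =
      (if e < 0 then -1 else 1) * ((bitsLt false z (encodeNat e.natAbs)).toNat : ℤ) := by
    intro z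
    unfold digit
    cases bitsLt false z (encodeNat e.natAbs) <;> split_ifs <;> simp
  simp only [h2]
  rw [bitSum_mul_left, ← bitSum_natCast, h1]
  split_ifs <;> omega

/-- The sign contributed to the integer `e` by the first `w` bits of `u`. -/
def readDigit (e : ℤ) (w : ℕ) (u : List Bool) : SignType :=
  bif (bitsLtStep^[w] (Sym.mk false, (encodeNat e.natAbs, u))).1.val then
    (if e < 0 then -1 else 1) else 0

theorem readDigit_append {e : ℤ} {w : ℕ} {z : List Bool} (hz : z.length = w) (u : List Bool) :
    readDigit e w (z ++ u) = digit e z := by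
  rw [readDigit, ← hz, bitsLtStep_iterate, digit]

/-- A fixed-length code for a finite set of choices, namely by indicator vectors. Strings that are
not code words decode to `none` and contribute nothing. -/
theorem exists_decoder (K : Type) [Fintype K] :
    ∃ (m : ℕ) (D : List Bool → Option K), ∀ F : Option K → ℤ, F none = 0 →
      bitSum m (fun u => F (D u)) = ∑ k, F (some k) := by
  classical
  let e : K → Fin (Fintype.card K) → Bool := fun k i => decide (Fintype.equivFin K k = i)
  have he : Function.Injective e := fun k l h => by
    have := congrFun h (Fintype.equivFin K l)
    simpa [e] using this
  have hf : Function.Injective fun k => List.ofFn (e k) := fun k l h => he (List.ofFn_injective h)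
  have hp := hf.isPartialInv
  refine ⟨Fintype.card K, Function.partialInv fun k => List.ofFn (e k), fun F hF => ?_⟩
  refine (Fintype.sum_of_injective e he _ _ (fun y hy => ?_) fun k => ?_).symm
  · cases h : Function.partialInv (fun k => List.ofFn (e k)) (List.ofFn y) with
    | none => simpa only [h] using hF
    | some k => exact absurd ⟨k, List.ofFn_injective ((hp _ _).1 h)⟩ hy
  · exact congrArg F (Function.partialInv_left hf k).symm

/-- The number `m` of bits is a constant, so nested case distinctions suffice and `D` may be
arbitrary. -/
theorem FP.takeSym {α X : Type} [Coded α] [Fintype X] (m : ℕ) (D : List Bool → X)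
    {u : α → List Bool} (hu : FP u) : FP (fun a => Sym.mk (D ((u a).take m))) := by
  induction m generalizing D u with
  | zero => exact FP.const (Sym.mk (D []))
  | succ m ih =>
    refine (FP.cases (c := fun a : α => (u a).head?) (f := fun (o : Option Bool) (a : α) => Sym.mk
      (o.elim (D []) fun b => D (b :: (u a).tail.take m))) (FP.head hu) fun o => ?_).of_code_eq
      fun a => ?_
    · cases o with
      | none => exact FP.const (Sym.mk (D []))
      | some b => exact ih (fun v => D (b :: v)) (FP.tail hu)
    · cases u a <;> rfl

/-- A nondeterministic system whose steps carry products of two integer weights from a finite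
list; the weights depend on a precision parameter. -/
structure PathSystem (K I σ : Type) where
  step : K → σ → σ
  index : K → σ → Option (I × I)
  weight : I → ℕ → ℤ
  final : σ → SignType

namespace PathSystem

variable {K I σ : Type} (P : PathSystem K I σ)

/-- The product of the weights of a step. -/
def stepWeight (b : ℕ) (k : K) (s : σ) : ℤ :=
  (P.index k s).elim 0 fun i => P.weight i.1 b * P.weight i.2 b

/-- The sum, over all paths of a given length, of the products of their weights. -/
def pathSum [Fintype K] (b : ℕ) : ℕ → σ → ℤ
  | 0, s => P.final s
  | t + 1, s => ∑ k, P.stepWeight b k s * pathSum b t (P.step k s)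

/-- The system is computable in polynomial time, and the states grow by a constant in each step. -/
structure Efficient [Coded σ] [Fintype I] : Prop where
  step : ∀ k, FP (P.step k)
  growth : ∃ C, ∀ k s, (code (P.step k s)).length ≤ (code s).length + C
  index : ∀ k, FP fun s => Sym.mk (P.index k s)
  weight : ∀ i, FP fun l : List Unit => encodeInt (P.weight i l.length)
  final : FP fun s => Sym.mk (P.final s)

variable (D : List Bool → Option K) (m : ℕ)

/-- States of the evaluation of a path given by a string of choice bits: the sign, the state of the
system, the remaining bits, the precision and the number of bits per weight. -/
abbrev Eval (σ : Type) : Type :=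
  Sym SignType × (σ × (List Bool × (List Unit × List Unit)))

/-- The sign of a step, given by choice bits. -/
def stepSign (s : Eval σ) : SignType :=
  (D (s.2.2.1.take m)).elim 0 fun k => (P.index k s.2.1).elim 0 fun i =>
    readDigit (P.weight i.1 s.2.2.2.1.length) s.2.2.2.2.length (s.2.2.1.drop m) *
    readDigit (P.weight i.2 s.2.2.2.1.length) s.2.2.2.2.length
      ((s.2.2.1.drop m).drop s.2.2.2.2.length)

/-- One step of the evaluation of a path. -/
def evalStep (s : Eval σ) : Eval σ :=
  (Sym.mk (s.1.val * P.stepSign D m s), ((D (s.2.2.1.take m)).elim s.2.1 fun k => P.step k s.2.1,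
    (((s.2.2.1.drop m).drop s.2.2.2.2.length).drop s.2.2.2.2.length, s.2.2.2)))

/-- The sign of an evaluated path. -/
def evalSign (s : Eval σ) : SignType := s.1.val * P.final s.2.1

/-- Each step consumes `m` bits for the choice and `w` bits for each of the two weights. Summing
over the bits of a weight recovers the weight (`bitSum_digit`), and by distributivity the sum over
all bits is the sum over paths of products. The accumulated sign `g` varies in the induction. -/
theorem bitSum_evalSign [Fintype K] (hD : ∀ F : Option K → ℤ, F none = 0 →
    bitSum m (fun u => F (D u)) = ∑ k, F (some k)) (b w : List Unit)
    (hw : ∀ i, (encodeNat (P.weight i b.length).natAbs).length ≤ w.length) (t : ℕ) :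
    ∀ (g : SignType) (s : σ), (bitSum (t * (m + (w.length + w.length))) fun u =>
      (P.evalSign ((P.evalStep D m)^[t] (Sym.mk g, (s, (u, (b, w))))) : ℤ)) =
        (g : ℤ) * P.pathSum b.length t s := by
  induction t with
  | zero =>
    intro g s
    rw [Nat.zero_mul, bitSum_zero]
    simp [evalSign, pathSum, SignType.coe_mul]
  | succ t ih =>
    intro g s
    rw [Nat.succ_mul, Nat.add_comm, bitSum_add, bitSum_add]
    have h1 : ∀ u : List Bool, u.length = m → (bitSum (w.length + w.length) fun z =>
        bitSum (t * (m + (w.length + w.length))) fun v => (P.evalSign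
          ((P.evalStep D m)^[t + 1] (Sym.mk g, (s, (u ++ z ++ v, (b, w))))) : ℤ)) =
        (D u).elim 0 fun k => (g : ℤ) * (P.stepWeight b.length k s *
          P.pathSum b.length t (P.step k s)) := by
      intro u hu
      rw [bitSum_add]
      have h2 : ∀ z₁ : List Bool, z₁.length = w.length → ∀ z₂ : List Bool, z₂.length = w.length →
          (bitSum (t * (m + (w.length + w.length))) fun v => (P.evalSign
          ((P.evalStep D m)^[t + 1] (Sym.mk g, (s, (u ++ (z₁ ++ z₂) ++ v, (b, w))))) : ℤ)) =
          (D u).elim 0 fun k => (P.index k s).elim 0 fun i =>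
            (digit (P.weight i.1 b.length) z₁ : ℤ) * ((digit (P.weight i.2 b.length) z₂ : ℤ) *
              ((g : ℤ) * P.pathSum b.length t (P.step k s))) := by
        intro z₁ h₁ z₂ h₂
        simp only [Function.iterate_succ_apply, evalStep, stepSign, List.append_assoc,
          List.take_left' hu, List.drop_left' hu, List.drop_left' h₁, List.drop_left' h₂,
          readDigit_append h₁, readDigit_append h₂]
        rw [ih]
        cases D u with
        | none => simp
        | some k =>
          cases hi : P.index k s with
          | none => simp [hi]
          | some i =>
            simp only [Option.elim_some, hi, SignType.coe_mul]
            ring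
      rw [bitSum_congr fun z₁ h₁ => bitSum_congr (h2 z₁ h₁)]
      cases D u with
      | none => simp [bitSum_eq_zero]
      | some k =>
        cases hi : P.index k s with
        | none => simp [hi, bitSum_eq_zero, stepWeight]
        | some i =>
          simp only [Option.elim_some, bitSum_mul_left, bitSum_mul_right, bitSum_digit (hw _), hi,
            stepWeight]
          ring
    rw [bitSum_congr h1, hD (fun o => o.elim 0 fun k => (g : ℤ) * (P.stepWeight b.length k s *
          P.pathSum b.length t (P.step k s))) rfl, pathSum, Finset.mul_sum]
    rfl

theorem Efficient.evalStep [Fintype K] [Coded σ] [Fintype I] {P : PathSystem K I σ}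
    (hP : P.Efficient) : FP (P.evalStep D m) := by
  have hs : FP (fun s : Eval σ => s.2.1) := FP.fst.comp FP.snd
  have hu : FP (fun s : Eval σ => s.2.2.1) := FP.fst.comp (FP.snd.comp FP.snd)
  have hbw : FP (fun s : Eval σ => s.2.2.2) := FP.snd.comp (FP.snd.comp FP.snd)
  have hb : FP (fun s : Eval σ => s.2.2.2.1) := FP.fst.comp hbw
  have hw : FP (fun s : Eval σ => s.2.2.2.2) := FP.snd.comp hbw
  have hu1 : FP (fun s : Eval σ => s.2.2.1.drop m) := by
    simpa using FP.drop (FP.const (List.replicate m ())) hu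
  have hu2 := FP.drop hw hu1
  have hdig : ∀ (i : I) (u : Eval σ → List Bool), FP u → FP (fun s => Sym.mk
      (readDigit (P.weight i s.2.2.2.1.length) s.2.2.2.2.length (u s))) := by
    intro i u hu
    have he := (hP.weight i).comp hb
    refine (FP.apply₂ (fun (o : Option Bool) (l : Bool) => Sym.mk
      (bif l then (if o = some true then -1 else 1) else 0 : SignType)) (FP.head he)
      (FP.fst.comp (FP.bitsLtIter hw (FP.const (Sym.mk false)) (FP.tail he) hu))).of_code_eq fun s => ?_
    simp only [encodeInt, List.head?_cons, List.tail_cons, Option.some.injEq, decide_eq_true_eq,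
      readDigit]
  have hsign : FP fun s => Sym.mk (P.stepSign D m s) := by
    refine (FP.cases (c := fun s : Eval σ => D (s.2.2.1.take m)) (f := fun o s => Sym.mk
      (o.elim (0 : SignType) fun k => (P.index k s.2.1).elim 0 fun i =>
      readDigit (P.weight i.1 s.2.2.2.1.length) s.2.2.2.2.length (s.2.2.1.drop m) *
      readDigit (P.weight i.2 s.2.2.2.1.length) s.2.2.2.2.length
        ((s.2.2.1.drop m).drop s.2.2.2.2.length)))
      (FP.takeSym m D hu) fun o => ?_)
    cases o with
    | none => exact FP.const (Sym.mk 0)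
    | some k =>
      refine (FP.cases (c := fun s : Eval σ => P.index k s.2.1) (f := fun o s => Sym.mk
        (o.elim (0 : SignType) fun i =>
        readDigit (P.weight i.1 s.2.2.2.1.length) s.2.2.2.2.length (s.2.2.1.drop m) *
        readDigit (P.weight i.2 s.2.2.2.1.length) s.2.2.2.2.length
          ((s.2.2.1.drop m).drop s.2.2.2.2.length)))
        ((hP.index k).comp hs) fun o => ?_)
      cases o with
      | none => exact FP.const (Sym.mk 0)
      | some i =>
        exact FP.apply₂ (fun a b : SignType => Sym.mk (a * b)) (hdig i.1 _ hu1) (hdig i.2 _ hu2)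
  have hstep : FP fun s : Eval σ => (D (s.2.2.1.take m)).elim s.2.1 fun k => P.step k s.2.1 := by
    refine (FP.cases (c := fun s : Eval σ => D (s.2.2.1.take m)) (f := fun o s =>
      o.elim s.2.1 fun k => P.step k s.2.1) (FP.takeSym m D hu) fun o => ?_)
    cases o with
    | none => exact hs
    | some k => exact (hP.step k).comp hs
  exact (FP.apply₂ (fun a b : SignType => Sym.mk (a * b)) FP.fst hsign).pair
    (hstep.pair ((FP.drop hw hu2).pair hbw))

/-- By `bitSum_evalSign` a path sum is a sum over bit strings of polynomial length of signs
computable in polynomial time, so `GapP.bitSum` applies. -/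
theorem Efficient.pathSum_mem_GapP [Fintype K] [Coded σ] [Fintype I] {P : PathSystem K I σ}
    (hP : P.Efficient) {init : Str → σ} (hinit : FP init) (b t : Polynomial ℕ) :
    (fun x => P.pathSum (b.eval x.length) (t.eval x.length) (init x)) ∈ GapP := by
  obtain ⟨m, D, hD⟩ := exists_decoder K
  choose T hT using fun i => (hP.weight i).length_le
  -- One width for all weights: the sum of the individual length bounds dominates each of them.
  let w : Polynomial ℕ := (∑ i, T i).comp b
  have hw : ∀ (x : Str) (i : I), (encodeNat (P.weight i
      (List.replicate (b.eval x.length) ()).length).natAbs).length ≤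
        (List.replicate (w.eval x.length) ()).length := by
    intro x i
    have h1 := hT i (List.replicate (b.eval x.length) ())
    have h2 : (T i).eval (b.eval x.length) ≤ ∑ j, (T j).eval (b.eval x.length) :=
      Finset.single_le_sum (f := fun j => (T j).eval (b.eval x.length)) (fun _ _ => Nat.zero_le _)
        (Finset.mem_univ i)
    simp only [length_code_list, encodeInt, List.length_cons, List.length_replicate] at h1
    simp only [w, Polynomial.eval_comp, Polynomial.eval_finsetSum, List.length_replicate]
    omega
  have key := fun x => P.bitSum_evalSign D m hD _ _ (hw x) (t.eval x.length) 1 (init x)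
  simp only [SignType.coe_one, one_mul, List.length_replicate] at key
  have hV : FP (fun a : Str × Str => encodeInt (P.evalSign ((P.evalStep D m)^[t.eval a.1.length]
      (Sym.mk 1, (init a.1, (a.2, (List.replicate (b.eval a.1.length) (),
        List.replicate (w.eval a.1.length) ()))))) : ℤ)) := by
    obtain ⟨C, hC⟩ := hP.growth
    have h := FP.iter (hP.evalStep D m) C (fun s => ?_) (FP.polyLength t (FP.fst (β := Str)))
      ((FP.const (Sym.mk 1)).pair ((hinit.comp FP.fst).pair (FP.snd.pair
        ((FP.polyLength b FP.fst).pair (FP.polyLength w FP.fst)))))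
    · simp only [List.length_replicate] at h
      exact FP.apply₂ (fun a c : SignType => encodeInt ((a * c : SignType) : ℤ)) (FP.fst.comp h)
        (hP.final.comp (FP.fst.comp (FP.snd.comp h)))
    · have h1 : (code ((D (s.2.2.1.take m)).elim s.2.1 fun k => P.step k s.2.1)).length ≤
          (code s.2.1).length + C := by
        cases D (s.2.2.1.take m) with
        | none => exact Nat.le_add_right _ _
        | some k => exact hC k _
      simp only [PathSystem.evalStep, length_code_prod, length_code_sym, length_code_list,
        List.length_drop]
      omega
  have := GapP.bitSum (V := fun x u => (P.evalSign ((P.evalStep D m)^[t.eval x.length]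
      (Sym.mk 1, (init x, (u, (List.replicate (b.eval x.length) (),
        List.replicate (w.eval x.length) ()))))) : ℤ)) hV
      (t * (Polynomial.C m + (w + w)))
  simpa only [Polynomial.eval_mul, Polynomial.eval_add, Polynomial.eval_C, key] using this

end PathSystem

/-! ### Acceptance probabilities of quantum Turing machines as sums over pairs of paths -/

namespace QTM

open Finset ComplexConjugate

variable {M : QTM}

/-- A written symbol, a new state, and a direction (`true` for right). -/
abbrev Move (M : QTM) : Type := M.Symbol × M.State × Bool

/-- The configuration after a move. -/
def Config.move (c : M.Config) (j : M.Move) : M.Config :=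
  c.next j.1 j.2.1 (bif j.2.2 then Dir.right else Dir.left)

/-- The amplitude of a move. -/
def Config.amp (c : M.Config) (j : M.Move) : ℂ :=
  M.δ c.state (c.tape c.head) j.1 j.2.1 (bif j.2.2 then Dir.right else Dir.left)

theorem evolve_single (c : M.Config) (z : ℂ) :
    M.evolve (Finsupp.single c z) = ∑ j, Finsupp.single (c.move j) (z * c.amp j) := by
  rw [evolve, Finsupp.linearCombination_single, Fintype.sum_prod_type, Finset.smul_sum]
  refine sum_congr rfl fun τ _ => ?_
  rw [Fintype.sum_prod_type, Finset.smul_sum]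
  refine sum_congr rfl fun q _ => ?_
  rw [Fintype.sum_bool, smul_add, Finsupp.smul_single, Finsupp.smul_single, add_comm]
  rfl

/-- The sesquilinear form with the matrix `v`. -/
noncomputable def form (v : M.Config → M.Config → ℂ) (ψ φ : M.Superposition) : ℂ :=
  ψ.sum fun c z => φ.sum fun c' z' => z * conj z' * v c c'

theorem form_add_left (v : M.Config → M.Config → ℂ) (ψ ψ' φ : M.Superposition) :
    form v (ψ + ψ') φ = form v ψ φ + form v ψ' φ := by
  unfold form
  rw [Finsupp.sum_add_index']
  · simp
  · intro c z z'
    rw [← Finsupp.sum_add]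
    simp only [add_mul]

theorem form_add_right (v : M.Config → M.Config → ℂ) (ψ φ φ' : M.Superposition) :
    form v ψ (φ + φ') = form v ψ φ + form v ψ φ' := by
  unfold form
  rw [← Finsupp.sum_add]
  refine Finsupp.sum_congr fun c _ => ?_
  rw [Finsupp.sum_add_index']
  · simp
  · intro c z z'
    rw [map_add]
    ring

theorem form_zero_left (v : M.Config → M.Config → ℂ) (φ : M.Superposition) : form v 0 φ = 0 :=
  Finsupp.sum_zero_index

theorem form_zero_right (v : M.Config → M.Config → ℂ) (ψ : M.Superposition) : form v ψ 0 = 0 := by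
  simp [form]

theorem form_single (v : M.Config → M.Config → ℂ) (c c' : M.Config) (z z' : ℂ) :
    form v (Finsupp.single c z) (Finsupp.single c' z') = z * conj z' * v c c' := by
  simp [form]

theorem form_sum_left {ι : Type} (v : M.Config → M.Config → ℂ) (s : Finset ι)
    (ψ : ι → M.Superposition) (φ : M.Superposition) :
    form v (∑ i ∈ s, ψ i) φ = ∑ i ∈ s, form v (ψ i) φ :=
  map_sum (⟨⟨fun ψ => form v ψ φ, form_zero_left v φ⟩, fun a b => form_add_left v a b φ⟩ :
    M.Superposition →+ ℂ) ψ s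

theorem form_sum_right {ι : Type} (v : M.Config → M.Config → ℂ) (s : Finset ι)
    (ψ : M.Superposition) (φ : ι → M.Superposition) :
    form v ψ (∑ i ∈ s, φ i) = ∑ i ∈ s, form v ψ (φ i) :=
  map_sum (⟨⟨fun φ => form v ψ φ, form_zero_right v ψ⟩, fun a b => form_add_right v ψ a b⟩ :
    M.Superposition →+ ℂ) φ s

/-- By additivity in both arguments it suffices to check basis vectors. -/
theorem form_map (v v' : M.Config → M.Config → ℂ) (f : M.Superposition →+ M.Superposition)
    (h : ∀ c c' z z', form v (f (Finsupp.single c z)) (f (Finsupp.single c' z')) =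
      z * conj z' * v' c c') (ψ φ : M.Superposition) : form v (f ψ) (f φ) = form v' ψ φ := by
  induction ψ using Finsupp.induction_linear with
  | zero => rw [map_zero, form_zero_left, form_zero_left]
  | add ψ ψ' h₁ h₂ => rw [map_add, form_add_left, form_add_left, h₁, h₂]
  | single c z =>
    induction φ using Finsupp.induction_linear with
    | zero => rw [map_zero, form_zero_right, form_zero_right]
    | add φ φ' h₁ h₂ => rw [map_add, form_add_right, form_add_right, h₁, h₂]
    | single c' z' => rw [h, form_single]

/-- The Heisenberg picture: instead of evolving the state, the evolution is transferred to the
matrix, where it becomes a sum over pairs of moves. -/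
theorem form_evolve (v : M.Config → M.Config → ℂ) (ψ φ : M.Superposition) :
    form v (M.evolve ψ) (M.evolve φ) = form (fun c c' => ∑ j, ∑ j', c.amp j * conj (c'.amp j') *
      v (c.move j) (c'.move j')) ψ φ := by
  refine form_map v _ M.evolve.toAddMonoidHom (fun c c' z z' => ?_) ψ φ
  change form v (M.evolve _) (M.evolve _) = _
  rw [evolve_single, evolve_single, form_sum_left, mul_sum]
  refine sum_congr rfl fun j _ => ?_
  rw [form_sum_right, mul_sum]
  refine sum_congr rfl fun j' _ => ?_
  rw [form_single, map_mul]
  ring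

open Classical in
theorem form_project (v : M.Config → M.Config → ℂ) (a : Bool ⊕ M.Outcome)
    (ψ φ : M.Superposition) : form v (project ψ a) (project φ a) =
      form (fun c c' => if c.obs = a ∧ c'.obs = a then v c c' else 0) ψ φ := by
  refine form_map v _ (⟨⟨fun ψ => project ψ a, Finsupp.filter_zero _⟩,
    fun _ _ => Finsupp.filter_add⟩ : M.Superposition →+ M.Superposition)
    (fun c c' z z' => ?_) ψ φ
  change form v (project _ a) (project _ a) = _
  unfold project
  by_cases h : c.obs = a
  · by_cases h' : c'.obs = a
    · rw [Finsupp.filter_single_of_pos (fun c : M.Config => c.obs = a) h,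
        Finsupp.filter_single_of_pos (fun c : M.Config => c.obs = a) h', form_single,
        if_pos ⟨h, h'⟩]
    · rw [Finsupp.filter_single_of_neg (fun c : M.Config => c.obs = a) h', form_zero_right,
        if_neg fun k => h' k.2, mul_zero]
  · rw [Finsupp.filter_single_of_neg (fun c : M.Config => c.obs = a) h, form_zero_left,
      if_neg fun k => h k.1, mul_zero]

theorem form_fun_add (v v' : M.Config → M.Config → ℂ) (ψ φ : M.Superposition) :
    form (fun c c' => v c c' + v' c c') ψ φ = form v ψ φ + form v' ψ φ := by
  simp only [form, mul_add, Finsupp.sum_add]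

theorem form_fun_sum {ι : Type} (s : Finset ι) (v : ι → M.Config → M.Config → ℂ)
    (ψ φ : M.Superposition) :
    form (fun c c' => ∑ i ∈ s, v i c c') ψ φ = ∑ i ∈ s, form (v i) ψ φ := by
  classical
  induction s using Finset.induction_on with
  | empty => simp [form]
  | insert i s hi ih => simp only [sum_insert hi, form_fun_add, ih]

open Classical in
theorem normSq_eq_form (ψ : M.Superposition) :
    (normSq ψ : ℂ) = form (fun c c' => if c = c' then 1 else 0) ψ ψ := by
  unfold normSq form Finsupp.sum
  push_cast
  refine sum_congr rfl fun c hc => ?_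
  simp only [mul_ite, mul_one, mul_zero, sum_ite_eq, hc, if_true]
  rw [Complex.mul_conj, Complex.normSq_eq_norm_sq]
  push_cast
  rfl

open Classical in
/-- The contribution to the probability of acceptance within `k` steps of the pairs of paths
starting from `c` and `c'`, for the amplitudes `a`. -/
noncomputable def pairValue (a : M.Config → M.Move → ℂ) : ℕ → M.Config → M.Config → ℂ
  | 0, c, c' => if c = c' ∧ c.obs = Sum.inl true then 1 else 0
  | k + 1, c, c' => if c.obs = c'.obs then
      (if c.obs.isLeft then pairValue a k c c' else
        ∑ j, ∑ j', a c j * conj (a c' j') * pairValue a k (c.move j) (c'.move j'))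
      else 0

-- Once both paths have halted with the same answer their contribution is frozen, and the remaining
-- steps are idle.
open Classical in
theorem pairValue_inl (a : M.Config → M.Move → ℂ) (k : ℕ) {c c' : M.Config} {b : Bool}
    (h : c.obs = Sum.inl b) (h' : c'.obs = Sum.inl b) :
    pairValue a k c c' = if c = c' ∧ c.obs = Sum.inl true then 1 else 0 := by
  induction k with
  | zero => rfl
  | succ k ih => rw [pairValue, if_pos (h.trans h'.symm), if_pos (by rw [h]; rfl), ih]

theorem form_pairValue_zero (a : M.Config → M.Move → ℂ) (ψ : M.Superposition) :
    form (pairValue a 0) ψ ψ = normSq (project ψ (Sum.inl true)) := by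
  classical
  rw [normSq_eq_form, form_project]
  congr 1
  funext c c'
  by_cases h : c = c'
  · subst h; simp [pairValue]
  · simp [pairValue, h]

/-- Measurement makes paths with different outcomes incoherent, so pairs split by their common
outcome: accepting pairs give a probability now, rejecting ones nothing, and those going on with
outcome `o` are evolved. -/
theorem form_pairValue_succ (k : ℕ) (ψ : M.Superposition) :
    form (pairValue Config.amp (k + 1)) ψ ψ = normSq (project ψ (Sum.inl true)) +
      ∑ o : M.Outcome, form (pairValue Config.amp k) (M.evolve (project ψ (Sum.inr o)))
        (M.evolve (project ψ (Sum.inr o))) := by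
  classical
  simp only [form_evolve, form_project]
  rw [← form_fun_sum, normSq_eq_form, form_project, ← form_fun_add]
  congr 1
  funext c c'
  by_cases h : c.obs = c'.obs
  · cases hc : c.obs with
    | inl b =>
      rw [pairValue_inl _ _ hc (h ▸ hc)]
      by_cases e : c = c'
      · subst e; simp [hc]
      · simp [e, hc]
    | inr o =>
      rw [pairValue, if_pos h, if_neg (by simp [hc])]
      simp [hc, ← h]
  · rw [pairValue, if_neg h, if_neg, zero_add, sum_eq_zero]
    · intro o _
      rw [if_neg fun k => h (k.1.trans k.2.symm)]
    · exact fun k => h (k.1.trans k.2.symm)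

theorem sum_ofFn_succ {A M : Type} [Fintype A] [AddCommMonoid M] (s : ℕ) (F : List A → M) :
    ∑ h : Fin (s + 1) → A, F (List.ofFn h) =
      ∑ h : Fin s → A, ∑ o, F (o :: List.ofFn h) := by
  rw [← (Fin.consEquiv fun _ : Fin (s + 1) => A).sum_comp, Fintype.sum_prod_type, sum_comm]
  simp [Fin.consEquiv, List.ofFn_succ]

/-- After `s` steps, `k` further steps collect the probabilities of accepting at the times `s, …, s
+ k`. The induction on `k` unfolds the first step, which lengthens the history of outcomes by one.
-/
theorem sum_form_pairValue (M : QTM) (x : Str) (k s : ℕ) :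
    ∑ h : Fin s → M.Outcome, form (pairValue Config.amp k) (M.run x (List.ofFn h))
      (M.run x (List.ofFn h)) = ∑ i ∈ range (k + 1), ∑ h : Fin (s + i) → M.Outcome,
        (normSq (project (M.run x (List.ofFn h)) (Sum.inl true)) : ℂ) := by
  induction k generalizing s with
  | zero => simp [form_pairValue_zero]
  | succ k ih =>
    simp only [form_pairValue_succ, sum_add_distrib]
    rw [sum_range_succ' _ (k + 1), add_comm, Nat.add_zero]
    congr 1
    have h := ih (s + 1)
    rw [sum_ofFn_succ s fun l => form (pairValue Config.amp k) (M.run x l) (M.run x l)] at h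
    refine h.trans (sum_congr rfl fun i _ => ?_)
    rw [Nat.add_right_comm, Nat.add_assoc]

theorem answerProb_true (M : QTM) (x : Str) (t : ℕ) : (M.answerProb x t true : ℂ) =
    pairValue Config.amp t (M.initConfig x) (M.initConfig x) := by
  have h := sum_form_pairValue M x t 0
  rw [Fintype.sum_unique] at h
  simp only [List.ofFn_zero, run, form_single, map_one, one_mul] at h
  rw [h, answerProb]
  push_cast
  exact sum_congr rfl fun i _ => by rw [Nat.zero_add]

/-! ### Conservation of probability -/

theorem normSq_nonneg (ψ : M.Superposition) : 0 ≤ normSq ψ :=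
  Finset.sum_nonneg fun _ _ => by positivity

theorem answerProb_nonneg (M : QTM) (x : Str) (t : ℕ) (b : Bool) : 0 ≤ M.answerProb x t b :=
  Finset.sum_nonneg fun _ _ => Finset.sum_nonneg fun _ _ => normSq_nonneg _

theorem sum_normSq_project (ψ : M.Superposition) :
    ∑ a, normSq (project ψ a) = normSq ψ := by
  classical
  have h : ∀ a, normSq (project ψ a) = ∑ c ∈ ψ.support, if c.obs = a then ‖ψ c‖ ^ 2 else 0 := by
    intro a
    rw [← sum_filter]
    unfold normSq project Finsupp.sum
    rw [Finsupp.support_filter]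
    refine sum_congr rfl fun c hc => ?_
    rw [Finsupp.filter_apply_pos (fun c : M.Config => c.obs = a) _ (mem_filter.1 hc).2]
  simp only [h]
  rw [sum_comm]
  simp [normSq, Finsupp.sum]

theorem answerProb_add_le_one (hM : M.WellFormed) (x : Str) (t : ℕ) :
    M.answerProb x t true + M.answerProb x t false ≤ 1 := by
  let N : ℕ → ℝ := fun s => ∑ h : Fin s → M.Outcome, normSq (M.run x (List.ofFn h))
  let A : ℕ → Bool → ℝ := fun s b =>
    ∑ h : Fin s → M.Outcome, normSq (project (M.run x (List.ofFn h)) (Sum.inl b))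
  -- `N s` is the probability of not having halted before time `s`. It splits into halting now with
  -- either answer and going on, and evolution preserves the norm of the part that goes on.
  have hN : ∀ s, N s = A s true + A s false + N (s + 1) := by
    intro s
    simp only [N, A]
    rw [sum_ofFn_succ s fun l => normSq (M.run x l), ← sum_add_distrib, ← sum_add_distrib]
    refine sum_congr rfl fun h _ => ?_
    rw [← sum_normSq_project, Fintype.sum_sum_type, Fintype.sum_bool]
    simp only [run]
    simp only [hM _]
  have hsum : ∀ n, ∑ s ∈ range n, (A s true + A s false) + N n = N 0 := by
    intro n
    induction n with
    | zero => simp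
    | succ n ih => rw [sum_range_succ, add_assoc, ← hN, ih]
  have h0 : N 0 = 1 := by
    simp [N, run, normSq]
  have h1 : 0 ≤ N (t + 1) := sum_nonneg fun _ _ => normSq_nonneg _
  have h2 := hsum (t + 1)
  rw [sum_add_distrib, h0] at h2
  unfold answerProb
  linarith

end QTM

/-! ### Equality of lists -/

/-- One step of the comparison of two lists. -/
def eqStep {A : Type} [DecidableEq A] (s : Sym Bool × (List A × List A)) :
    Sym Bool × (List A × List A) :=
  (Sym.mk (s.1.val && decide (s.2.1.head? = s.2.2.head?)), (s.2.1.tail, s.2.2.tail))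

/-- After as many rounds as `l` is long, a shorter `l'` has already shown a mismatch of heads; a
longer one is detected by its nonempty remainder. -/
theorem eqStep_iterate {A : Type} [DecidableEq A] (l l' : List A) (f : Bool) :
    ((eqStep^[l.length] (Sym.mk f, (l, l'))).1.val &&
      (eqStep^[l.length] (Sym.mk f, (l, l'))).2.2.head?.isNone) =
        (f && decide (l = l')) := by
  induction l generalizing f l' with
  | nil => cases l' <;> simp
  | cons a l ih =>
    simp only [List.length_cons, Function.iterate_succ_apply, eqStep, List.tail_cons]
    rw [ih]
    cases l' with
    | nil => simp
    | cons b l' =>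
      rw [Bool.eq_iff_iff]
      simp only [List.head?_cons, Option.some.injEq, List.tail_cons, List.cons.injEq,
        Bool.and_eq_true, decide_eq_true_iff, and_assoc]
      exact and_congr_right fun _ => and_congr_right fun _ => decide_eq_true_iff

theorem FP.listEq {α A : Type} [Coded α] [Fintype A] [DecidableEq A] {l l' : α → List A}
    (hl : FP l) (hl' : FP l') : FP (fun a => Sym.mk (decide (l a = l' a))) := by
  have h := FP.iter (step := eqStep (A := A)) ?_ 0 (fun s => ?_) (FP.map (fun _ => ()) hl)
    ((FP.const (Sym.mk true)).pair (hl.pair hl'))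
  · have h2 := FP.apply₂ (fun (b : Bool) (o : Option A) => Sym.mk (b && o.isNone))
      (FP.fst.comp h) (FP.head (FP.snd.comp (FP.snd.comp h)))
    simpa only [List.length_map, eqStep_iterate, Bool.true_and] using h2
  · have h1 : FP (fun s : Sym Bool × (List A × List A) => s.2.1) := FP.fst.comp FP.snd
    have h2 : FP (fun s : Sym Bool × (List A × List A) => s.2.2) := FP.snd.comp FP.snd
    exact (FP.apply₃ (fun (b : Bool) (o o' : Option A) => Sym.mk (b && decide (o = o'))) FP.fst
      (FP.head h1) (FP.head h2)).pair ((FP.tail h1).pair (FP.tail h2))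
  · simp only [length_code_prod, eqStep, length_code_sym, length_code_list, List.length_tail]
    omega

namespace QTM

open Finset ComplexConjugate

/-! ### Approximation of the amplitudes -/

section Approximation

variable {M : QTM} {a a' : M.Config → M.Move → ℂ} {A η : ℝ}

theorem one_le_card_move (M : QTM) : (1 : ℝ) ≤ Fintype.card M.Move := by
  have : 0 < Fintype.card M.Move := Fintype.card_pos_iff.2 ⟨(M.blank, M.start, true)⟩
  exact_mod_cast this

theorem norm_sum_sum_le {F : M.Move → M.Move → ℂ} {r : ℝ} (h : ∀ j j', ‖F j j'‖ ≤ r) :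
    ‖∑ j, ∑ j', F j j'‖ ≤ (Fintype.card M.Move) ^ 2 * r := by
  refine (norm_sum_le _ _).trans ((sum_le_sum fun j _ => (norm_sum_le _ _).trans
    (sum_le_sum fun j' _ => h j j')).trans_eq ?_)
  simp only [sum_const, card_univ, nsmul_eq_mul]
  ring

theorem norm_pairValue_le (hA : 1 ≤ A) (ha : ∀ c j, ‖a c j‖ ≤ A) (k : ℕ) (c c' : M.Config) :
    ‖pairValue a k c c'‖ ≤ (2 * (Fintype.card M.Move) ^ 2 * A ^ 2) ^ k := by
  have hN := one_le_card_move M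
  set N : ℝ := (Fintype.card M.Move : ℝ)
  have hC : 1 ≤ 2 * N ^ 2 * A ^ 2 := by
    have := one_le_pow₀ hN (n := 2)
    have := one_le_pow₀ hA (n := 2)
    nlinarith
  have hC0 : 0 ≤ 2 * N ^ 2 * A ^ 2 := by linarith
  induction k generalizing c c' with
  | zero => rw [pairValue]; split_ifs <;> simp
  | succ k ih =>
    rw [pairValue]
    split_ifs
    · exact (ih c c').trans (pow_le_pow_right₀ hC (Nat.le_succ k))
    · have : ∀ j j', ‖a c j * conj (a c' j') * pairValue a k (c.move j) (c'.move j')‖ ≤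
          A * A * (2 * N ^ 2 * A ^ 2) ^ k := by
        intro j j'
        rw [norm_mul, norm_mul, RCLike.norm_conj]
        have h1 := ha c j
        have h2 := ha c' j'
        have h3 := ih (c.move j) (c'.move j')
        gcongr
      refine (norm_sum_sum_le this).trans ?_
      change N ^ 2 * _ ≤ _
      rw [pow_succ (2 * N ^ 2 * A ^ 2) k]
      have h : 0 ≤ (2 * N ^ 2 * A ^ 2) ^ k * (N ^ 2 * A ^ 2) := by positivity
      linarith
    · rw [norm_zero]; positivity

/-- The error per step obeys a linear recursion, so it grows geometrically. The factors `2` in the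
base are slack: one absorbs the two errors of the amplitudes, the other the sum of the new and the
inherited error. -/
theorem norm_pairValue_sub_le (hA : 1 ≤ A) (ha : ∀ c j, ‖a c j‖ ≤ A) (ha' : ∀ c j, ‖a' c j‖ ≤ A)
    (hη : ∀ c j, ‖a c j - a' c j‖ ≤ η) (k : ℕ) (c c' : M.Config) :
    ‖pairValue a k c c' - pairValue a' k c c'‖ ≤
      η * (2 * (2 * (Fintype.card M.Move) ^ 2 * A ^ 2)) ^ k := by
  have hη0 : 0 ≤ η := (norm_nonneg _).trans (hη c (M.blank, M.start, true))
  have hN := one_le_card_move M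
  have hval := norm_pairValue_le hA ha
  set N : ℝ := (Fintype.card M.Move : ℝ)
  set C : ℝ := 2 * N ^ 2 * A ^ 2 with hC_def
  have hC : 1 ≤ C := by
    have := one_le_pow₀ hN (n := 2)
    have := one_le_pow₀ hA (n := 2)
    nlinarith
  have hC2 : 0 ≤ η * (2 * C) ^ k := by positivity
  induction k generalizing c c' with
  | zero => simpa [pairValue] using hη0
  | succ k ih =>
    rw [pairValue, pairValue]
    split_ifs
    · refine (ih c c' (by positivity)).trans ?_
      gcongr
      · linarith
      · exact Nat.le_succ k
    · simp only [← sum_sub_distrib]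
      have hterm : ∀ j j', ‖a c j * conj (a c' j') * pairValue a k (c.move j) (c'.move j') -
          a' c j * conj (a' c' j') * pairValue a' k (c.move j) (c'.move j')‖ ≤
          η * A * C ^ k + A * η * C ^ k + A * A * (η * (2 * C) ^ k) := by
        intro j j'
        -- Telescoping of a product of three factors. The first two terms use the size bound on
        -- `pairValue`, the third the induction hypothesis.
        have e : a c j * conj (a c' j') * pairValue a k (c.move j) (c'.move j') -
            a' c j * conj (a' c' j') * pairValue a' k (c.move j) (c'.move j') =
            (a c j - a' c j) * conj (a c' j') * pairValue a k (c.move j) (c'.move j') +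
            a' c j * conj (a c' j' - a' c' j') * pairValue a k (c.move j) (c'.move j') +
            a' c j * conj (a' c' j') * (pairValue a k (c.move j) (c'.move j') -
              pairValue a' k (c.move j) (c'.move j')) := by
          rw [map_sub]; ring
        rw [e]
        refine (norm_add₃_le).trans ?_
        simp only [norm_mul, RCLike.norm_conj]
        have h1 := ha c' j'
        have h2 := ha' c j
        have h3 := ha' c' j'
        have h4 := hη c j
        have h5 := hη c' j'
        have h6 := hval k (c.move j) (c'.move j')
        have h7 := ih (c.move j) (c'.move j') (by positivity)
        gcongr
      refine (norm_sum_sum_le hterm).trans ?_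
      have h1 : C ^ k ≤ (2 * C) ^ k := by
        gcongr
        linarith
      have h2 : N ^ 2 * (2 * A) ≤ C := by
        rw [hC_def]
        have : A ≤ A ^ 2 := by nlinarith
        have := mul_le_mul_of_nonneg_left this (by positivity : 0 ≤ 2 * N ^ 2)
        linarith
      have h3 : N ^ 2 * (A * A) ≤ C := by
        rw [hC_def]
        have : 0 ≤ N ^ 2 * A ^ 2 := by positivity
        linarith
      calc N ^ 2 * (η * A * C ^ k + A * η * C ^ k + A * A * (η * (2 * C) ^ k))
          = N ^ 2 * (2 * A) * (η * C ^ k) + N ^ 2 * (A * A) * (η * (2 * C) ^ k) := by ring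
        _ ≤ C * (η * (2 * C) ^ k) + C * (η * (2 * C) ^ k) := by gcongr
        _ = η * (2 * C) ^ (k + 1) := by ring
    · simpa using hC2

end Approximation

/-! ### Encoded configurations -/

/-- The control state, the symbols to the left of the head (the nearest first), and those from the
head to the right, in a window of the tape. -/
abbrev Window (M : QTM) : Type := Sym M.State × (List M.Symbol × List M.Symbol)

variable {M : QTM}

/-- The control state and the scanned symbol. -/
def Window.scan (z : M.Window) : M.State × M.Symbol := (z.1.val, z.2.2.head?.getD M.blank)

/-- The effect of a move on a window. -/
def Window.move (j : M.Move) (z : M.Window) : M.Window :=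
  (Sym.mk j.2.1, bif j.2.2 then (j.1 :: z.2.1, z.2.2.tail)
    else (z.2.1.tail, z.2.1.head?.getD M.blank :: j.1 :: z.2.2.tail))

/-- The window, which begins at the cell `-W`, contains all symbols of the configuration that are
not blank. -/
structure Window.Represents (W : ℕ) (z : M.Window) (c : M.Config) : Prop where
  state : c.state = z.1.val
  head : c.head = z.2.1.length - W
  left : ∀ i : ℕ, c.tape (c.head - 1 - i) = z.2.1.getD i M.blank
  right : ∀ i : ℕ, c.tape (c.head + i) = z.2.2.getD i M.blank

namespace Window

variable {W : ℕ} {z z' : M.Window} {c c' : M.Config}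

theorem Represents.scan (h : Represents W z c) : scan z = (c.state, c.tape c.head) := by
  have h0 := h.right 0
  rw [Nat.cast_zero, add_zero] at h0
  rw [Window.scan, h.state, h0]
  cases z.2.2 <;> rfl

/-- A left move needs a symbol to the left of the head, because the head position is read off from
the length of that list. On the right nothing is required, since cells beyond the window are blank.
-/
theorem Represents.move (h : Represents W z c) (hl : 1 ≤ z.2.1.length) (j : M.Move) :
    Represents W (Window.move j z) (c.move j) := by
  obtain ⟨τ, q, d⟩ := j
  obtain ⟨⟨p⟩, l, r⟩ := z
  cases d with
  | true =>
    refine ⟨rfl, ?_, fun i => ?_, fun i => ?_⟩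
    · have := h.head
      simp only [Config.move, Config.next, Window.move, cond_true, List.length_cons] at this ⊢
      push_cast
      omega
    · simp only [Config.move, Config.next, Window.move, cond_true]
      cases i with
      | zero => simp
      | succ i =>
        rw [Function.update_of_ne (by push_cast; omega), List.getD_cons_succ, ← h.left i]
        congr 1
        push_cast
        ring
    · simp only [Config.move, Config.next, Window.move, cond_true]
      rw [Function.update_of_ne (by omega)]
      have h1 := h.right (i + 1)
      have h2 : c.head + 1 + i = c.head + ((i + 1 : ℕ) : ℤ) := by push_cast; ring
      rw [h2, h1]
      cases r <;> simp
  | false =>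
    obtain _ | ⟨b, l⟩ := l
    · simp at hl
    refine ⟨rfl, ?_, fun i => ?_, fun i => ?_⟩
    · have := h.head
      simp only [Config.move, Config.next, Window.move, cond_false, List.length_cons,
        List.tail_cons] at this ⊢
      push_cast at this
      omega
    · simp only [Config.move, Config.next, Window.move, cond_false, List.tail_cons]
      rw [Function.update_of_ne (by omega)]
      have h1 := h.left (i + 1)
      have h2 : c.head - 1 - 1 - i = c.head - 1 - ((i + 1 : ℕ) : ℤ) := by push_cast; ring
      rw [h2, h1]
      simp
    · simp only [Config.move, Config.next, Window.move, cond_false, List.head?_cons,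
        Option.getD_some]
      match i with
      | 0 =>
        have h1 := h.left 0
        rw [Function.update_of_ne (by omega)]
        simpa using h1
      | 1 => simp
      | i + 2 =>
        rw [Function.update_of_ne (by push_cast; omega)]
        have h1 := h.right (i + 1)
        have h2 : c.head - 1 + ((i + 2 : ℕ) : ℤ) = c.head + ((i + 1 : ℕ) : ℤ) := by push_cast; ring
        rw [h2, h1]
        cases r <;> simp

theorem list_eq_of_getD {A : Type} {l l' : List A} {d : A} (hl : l.length = l'.length)
    (h : ∀ i, l.getD i d = l'.getD i d) : l = l' := by
  refine List.ext_getElem hl fun i h₁ h₂ => ?_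
  have := h i
  rwa [List.getD_eq_getElem _ _ h₁, List.getD_eq_getElem _ _ h₂] at this

/-- Windows may end in superfluous blanks, so only windows with the same origin and the same total
length can be compared literally. This makes equality of configurations decidable on the coded data.
-/
theorem Represents.eq_iff (h : Represents W z c) (h' : Represents W z' c')
    (hlen : z.2.1.length + z.2.2.length = z'.2.1.length + z'.2.2.length) :
    c = c' ↔ z = z' := by
  constructor
  · rintro rfl
    have h1 := h.head.symm.trans h'.head
    refine Prod.ext (Sym.ext (h.state.symm.trans h'.state)) (Prod.ext ?_ ?_)
    · exact list_eq_of_getD (by omega) fun i => (h.left i).symm.trans (h'.left i)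
    · exact list_eq_of_getD (by omega) fun i => (h.right i).symm.trans (h'.right i)
  · rintro rfl
    have h1 := h.head.trans h'.head.symm
    refine Config.ext (h.state.trans h'.state.symm) h1 (funext fun i => ?_)
    rcases le_or_gt c.head i with hi | hi
    · obtain ⟨n, rfl⟩ := Int.le.dest hi
      rw [h.right n, h1, h'.right n]
    · obtain ⟨n, hn⟩ := Int.le.dest (show i ≤ c.head - 1 by omega)
      have : i = c.head - 1 - n := by omega
      rw [this, h.left n, h1, h'.left n]

/-- The window around the input. -/
def init (M : QTM) (W : ℕ) (x : Str) : M.Window :=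
  (Sym.mk M.start, (List.replicate W M.blank, x.map M.bit ++ List.replicate W M.blank))

theorem represents_init (M : QTM) (W : ℕ) (x : Str) :
    Represents W (init M W x) (M.initConfig x) := by
  refine ⟨rfl, by simp [init, initConfig], fun i => ?_, fun i => ?_⟩
  · have : ¬ (0 : ℤ) ≤ 0 - 1 - i := by omega
    simp only [initConfig, init, if_neg this]
    by_cases h : i < W <;> simp [h]
  · simp only [initConfig, init, zero_add, Int.natCast_nonneg, if_true, Int.toNat_natCast]
    rw [List.getD_eq_getElem?_getD]
    by_cases h : i < x.length
    · rw [List.getElem?_append_left (by simpa using h)]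
      simp [h]
    · rw [List.getElem?_append_right (by simpa using h)]
      rw [List.getElem?_eq_none (not_lt.1 h), List.getElem?_replicate]
      split_ifs <;> simp

theorem FP.scan {α : Type} [Coded α] {z : α → M.Window} (hz : FP z) :
    FP fun a => Sym.mk (scan (z a)) :=
  FP.apply₂ (fun q (o : Option M.Symbol) => Sym.mk (q, o.getD M.blank)) (FP.fst.comp hz)
    (FP.head (FP.snd.comp (FP.snd.comp hz)))

theorem FP.move (j : M.Move) : FP (Window.move (M := M) j) := by
  obtain ⟨τ, q, d⟩ := j
  have hl : FP (fun z : M.Window => z.2.1) := FP.fst.comp FP.snd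
  have hr : FP (fun z : M.Window => z.2.2) := FP.snd.comp FP.snd
  refine (FP.const _).pair ?_
  cases d with
  | true => exact (FP.cons (FP.const (Sym.mk τ)) hl).pair (FP.tail hr)
  | false =>
    exact (FP.tail hl).pair (FP.cons (FP.apply₁ (fun o : Option M.Symbol =>
      Sym.mk (o.getD M.blank)) (FP.head hl)) (FP.cons (FP.const (Sym.mk τ)) (FP.tail hr)))

theorem FP.init {t : Polynomial ℕ} : FP fun x : Str => init M (t.eval x.length) x := by
  have h := FP.map (fun _ => M.blank) (FP.polyLength t (FP.id (α := Str)))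
  simp only [List.map_replicate] at h
  exact (FP.const _).pair (h.pair (FP.append (FP.map _ FP.id) h))

end Window

end QTM

namespace QTM

open Finset ComplexConjugate

/-! ### The path system of a quantum Turing machine -/

/-- Pairs of windows, and a power of the imaginary unit. -/
abbrev PairState (M : QTM) : Type := (M.Window × M.Window) × Sym (Fin 4)

/-- The real part of a power of the imaginary unit. -/
def phaseSign : Fin 4 → SignType := ![1, 0, -1, 0]

variable {M : QTM}

/-- The exponent may be kept modulo four, hence in a finite control. -/
theorem I_pow_add (p q : Fin 4) :
    Complex.I ^ (p + q).val = Complex.I ^ p.val * Complex.I ^ q.val := by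
  rw [Fin.val_add, ← Complex.I_pow_eq_pow_mod, pow_add]

open Classical in
/-- The index of the weights of a pair of moves; a pair of halted paths idles. -/
noncomputable def pairIndex (k : Option ((M.Move × Bool) × (M.Move × Bool)))
    (s s' : M.State × M.Symbol) :
    Option (Option ((M.State × M.Symbol) × (M.Move × Bool)) ×
      Option ((M.State × M.Symbol) × (M.Move × Bool))) :=
  if M.obs s.1 s.2 = M.obs s'.1 s'.2 then
    k.elim (bif (M.obs s.1 s.2).isLeft then some (none, none) else none) fun j =>
      bif (M.obs s.1 s.2).isLeft then none else some (some (s, j.1), some (s', j.2))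
  else none

open Classical in
/-- The system of pairs of paths, for amplitudes whose real parts (`true`) and imaginary parts
(`false`) are given by `V`, multiplied by `2 ^ b` for the precision `b`. -/
noncomputable def pairSystem (M : QTM) (V : M.State × M.Symbol → M.Move × Bool → ℕ → ℤ) :
    PathSystem (Option ((M.Move × Bool) × (M.Move × Bool)))
      (Option ((M.State × M.Symbol) × (M.Move × Bool))) M.PairState where
  step k s := k.elim s fun j => ((s.1.1.move j.1.1, s.1.2.move j.2.1),
    Sym.mk (s.2.val + ((bif j.1.2 then 0 else 1) + bif j.2.2 then 0 else 3)))
  index k s := pairIndex k s.1.1.scan s.1.2.scan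
  weight i b := i.elim (2 ^ b) fun i => V i.1 i.2 b
  final s := bif decide (s.1.1.2.1 = s.1.2.2.1) && decide (s.1.1.2.2 = s.1.2.2.2) then
    (if s.1.1.scan.1 = s.1.2.scan.1 ∧ M.obs s.1.1.scan.1 s.1.1.scan.2 = Sum.inl true then
      phaseSign s.2.val else 0) else 0

/-- The amplitudes given by `V` for the precision `b`. -/
noncomputable def approxAmp (V : M.State × M.Symbol → M.Move × Bool → ℕ → ℤ) (b : ℕ)
    (c : M.Config) (j : M.Move) : ℂ :=
  (V (c.state, c.tape c.head) (j, true) b + V (c.state, c.tape c.head) (j, false) b * Complex.I) /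
    2 ^ b

theorem sum_pairs {A B : Type} [Fintype A] [Fintype B] (F : (A × B) × (A × B) → ℝ) :
    ∑ x, F x = ∑ a, ∑ a', ∑ b, ∑ b', F ((a, b), (a', b')) := by
  simp only [Fintype.sum_prod_type]
  exact Finset.sum_congr rfl fun a _ => Finset.sum_comm

theorem pairSystem_efficient {V : M.State × M.Symbol → M.Move × Bool → ℕ → ℤ}
    (hV : ∀ s j, FP fun l : List Unit => encodeInt (V s j l.length)) :
    (pairSystem M V).Efficient := by
  classical
  have h1 : FP (fun s : M.PairState => s.1.1) := FP.fst.comp FP.fst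
  have h2 : FP (fun s : M.PairState => s.1.2) := FP.snd.comp FP.fst
  refine ⟨fun k => ?_, ⟨4, fun k s => ?_⟩, fun k => ?_, fun i => ?_, ?_⟩
  · cases k with
    | none => exact FP.id
    | some j =>
      exact (((Window.FP.move _).comp h1).pair ((Window.FP.move _).comp h2)).pair
        (FP.apply₁ (fun p : Fin 4 =>
          Sym.mk (p + ((bif j.1.2 then 0 else 1) + bif j.2.2 then 0 else 3))) FP.snd)
  · cases k with
    | none => exact Nat.le_add_right _ _
    | some j =>
      have hm : ∀ (i : M.Move) (z : M.Window),
          (z.move i).2.1.length + (z.move i).2.2.length ≤ z.2.1.length + z.2.2.length + 2 := by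
        rintro ⟨τ, q, d⟩ z
        cases d <;> simp only [Window.move, cond_true, cond_false, List.length_cons,
          List.length_tail] <;> omega
      have := hm j.1.1 s.1.1
      have := hm j.2.1 s.1.2
      simp only [pairSystem, Option.elim_some, length_code_prod, length_code_sym,
        length_code_list]
      omega
  · exact FP.apply₂ (fun s s' => Sym.mk (pairIndex k s s')) (Window.FP.scan h1)
      (Window.FP.scan h2)
  · cases i with
    | none =>
      have h := FP.cons (FP.const (Sym.mk false)) (FP.append
        (FP.map (fun _ : Unit => false) FP.id) (FP.const [true]))
      refine h.of_code_eq fun l => ?_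
      have : ¬ (2 : ℤ) ^ l.length < 0 := not_lt.2 (by positivity)
      simp [pairSystem, encodeInt, Int.natAbs_pow, encodeNat_two_pow, this]
    | some i => exact hV i.1 i.2
  · have hl := FP.listEq (FP.fst.comp (FP.snd.comp h1)) (FP.fst.comp (FP.snd.comp h2))
    have hr := FP.listEq (FP.snd.comp (FP.snd.comp h1)) (FP.snd.comp (FP.snd.comp h2))
    exact FP.apply₃ (fun (e : Bool × Bool) (s : (M.State × M.Symbol) × (M.State × M.Symbol))
      (p : Fin 4) => Sym.mk (bif e.1 && e.2 then (if s.1.1 = s.2.1 ∧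
        M.obs s.1.1 s.1.2 = Sum.inl true then phaseSign p else 0) else 0)) (FP.symPair hl hr)
      (FP.symPair (Window.FP.scan h1) (Window.FP.scan h2)) FP.snd

theorem phaseSign_eq (p : Fin 4) : ((phaseSign p : ℤ) : ℝ) = (Complex.I ^ p.val).re := by
  fin_cases p <;> simp [phaseSign, pow_succ]

/-- Expanding both amplitudes into real and imaginary parts gives four integer products. An
imaginary part contributes the phase `i` in the first path, and `i ^ 3 = -i` in the conjugated
second one; clearing both denominators costs `2 ^ (2 * b)`. -/
theorem sum_parts (V V' : Bool → ℤ) (b : ℕ) (w : ℂ) :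
    ∑ p, ∑ p', (V p : ℝ) * V' p' * (Complex.I ^ ((bif p then 0 else 1) +
      (bif p' then 0 else 3) : Fin 4).val * w).re =
      2 ^ (2 * b) * ((V true + V false * Complex.I) / 2 ^ b *
        conj ((V' true + V' false * Complex.I) / 2 ^ b) * w).re := by
  have h : (2 : ℂ) ^ (2 * b) * ((V true + V false * Complex.I) / 2 ^ b *
        conj ((V' true + V' false * Complex.I) / 2 ^ b) * w) =
      (V true + V false * Complex.I) * (V' true - V' false * Complex.I) * w := by
    simp only [map_div₀, map_add, map_mul, map_pow, Complex.conj_I, map_intCast, map_ofNat]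
    rw [mul_comm 2 b, pow_mul]
    field_simp
    ring
  have e : ∀ (r : ℝ) (z : ℂ), r * z.re = ((r : ℂ) * z).re := fun r z => by simp
  rw [e]
  push_cast
  rw [h]
  simp only [Fintype.sum_bool, e, ← Complex.add_re]
  congr 1
  simp only [cond_true, cond_false, I_pow_add]
  have h3 : Complex.I ^ (3 : Fin 4).val = -Complex.I := Complex.I_pow_three
  have h1 : Complex.I ^ (1 : Fin 4).val = Complex.I := pow_one _
  have h0 : Complex.I ^ (0 : Fin 4).val = 1 := pow_zero _
  rw [h0, h1, h3]
  push_cast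
  ring

/-- Each window keeps its total length `n` as long as `k` steps cannot leave it, which the four
inequalities guarantee. The phase `p` varies in the induction, and the real part is taken only at
the end, by `phaseSign`. -/
theorem pathSum_pairSystem (V : M.State × M.Symbol → M.Move × Bool → ℕ → ℤ) (b W n : ℕ) (k : ℕ) :
    ∀ (z z' : M.Window) (c c' : M.Config) (p : Fin 4), z.Represents W c → z'.Represents W c' →
      z.2.1.length + z.2.2.length = n → z'.2.1.length + z'.2.2.length = n →
      k ≤ z.2.1.length → k ≤ z.2.2.length → k ≤ z'.2.1.length → k ≤ z'.2.2.length →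
      ((pairSystem M V).pathSum b k ((z, z'), Sym.mk p) : ℝ) =
        2 ^ (2 * b * k) * (Complex.I ^ p.val * pairValue (approxAmp V b) k c c').re := by
  classical
  induction k with
  | zero =>
    intro z z' c c' p hz hz' hn hn' _ _ _ _
    have heq := hz.eq_iff hz' (hn.trans hn'.symm)
    rw [PathSystem.pathSum, mul_zero, pow_zero, one_mul, pairValue]
    have hobs : M.obs z.scan.1 z.scan.2 = c.obs := by rw [hz.scan]; rfl
    simp only [pairSystem, hobs]
    by_cases h : z = z'
    · subst h
      rw [if_congr (and_iff_right (heq.2 rfl)) rfl rfl]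
      simp only [decide_true, Bool.and_self, cond_true, true_and]
      split_ifs
      · rw [mul_one, phaseSign_eq]
      · simp
    · rw [if_neg (fun h' : c = c' ∧ _ => h (heq.1 h'.1)), mul_zero, Complex.zero_re]
      by_cases h1 : z.2.1 = z'.2.1 ∧ z.2.2 = z'.2.2
      · rw [if_neg]
        · simp
        · exact fun h' => h (Prod.ext (Sym.ext h'.1) (Prod.ext h1.1 h1.2))
      · have : (decide (z.2.1 = z'.2.1) && decide (z.2.2 = z'.2.2)) = false := by
          simpa using h1
        rw [this]
        simp
  | succ k ih =>
    intro z z' c c' p hz hz' hn hn' h1 h2 h3 h4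
    have hobs : M.obs z.scan.1 z.scan.2 = c.obs := by rw [hz.scan]; rfl
    have hobs' : M.obs z'.scan.1 z'.scan.2 = c'.obs := by rw [hz'.scan]; rfl
    rw [PathSystem.pathSum, pairValue, Fintype.sum_option]
    push_cast
    by_cases ho : c.obs = c'.obs
    · rw [if_pos ho]
      by_cases hl : c.obs.isLeft
      · rw [if_pos hl, Finset.sum_eq_zero, add_zero]
        -- A halted pair idles with weight `2 ^ b * 2 ^ b`, so every step contributes the same scale
        -- and all pairs share the normalisation `2 ^ (2 * b * k)`.
        · have : (pairSystem M V).stepWeight b none ((z, z'), Sym.mk p) = 2 ^ b * 2 ^ b := by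
            simp [PathSystem.stepWeight, pairSystem, pairIndex, hobs, hobs', ho, ho ▸ hl]
          rw [this]
          change _ * (((pairSystem M V).pathSum b k ((z, z'), Sym.mk p) : ℤ) : ℝ) = _
          rw [ih z z' c c' p hz hz' hn hn' (by omega) (by omega) (by omega) (by omega)]
          push_cast
          ring
        · intro j _
          have : (pairSystem M V).stepWeight b (some j) ((z, z'), Sym.mk p) = 0 := by
            simp [PathSystem.stepWeight, pairSystem, pairIndex, hobs, hobs', ho, ho ▸ hl]
          rw [this]
          simp
      · rw [if_neg hl]
        have h0 : (pairSystem M V).stepWeight b none ((z, z'), Sym.mk p) = 0 := by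
          simp [PathSystem.stepWeight, pairSystem, pairIndex, hobs, hobs', ho, ho ▸ hl]
        have hs : ∀ j, (pairSystem M V).stepWeight b (some j) ((z, z'), Sym.mk p) =
            V (c.state, c.tape c.head) j.1 b * V (c'.state, c'.tape c'.head) j.2 b := by
          intro j
          rw [← hz.scan, ← hz'.scan]
          simp [PathSystem.stepWeight, pairSystem, pairIndex, hobs, hobs', ho, ho ▸ hl]
        have hlen : ∀ (z : M.Window) (j : M.Move), 1 ≤ z.2.1.length → 1 ≤ z.2.2.length →
            (z.move j).2.1.length + (z.move j).2.2.length = z.2.1.length + z.2.2.length ∧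
            z.2.1.length ≤ (z.move j).2.1.length + 1 ∧
            z.2.2.length ≤ (z.move j).2.2.length + 1 := by
          rintro z ⟨τ, q, d⟩ _ _
          cases d <;> simp only [Window.move, cond_true, cond_false, List.length_cons,
            List.length_tail] <;> omega
        have hstep : ∀ j : (M.Move × Bool) × (M.Move × Bool), ((pairSystem M V).pathSum b k
            ((pairSystem M V).step (some j) ((z, z'), Sym.mk p)) : ℝ) =
            2 ^ (2 * b * k) * (Complex.I ^ (p + ((bif j.1.2 then 0 else 1) +
              (bif j.2.2 then 0 else 3)) : Fin 4).val *
              pairValue (approxAmp V b) k (c.move j.1.1) (c'.move j.2.1)).re := by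
          intro j
          have l1 := hlen z j.1.1 (by omega) (by omega)
          have l2 := hlen z' j.2.1 (by omega) (by omega)
          exact ih (z.move j.1.1) (z'.move j.2.1) _ _ _ (hz.move (by omega) _) (hz'.move (by omega) _) (by omega) (by omega)
            (by omega) (by omega) (by omega) (by omega)
        simp only [hstep, hs, h0]
        rw [Int.cast_zero, zero_mul, zero_add, sum_pairs]
        rw [Finset.mul_sum, Complex.re_sum, Finset.mul_sum]
        refine Finset.sum_congr rfl fun j _ => ?_
        rw [Finset.mul_sum, Complex.re_sum, Finset.mul_sum]
        refine Finset.sum_congr rfl fun j' _ => ?_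
        have key := sum_parts (fun q => V (c.state, c.tape c.head) (j, q) b)
          (fun q => V (c'.state, c'.tape c'.head) (j', q) b) b
          (Complex.I ^ p.val * pairValue (approxAmp V b) k (c.move j) (c'.move j'))
        rw [Nat.mul_succ, pow_add]
        have e : Complex.I ^ p.val * (approxAmp V b c j * conj (approxAmp V b c' j') *
            pairValue (approxAmp V b) k (c.move j) (c'.move j')) =
            approxAmp V b c j * conj (approxAmp V b c' j') * (Complex.I ^ p.val *
              pairValue (approxAmp V b) k (c.move j) (c'.move j')) := by ring
        rw [e]
        refine Eq.trans ?_ ((congrArg (2 ^ (2 * b * k) * ·) key).trans (mul_assoc _ _ _).symm)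
        simp only [Finset.mul_sum]
        refine Finset.sum_congr rfl fun q _ => Finset.sum_congr rfl fun q' _ => ?_
        rw [I_pow_add p]
        push_cast
        rw [mul_comm (Complex.I ^ p.val), mul_assoc (Complex.I ^ _)]
        ring
    · rw [if_neg ho, mul_zero, Complex.zero_re, mul_zero]
      have : ∀ k, (pairSystem M V).stepWeight b k ((z, z'), Sym.mk p) = 0 := by
        intro k
        simp [PathSystem.stepWeight, pairSystem, pairIndex, hobs, hobs', ho]
      simp [this]

theorem amp_approx {V : M.State × M.Symbol → M.Move × Bool → ℕ → ℤ}
    (hV : ∀ s j b, |(M.δ s.1 s.2 j.1 j.2.1 (bif j.2.2 then Dir.right else Dir.left)).re -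
      (V s (j, true) b : ℝ) / 2 ^ b| ≤ 1 / 2 ^ b)
    (hV' : ∀ s j b, |(M.δ s.1 s.2 j.1 j.2.1 (bif j.2.2 then Dir.right else Dir.left)).im -
      (V s (j, false) b : ℝ) / 2 ^ b| ≤ 1 / 2 ^ b) (b : ℕ) (c : M.Config) (j : M.Move) :
    ‖c.amp j - approxAmp V b c j‖ ≤ 2 / 2 ^ b := by
  have e : approxAmp V b c j = ((V (c.state, c.tape c.head) (j, true) b / 2 ^ b : ℝ) : ℂ) +
      ((V (c.state, c.tape c.head) (j, false) b / 2 ^ b : ℝ) : ℂ) * Complex.I := by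
    unfold approxAmp
    push_cast
    ring
  refine (Complex.norm_le_abs_re_add_abs_im _).trans ?_
  have h1 := hV (c.state, c.tape c.head) j b
  have h2 := hV' (c.state, c.tape c.head) j b
  rw [e]
  simp only [Complex.sub_re, Complex.sub_im, Complex.add_re, Complex.add_im, Complex.ofReal_re,
    Complex.ofReal_im, Complex.re_ofReal_mul, Complex.im_ofReal_mul, Complex.I_re, Complex.I_im,
    mul_zero, mul_one, add_zero, zero_add]
  refine (add_le_add h1 h2).trans_eq ?_
  ring

theorem exists_gapP_approx (hE : M.EfficientAmplitudes) (t : Polynomial ℕ) (k : ℕ) :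
    ∃ g ∈ GapP, ∃ r : Polynomial ℕ, ∀ x : Str, |(g x : ℝ) / 2 ^ r.eval x.length -
      M.answerProb x (t.eval x.length) true| ≤ 1 / 2 ^ k := by
  have hE' : ∀ (s : M.State × M.Symbol) (j : M.Move × Bool), IsEfficientReal
      (bif j.2 then (M.δ s.1 s.2 j.1.1 j.1.2.1 (bif j.1.2.2 then Dir.right else Dir.left)).re else
        (M.δ s.1 s.2 j.1.1 j.1.2.1 (bif j.1.2.2 then Dir.right else Dir.left)).im) := by
    rintro s ⟨j, _ | _⟩
    · exact (hE _ _ _ _ _).2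
    · exact (hE _ _ _ _ _).1
  choose V hVp hV using hE'
  obtain ⟨A₀, hA₀⟩ := Finite.exists_le fun i : (M.State × M.Symbol) × M.Move =>
    ‖M.δ i.1.1 i.1.2 i.2.1 i.2.2.1 (bif i.2.2.2 then Dir.right else Dir.left)‖
  -- The approximate amplitudes deviate by at most `2`, so this bounds both them and the exact ones,
  -- and it is at least one.
  let A : ℝ := |A₀| + 3
  have hA : 1 ≤ A := by
    have := abs_nonneg A₀
    simp only [A]
    linarith
  have ha : ∀ (c : M.Config) (j : M.Move), ‖c.amp j‖ ≤ |A₀| := fun c j =>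
    (hA₀ ((c.state, c.tape c.head), j)).trans (le_abs_self _)
  have happ := amp_approx (fun s j b => hV s (j, true) b) (fun s j b => hV s (j, false) b)
  have ha' : ∀ (b : ℕ) (c : M.Config) (j : M.Move), ‖approxAmp V b c j‖ ≤ A := by
    intro b c j
    have h1 := norm_sub_norm_le (approxAmp V b c j) (c.amp j)
    rw [norm_sub_rev] at h1
    have h2 := happ b c j
    have h3 : (2 : ℝ) / 2 ^ b ≤ 2 := div_le_self (by norm_num) (one_le_pow₀ (by norm_num))
    have h4 := ha c j
    simp only [A]
    linarith
  -- `2 ^ K` exceeds the factor by which the error grows in one step. With precision `K * t + k + 1`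
  -- the total error is at most `2 / 2 ^ b * 2 ^ (K * t) = 2 ^ (-k)`.
  obtain ⟨K, hK⟩ := pow_unbounded_of_one_lt (2 * (2 * (Fintype.card M.Move : ℝ) ^ 2 * A ^ 2))
    one_lt_two
  let b : Polynomial ℕ := Polynomial.C K * t + Polynomial.C (k + 1)
  refine ⟨_, (pairSystem_efficient fun s j => FP.of_isPolyTime_unary (hVp s j)).pathSum_mem_GapP
    (init := fun x => ((Window.init M (t.eval x.length) x, Window.init M (t.eval x.length) x),
      Sym.mk 0)) ((Window.FP.init.pair Window.FP.init).pair (FP.const _)) b t,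
      Polynomial.C 2 * b * t, fun x => ?_⟩
  set T := t.eval x.length with hT
  have hr : (Polynomial.C 2 * b * t).eval x.length = 2 * b.eval x.length * T := by
    simp [hT]
  have hb : b.eval x.length = K * T + (k + 1) := by
    simp [b, hT]
  have hw := Window.represents_init M T x
  -- The initial window has a margin of `T` blank cells on either side of the input, so `T` steps
  -- stay inside it.
  have hp := pathSum_pairSystem V (b.eval x.length) T _ T _ _ _ _ 0 hw hw rfl rfl
    (by simp [Window.init]) (by simp [Window.init]) (by simp [Window.init])
    (by simp [Window.init])
  have herr := norm_pairValue_sub_le hA (fun c j => (ha c j).trans (by simp [A]))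
    (ha' (b.eval x.length)) (happ (b.eval x.length)) T (M.initConfig x) (M.initConfig x)
  have h2 : (0 : ℝ) < 2 ^ (2 * b.eval x.length * T) := by positivity
  rw [hr, hp, mul_div_cancel_left₀ _ h2.ne', Fin.val_zero, pow_zero, one_mul, abs_sub_comm]
  have hre : M.answerProb x T true =
      (pairValue Config.amp T (M.initConfig x) (M.initConfig x)).re := by
    rw [← answerProb_true, Complex.ofReal_re]
  rw [hre, ← Complex.sub_re]
  refine (Complex.abs_re_le_norm _).trans (herr.trans ?_)
  have hKT : (2 * (2 * (Fintype.card M.Move : ℝ) ^ 2 * A ^ 2)) ^ T ≤ 2 ^ (K * T) := by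
    rw [pow_mul]
    have : 0 ≤ 2 * (2 * (Fintype.card M.Move : ℝ) ^ 2 * A ^ 2) := by positivity
    gcongr
  calc (2 : ℝ) / 2 ^ b.eval x.length * (2 * (2 * (Fintype.card M.Move : ℝ) ^ 2 * A ^ 2)) ^ T
      ≤ 2 / 2 ^ b.eval x.length * 2 ^ (K * T) := by gcongr
    _ = 1 / 2 ^ k := by
      rw [hb, pow_add, pow_succ]
      field_simp

end QTM

/-! ### The inclusion of BQP in AWPP, and the theorem -/

theorem BQP_subset_AWPP : BQP ⊆ AWPP := by
  rintro L ⟨M, hW, hE, t, h⟩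
  refine mem_AWPP_of_approx (P := fun x => M.answerProb x (t.eval x.length) true) (c := 1 / 3)
    (by norm_num) (fun x => ?_) (M.exists_gapP_approx hE t)
  have h1 := M.answerProb_add_le_one hW x (t.eval x.length)
  have h2 := M.answerProb_nonneg x (t.eval x.length)
  constructor
  · intro hx
    have := (h x).2.1 hx
    have := h2 false
    constructor <;> linarith
  · intro hx
    have := (h x).2.2 hx
    exact ⟨h2 true, by linarith⟩

end WeightedCounting

theorem mainTheorem10 :
    (∀ L : Language Bool,
      L ∈ WeightedCounting.AWPP ↔
        ∃ g ∈ WeightedCounting.WeightedSharpP Set.univ, ∃ c : ℝ, c < 1 / 2 ∧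
          ∀ x : List Bool,
            (x ∈ L → 1 - c ≤ g x ∧ g x ≤ 1) ∧ (x ∉ L → 0 ≤ g x ∧ g x ≤ c)) ∧
    WeightedCounting.BQP ⊆ WeightedCounting.AWPP ∧
    WeightedCounting.BQP ⊆ WeightedCounting.PP := ⟨fun _ =>
    ⟨WeightedCounting.exists_weighted_of_mem_AWPP, fun ⟨_, hg, _, hc, hL⟩ =>
      WeightedCounting.mem_AWPP_of_weighted hg hc hL⟩,
    WeightedCounting.BQP_subset_AWPP,
    WeightedCounting.BQP_subset_AWPP.trans WeightedCounting.AWPP_subset_PP⟩
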